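/- Let $\omega=e^{i\pi/4}$. For a finite number $k$ of qubits let $\mathcal D_3$ be the group of diagonal unitaries $U_F=\sum_{x\in\mathbb Z_2^k}\omega^{F(x)}|x\rangle\langle x|$ with $F(x)=L(x)+2Q(x)+4C(x)\bmod 8$, where $L,Q,C$ are linear, quadratic and cubic polynomials (without constant term) with integer coefficients in $x_1,\dots,x_k\in\{0,1\}$. For $U\in\mathcal D_3$ let $\tau[U]$ be the least number of $T$ gates in a circuit over $\{\mathrm{CNOT},S,T\}$ without ancillas that equals $U$, and let $\mu[U]$ be the minimum of $\tau[V]$ over all factorisations $U=VW$ in which $W$ is a product of CCZ gates. A noisy $T$-state of error rate $\epsilon$ is $(1-\epsilon)|T\rangle\langle T|+\epsilon Z|T\rangle\langle T|Z$ with $|T\rangle=T|+\rangle$. **The synthillation protocol** with $n$ noisy $T$-states for unitaries $U_1,\dots,U_l$ on $k_1,\dots,k_l$ qubits; put $k=\sum_j k_j$ and $U_F=\bigotimes_j U_j$. It is given by a full-rank binary matrix $G=\binom{K}{S}$ with $k+s$ rows whose columns are the qubits of a code block; by $n$ of these columns, the $T$ sites, where the number of remaining columns is exactly the rank deficiency of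 the submatrix of $G$ on the $T$ sites (so if that submatrix has full rank, the block has exactly $n$ qubits, all of them $T$ sites); by a CNOT circuit $E_G$ with $E_G|x,y,0\rangle=|K^{T}x\oplus S^{T}y\rangle$; and by a diagonal Clifford circuit $\tilde C$ such that $\tilde C|x,y\rangle=d(x,y)|x,y\rangle$ with $d(x,y)\,\omega^{w(x,y)}=\omega^{F(x)}$ for all $x,y$, where $w(x,y)$ is the Hamming weight of $K^{T}x\oplus S^{T}y$ on the $T$ sites. The protocol prepares $|+\rangle^{\otimes (k+s)}|0\cdots0\rangle$, applies $E_G$, applies one $T$ gate at each $T$ site by injecting one noisy $T$-state (CNOT, measurement, conditional $S$), applies $E_G^\dagger$ and $\tilde C$, and measures the $s$ qubits of $y$ in the $X$ basis. It succeeds if all these outcomes are $+$. On success the first $k$ qubits hold a noisy copy of $U_F|+\rangle^{\otimes k}$, and each $U_j$ is then teleported from its part of this state into the computation: CNOTs from the resource qubits to the data qubits, measurement of the data qubits with outcome $a$, and the Clifford correction $U_jX[a]U_j^\dagger$ (up to a phase). Apart from the noisy $T$-states all operations are noiseless. **Theorem.** Let $U_1,\dots,U_l$ be in $\mathcal D_3$,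 on $k_1,\dots,k_l$ qubits respectively, and let $U_F=\bigotimes_j U_j$. There are an integer $\Delta$ with $0\le\Delta\le 11$ and a synthillation protocol for $U_1,\dots,U_l$, independent of $\epsilon$, that uses $$n=\tau[U_F]+2\mu[U_F]+\Delta\le 3\tau[U_F]+\Delta$$ noisy $T$-states of error rate $\epsilon$ and implements $U_1,\dots,U_l$ with success probability $p(\epsilon)=1-n\epsilon+O(\epsilon^2)$ and error rate $\delta(\epsilon)=O(\epsilon^2)$ as $\epsilon\to0^+$. That is, in any computation on any finite number of qubits with any initial state, in which $U_1,\dots,U_l$ are applied one after the other, each to arbitrarily chosen distinct qubits, with an arbitrary unitary before each of them, and for every $\epsilon\in[0,1]$: the run succeeds with probability $p(\epsilon)$, and the unnormalised output state on success is $p(\epsilon)\bigl((1-\delta(\epsilon))\,\rho_{\mathrm{ideal}}+\delta(\epsilon)\,\eta\bigr)$, where $\rho_{\mathrm{ideal}}$ is the output state of the ideal computation, $\eta$ is some density matrix and $0\le\delta(\epsilon)\le1$. The functions $p$ and $\delta$ do not depend on the computation, on its initial state, or on where the $U_j$ are applied. -/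

import Mathlib

open scoped ComplexOrder Topology

noncomputable section

namespace Synth

/-! ### Qubits, operators, elementary gates -/

/-- Labels of the computational basis of a system with one qubit for each `i : ι`. -/
abbrev Bits (ι : Type) := ι → ZMod 2

/-- Operators (unitaries, density matrices, ...) on the qubits labelled by `ι`. -/
abbrev Op (ι : Type) := Matrix (Bits ι) (Bits ι) ℂ

/-- `ω = exp(iπ/4)`. -/
def omega : ℂ := Complex.exp (Complex.I * (Real.pi / 4 : ℝ))

/-- The gate `diag(1, ζ)` on qubit `i`. -/
def phaseOp {ι : Type} [Fintype ι] [DecidableEq ι] (ζ : ℂ) (i : ι) : Op ι :=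
  Matrix.diagonal fun x => ζ ^ (x i).val

/-- The CNOT gate with control `i` and target `j`. -/
def cnotOp {ι : Type} [Fintype ι] [DecidableEq ι] (i j : ι) : Op ι :=
  Matrix.of fun x y => if x = Function.update y j (y j + y i) then 1 else 0

/-- The Hadamard gate on qubit `i`. -/
def hadamardOp {ι : Type} [Fintype ι] [DecidableEq ι] (i : ι) : Op ι :=
  Matrix.of fun x y =>
    if ∀ a, a ≠ i → x a = y a then (-1) ^ ((x i).val * (y i).val) / (Real.sqrt 2 : ℂ) else 0

/-- The CCZ gate on the qubits `i`, `j`, `m`. -/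
def cczOp {ι : Type} [Fintype ι] [DecidableEq ι] (i j m : ι) : Op ι :=
  Matrix.diagonal fun x => (-1) ^ ((x i).val * (x j).val * (x m).val)

/-- The product of Pauli `X` operators `X[a]`, that is `|y⟩ ↦ |y ⊕ a⟩`. -/
def shiftOp {ι : Type} [Fintype ι] [DecidableEq ι] (a : Bits ι) : Op ι :=
  Matrix.of fun x y => if x = y + a then 1 else 0

/-- The projector onto the outcome `b` of a computational basis measurement of qubit `i`. -/
def projOp {ι : Type} [Fintype ι] [DecidableEq ι] (i : ι) (b : ZMod 2) : Op ι :=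
  Matrix.diagonal fun x => if x i = b then 1 else 0

/-- The basis vector `|x⟩`. -/
def ket {ι : Type} [Fintype ι] [DecidableEq ι] (x : Bits ι) : Bits ι → ℂ := Pi.single x 1

/-- `ρ ↦ M ρ M†`. -/
def conj {ι : Type} [Fintype ι] [DecidableEq ι] (M ρ : Op ι) : Op ι :=
  M * ρ * M.conjTranspose

open Classical in
/-- The operator `M` on the qubits `κ`, acting on the qubits `f i` of a larger system
and as the identity on all other qubits. -/
def embedOp {κ ι : Type} (f : κ ↪ ι) (M : Op κ) : Op ι :=
  Matrix.of fun x y => if ∀ a, a ∉ Set.range f → x a = y a then M (x ∘ f) (y ∘ f) else 0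

/-- Density matrices. -/
def IsState {ι : Type} [Fintype ι] [DecidableEq ι] (ρ : Op ι) : Prop :=
  ρ.PosSemidef ∧ ρ.trace = 1

/-- Partial trace over the second group of qubits. -/
def ptrace {ι κ : Type} [Fintype κ] [DecidableEq κ] (ρ : Op (ι ⊕ κ)) : Op ι :=
  Matrix.of fun x y => ∑ e : Bits κ, ρ (Sum.elim x e) (Sum.elim y e)

/-- The operator of a circuit; the first gate of the list acts first. -/
def circuitOp {γ ι : Type} [Fintype ι] [DecidableEq ι] (f : γ → Op ι) : List γ → Op ι
  | [] => 1
  | g :: c => circuitOp f c * f g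

/-! ### The group `D₃`, the `T`-count and the quantity `μ` -/

/-- The weighted polynomial `L(x) + 2 Q(x) + 4 C(x)` modulo 8. -/
def weightedPoly {ι : Type} [Fintype ι] (a : ι → ZMod 8) (b : ι → ι → ZMod 8)
    (c : ι → ι → ι → ZMod 8) (x : Bits ι) : ZMod 8 :=
  ∑ i, a i * ((x i).val : ZMod 8)
    + 2 * ∑ i, ∑ j, b i j * ((x i).val : ZMod 8) * ((x j).val : ZMod 8)
    + 4 * ∑ i, ∑ j, ∑ m,
        c i j m * ((x i).val : ZMod 8) * ((x j).val : ZMod 8) * ((x m).val : ZMod 8)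

/-- The diagonal unitaries `U_F = ∑ₓ ω^{F(x)} |x⟩⟨x|` with `F` a weighted polynomial. -/
def D3 (ι : Type) [Fintype ι] [DecidableEq ι] : Set (Op ι) :=
  {U | ∃ a b c, U = Matrix.diagonal fun x => omega ^ (weightedPoly a b c x).val}

/-- The gate set `{CNOT, S, T}` of ancilla-free synthesis. -/
inductive SynthGate (ι : Type) where
  | cnot (i j : ι) (h : i ≠ j) : SynthGate ι
  | s (i : ι) : SynthGate ι
  | t (i : ι) : SynthGate ι

def SynthGate.op {ι : Type} [Fintype ι] [DecidableEq ι] : SynthGate ι → Op ι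
  | .cnot i j _ => cnotOp i j
  | .s i => phaseOp Complex.I i
  | .t i => phaseOp omega i

/-- The number of `T` gates of a circuit. -/
def numT {ι : Type} : List (SynthGate ι) → ℕ
  | [] => 0
  | .t _ :: c => numT c + 1
  | .cnot _ _ _ :: c => numT c
  | .s _ :: c => numT c

/-- The ancilla-free `T`-count `τ[U]` (`⊤` if no circuit realises `U` exactly). -/
def tau {ι : Type} [Fintype ι] [DecidableEq ι] (U : Op ι) : ℕ∞ :=
  ⨅ (c : List (SynthGate ι)) (_ : circuitOp SynthGate.op c = U), (numT c : ℕ∞)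

/-- The circuits composed purely of CCZ gates (on three distinct qubits). -/
def cczCircuits (ι : Type) [Fintype ι] [DecidableEq ι] : Submonoid (Op ι) :=
  Submonoid.closure {W | ∃ i j m : ι, i ≠ j ∧ j ≠ m ∧ i ≠ m ∧ W = cczOp i j m}

/-- `μ[U]`: the minimum of `τ[V]` over all `U = V W` with `W` composed purely of CCZ gates. -/
def mu {ι : Type} [Fintype ι] [DecidableEq ι] (U : Op ι) : ℕ∞ :=
  ⨅ (V : Op ι) (W : Op ι) (_ : W ∈ cczCircuits ι) (_ : U = V * W), tau V

/-! ### Adaptive Clifford programs -/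

inductive CliffordGate (ι : Type) where
  | hadamard (i : ι) : CliffordGate ι
  | s (i : ι) : CliffordGate ι
  | cnot (i j : ι) (h : i ≠ j) : CliffordGate ι

def CliffordGate.op {ι : Type} [Fintype ι] [DecidableEq ι] : CliffordGate ι → Op ι
  | .hadamard i => hadamardOp i
  | .s i => phaseOp Complex.I i
  | .cnot i j _ => cnotOp i j

/-- Relabelling of the qubits. -/
def CliffordGate.map {κ ι : Type} (f : κ ↪ ι) : CliffordGate κ → CliffordGate ι
  | .hadamard i => .hadamard (f i)
  | .s i => .s (f i)
  | .cnot i j h => .cnot (f i) (f j) (f.injective.ne h)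

/-- Programs made of Clifford gates, computational basis measurements with classical
feed-forward, and heralded failure (`abort`). -/
inductive Prog (ι : Type) where
  | skip : Prog ι
  | abort : Prog ι
  | gate (g : CliffordGate ι) : Prog ι
  | seq (p q : Prog ι) : Prog ι
  | measure (i : ι) (next : ZMod 2 → Prog ι) : Prog ι

/-- The unnormalised state after a run that did not abort, summed over all measurement
outcomes; its trace is the probability of not aborting. -/
def Prog.run {ι : Type} [Fintype ι] [DecidableEq ι] : Prog ι → Op ι → Op ι
  | .skip, ρ => ρ
  | .abort, _ => 0
  | .gate g, ρ => conj g.op ρ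
  | .seq p q, ρ => q.run (p.run ρ)
  | .measure i next, ρ => ∑ b : ZMod 2, (next b).run (conj (projOp i b) ρ)

def Prog.map {κ ι : Type} (f : κ ↪ ι) : Prog κ → Prog ι
  | .skip => .skip
  | .abort => .abort
  | .gate g => .gate (g.map f)
  | .seq p q => .seq (p.map f) (q.map f)
  | .measure i next => .measure (f i) fun b => (next b).map f

/-- Sequential composition. -/
def Prog.ofList {ι : Type} (ps : List (Prog ι)) : Prog ι := ps.foldr Prog.seq Prog.skip

/-- A Clifford circuit as a program. -/
def Prog.circuit {ι : Type} (c : List (CliffordGate ι)) : Prog ι :=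
  Prog.ofList (c.map Prog.gate)

/-- Measure all listed qubits and continue depending on the outcomes. -/
def Prog.measureAll {ι : Type} [DecidableEq ι] :
    List ι → (Bits ι → Prog ι) → Prog ι
  | [], next => next 0
  | i :: is, next =>
      .measure i fun b => Prog.measureAll is fun o => next (Function.update o i b)

/-! ### Noisy `T`-states -/

/-- The state `T|+⟩ = (|0⟩ + ω|1⟩)/√2`. -/
def magic (b : ZMod 2) : ℂ := omega ^ b.val / (Real.sqrt 2 : ℂ)

/-- The state `Z T|+⟩`. -/
def magicZ (b : ZMod 2) : ℂ := (-1) ^ b.val * magic b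

/-- The noisy `T`-state: a `Z` error has occurred with probability `ε`. -/
def noisyT (ε : ℝ) : Matrix (ZMod 2) (ZMod 2) ℂ :=
  ((1 - ε : ℝ) : ℂ) • Matrix.vecMulVec magic (star magic)
    + (ε : ℂ) • Matrix.vecMulVec magicZ (star magicZ)

/-! ### The synthillation protocol -/

/-- The qubits on which `U₁ ⊗ ⋯ ⊗ U_l` acts. -/
abbrev Reg {l : ℕ} (k : Fin l → ℕ) : Type := (j : Fin l) × Fin (k j)

/-- The tensor product `U₁ ⊗ ⋯ ⊗ U_l`. -/
def tensorOp {l : ℕ} {k : Fin l → ℕ} (U : ∀ j, Op (Fin (k j))) : Op (Reg k) :=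
  Matrix.of fun x y => ∏ j, U j (fun i => x ⟨j, i⟩) (fun i => y ⟨j, i⟩)

/-- The qubits of the code block: logical qubits, `s` gauge qubits (prepared in `|+⟩` and
measured at the end), `m` qubits prepared in `|0⟩`. -/
abbrev Block {l : ℕ} (k : Fin l → ℕ) (s m : ℕ) : Type := (Reg k ⊕ Fin s) ⊕ Fin m

/-- A pair of distinct qubits: control and target of a CNOT. -/
abbrev CnotPair (ι : Type) : Type := {p : ι × ι // p.1 ≠ p.2}

def CnotPair.gate {ι : Type} (p : CnotPair ι) : CliffordGate ι := .cnot p.1.1 p.1.2 p.2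

/-- A synthillation protocol for `U₁, …, U_l` with `n` noisy `T`-states: a binary matrix
`G = (K / S)`, a CNOT encoder for it, a diagonal Clifford correction that makes the code
quasitransversal for `U₁ ⊗ ⋯ ⊗ U_l`, and the Clifford corrections of gate teleportation. -/
structure Synthillation {l : ℕ} (k : Fin l → ℕ) (U : ∀ j, Op (Fin (k j))) where
  /-- number of noisy `T`-states -/
  n : ℕ
  s : ℕ
  m : ℕ
  /-- the generator matrix; its rows are the rows of `K` followed by those of `S`, its
  columns belong to the physical qubits -/
  G : Matrix (Reg k ⊕ Fin s) (Block k s m) (ZMod 2)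
  /-- the physical qubits that undergo a `T` gate -/
  site : Fin n ↪ Block k s m
  /-- physical qubits without a `T` gate are present only as far as they are needed to give
  `G` full rank; if the columns at the `T` sites have full rank already, there are
  exactly `n` physical qubits, each with a `T` gate -/
  site_spec : m + (G.submatrix id site).rank = n
  /-- the encoder `E_G`, a CNOT circuit with `E_G |x, y, 0⟩ = |Kᵀ x ⊕ Sᵀ y⟩` -/
  encoder : List (CnotPair (Block k s m))
  encoder_spec : ∀ z : Bits (Reg k ⊕ Fin s),
    (circuitOp CliffordGate.op (encoder.map CnotPair.gate)).mulVec (ket (Sum.elim z 0))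
      = ket (G.transpose.mulVec z)
  /-- the diagonal Clifford correction -/
  correction : List (CliffordGate (Reg k ⊕ Fin s))
  correction_spec : ∃ d : Bits (Reg k ⊕ Fin s) → ℂ,
    circuitOp CliffordGate.op correction = Matrix.diagonal d ∧
    ∀ z, d z * omega ^ (∑ c, (G.transpose.mulVec z (site c)).val)
      = tensorOp U (z ∘ Sum.inl) (z ∘ Sum.inl)
  /-- the Clifford corrections `U_j X[a] U_j†` (up to a phase) of gate teleportation -/
  fixup : ∀ j, Bits (Fin (k j)) → List (CliffordGate (Fin (k j)))
  fixup_spec : ∀ j a, ∃ ζ : ℂ, ‖ζ‖ = 1 ∧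
    circuitOp CliffordGate.op (fixup j a) * (U j * shiftOp a) = ζ • U j

namespace Synthillation

/-- The code block together with the `T`-states. -/
abbrev Lab {l : ℕ} {k : Fin l → ℕ} {U : ∀ j, Op (Fin (k j))} (P : Synthillation k U) : Type :=
  Block k P.s P.m ⊕ Fin P.n

/-- The list of all qubits of `Reg k`. -/
def regList {l : ℕ} (k : Fin l → ℕ) : List (Reg k) :=
  (List.finRange l).flatMap fun j => (List.finRange (k j)).map fun i => ⟨j, i⟩

/-- Injection of the `c`-th noisy `T`-state: a `T` gate on its site, by CNOT, measurement of
the `T`-state qubit and a conditional `S` gate. -/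
def inject {l : ℕ} {k : Fin l → ℕ} {U : ∀ j, Op (Fin (k j))} (P : Synthillation k U)
    (c : Fin P.n) : Prog P.Lab :=
  .seq (.gate (.cnot (Sum.inl (P.site c)) (Sum.inr c) Sum.inl_ne_inr))
    (.measure (Sum.inr c) fun b =>
      if b = 1 then .gate (.s (Sum.inl (P.site c))) else .skip)

/-- Heralded preparation of the resource state `U_F |+⟩^{⊗k}` on the logical qubits. -/
def prepare {l : ℕ} {k : Fin l → ℕ} {U : ∀ j, Op (Fin (k j))} (P : Synthillation k U) :
    Prog P.Lab :=
  let gauge : List P.Lab := (List.finRange P.s).map fun i => Sum.inl (Sum.inl (Sum.inr i))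
  let logical : List P.Lab := (regList k).map fun a => Sum.inl (Sum.inl (Sum.inl a))
  Prog.ofList [
    -- prepare the logical and the gauge qubits in `|+⟩`
    Prog.circuit ((logical ++ gauge).map CliffordGate.hadamard),
    -- encode
    (Prog.circuit (P.encoder.map CnotPair.gate)).map Function.Embedding.inl,
    -- the noisy `T` gates
    Prog.ofList ((List.finRange P.n).map P.inject),
    -- decode
    (Prog.circuit (P.encoder.reverse.map CnotPair.gate)).map Function.Embedding.inl,
    -- Clifford correction
    (Prog.circuit P.correction).map (Function.Embedding.inl.trans Function.Embedding.inl),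
    -- measure the gauge qubits in the `X` basis and accept only if all outcomes are `+`
    Prog.circuit (gauge.map CliffordGate.hadamard),
    Prog.measureAll gauge fun o => if ∀ w ∈ gauge, o w = 0 then .skip else .abort]

/-- Teleportation of `U_j`; the first copy of the `k_j` qubits is the data, the second one is
the part of the resource state that belongs to `U_j`. -/
def teleport {l : ℕ} {k : Fin l → ℕ} {U : ∀ j, Op (Fin (k j))} (P : Synthillation k U)
    (j : Fin l) : Prog (Fin (k j) ⊕ Fin (k j)) :=
  let toData : List (CliffordGate (Fin (k j) ⊕ Fin (k j))) :=
    (List.finRange (k j)).map fun i => .cnot (Sum.inr i) (Sum.inl i) Sum.inr_ne_inl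
  let toRes : List (CliffordGate (Fin (k j) ⊕ Fin (k j))) :=
    (List.finRange (k j)).map fun i => .cnot (Sum.inl i) (Sum.inr i) Sum.inl_ne_inr
  .seq (Prog.circuit toData)
    (Prog.measureAll ((List.finRange (k j)).map Sum.inl) fun o =>
      .seq ((Prog.circuit (P.fixup j (o ∘ Sum.inl))).map Function.Embedding.inr)
        -- swap the result into the data qubits
        (Prog.circuit (toData ++ toRes ++ toData)))

/-- The resource qubits that belong to `U_j`. -/
def resource {l : ℕ} {k : Fin l → ℕ} {U : ∀ j, Op (Fin (k j))} (P : Synthillation k U)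
    (j : Fin l) : Fin (k j) ↪ P.Lab :=
  ⟨fun i => Sum.inl (Sum.inl (Sum.inl ⟨j, i⟩)), fun a b h => by simpa using h⟩

/-- The initial state: the state `ρ` of a computer with qubits `D`, the code block in
`|0 ⋯ 0⟩`, and `n` noisy `T`-states of error rate `ε`. -/
def initial {l : ℕ} {k : Fin l → ℕ} {U : ∀ j, Op (Fin (k j))} (P : Synthillation k U)
    {D : Type} (ε : ℝ) (ρ : Op D) : Op (D ⊕ P.Lab) :=
  Matrix.of fun x y =>
    ρ (x ∘ Sum.inl) (y ∘ Sum.inl)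
      * (if (∀ w, x (Sum.inr (Sum.inl w)) = 0) ∧ (∀ w, y (Sum.inr (Sum.inl w)) = 0)
          then 1 else 0)
      * ∏ c : Fin P.n, noisyT ε (x (Sum.inr (Sum.inr c))) (y (Sum.inr (Sum.inr c)))

/-- The unnormalised state of the computer after a successful run: the resource state is
prepared, then for `j = 1, …, l` in turn the computer applies the unitary `V_j` to all its qubits
and `U_j` is teleported onto the qubits selected by `place j`. -/
def accepted {l : ℕ} {k : Fin l → ℕ} {U : ∀ j, Op (Fin (k j))} (P : Synthillation k U)
    {D : Type} [Fintype D] [DecidableEq D] (place : ∀ j, Fin (k j) ↪ D)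
    (V : Fin l → Op D) (ε : ℝ) (ρ : Op D) : Op D :=
  ptrace <|
    (List.finRange l).foldl
      (fun σ j => ((P.teleport j).map (Function.Embedding.sumMap (place j) (P.resource j))).run
        (conj (embedOp Function.Embedding.inl (V j)) σ))
      ((P.prepare.map Function.Embedding.inr).run (P.initial ε ρ))

end Synthillation

/-- The ideal computation: for `j = 1, …, l` in turn, apply `V_j` to all qubits and `U_j` to the
qubits selected by `place j`. -/
def ideal {l : ℕ} {k : Fin l → ℕ} (U : ∀ j, Op (Fin (k j)))
    {D : Type} [Fintype D] [DecidableEq D] (place : ∀ j, Fin (k j) ↪ D)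
    (V : Fin l → Op D) (ρ : Op D) : Op D :=
  (List.finRange l).foldl (fun σ j => conj (embedOp (place j) (U j)) (conj (V j) σ)) ρ

end Synth

end

set_option linter.unusedSectionVars false

/-! Modulo 8, the phase F of an element of `D3` is a sum of parities φ(x) ∈ {0,1} of linear forms φ,
and twice such a sum is the phase of a diagonal Clifford unitary. In a circuit over CNOT, S, T every
T gate contributes one parity and the S gates an even phase (`synth_normal_form`). Optimal circuits
therefore give F ≡ α and F ≡ β + 4C modulo Clifford phases, where α is a sum of τ parities (the list
A) and β a sum of μ parities (the list B), and 4C is the phase of the CCZ part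
(`exists_optimal_forms`).

The code has three gauge bits y₀, y₁, y₂. Its main columns are A shifted by y₀, B shifted by y₀ ⊕
y₁, and B shifted by y₁. Since the bit φ ⊕ y equals φ + y − 2yφ, their weights add up to α + 2β −
2y₀(α + β) − 4y₁β + 4y₀y₁β, plus terms in the gauge bits alone. Here 2β and 4y₁β are Clifford
phases, and so is 2y₀(α + β) = 4y₀β + 2y₀(α − β): α and β differ by an even phase and by 4C, and the
latter turns into 8C = 0. This is why the second factor needs to be known only up to CCZ gates. The
term 4y₀y₁β is a CCZ phase of y₀, y₁ and the parity v of the sum of B; the eight columns in y₂ +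
span(y₀, y₁, v) cancel it up to Clifford phases (`cancel_identity`). At most 1 + 2 further columns
make the linear gauge terms even, so Δ ≤ 8 + 1 + 2 (`columns_quasitransversal`, `length_columns`).

Every column contains a gauge bit (`columns_detect`), so a single Z error always flips a gauge
measurement. Injecting a noisy T-state is a T gate followed by Z with probability ε, whatever the
measurement outcome (`run_injectAt`). The Z errors commute with all diagonal gates, and decoding
turns the pattern e into Z[Ge] on logical and gauge qubits; acceptance means that the gauge part of
Ge vanishes (`run_gauge`), and the logical part κ is teleported along as U_j Z[κ_j]
(`run_teleport`). The accepted state is thus a mixture of ideal computations with Z errors whose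
weights depend on the protocol and ε only (`accepted_eq`). Undetected nonzero patterns have at least
two errors, which yields both O(ε²) bounds. -/

namespace Synth

/-! ### Operators and programs acting on a subset of the qubits -/

section Slices

variable {κ ι : Type} [Fintype κ] [DecidableEq κ] [Fintype ι] [DecidableEq ι]

theorem extend_comp_self (f : κ ↪ ι) (x : Bits ι) : Function.extend f (x ∘ f) x = x := by
  funext a
  by_cases h : ∃ b, f b = a
  · obtain ⟨b, rfl⟩ := h
    rw [f.injective.extend_apply]; rfl
  · rw [Function.extend_apply' _ _ _ h]

theorem extend_extend (f : κ ↪ ι) (u v : Bits κ) (x : Bits ι) :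
    Function.extend f u (Function.extend f v x) = Function.extend f u x := by
  funext a
  by_cases h : ∃ b, f b = a
  · obtain ⟨b, rfl⟩ := h
    rw [f.injective.extend_apply, f.injective.extend_apply]
  · rw [Function.extend_apply' _ _ _ h, Function.extend_apply' _ _ _ h,
      Function.extend_apply' _ _ _ h]

theorem extend_comp (f : κ ↪ ι) (u : Bits κ) (x : Bits ι) : Function.extend f u x ∘ f = u := by
  funext a
  exact f.injective.extend_apply _ _ _

theorem extend_off (f : κ ↪ ι) (u : Bits κ) (x : Bits ι) {a : ι} (ha : a ∉ Set.range f) :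
    Function.extend f u x a = x a :=
  Function.extend_apply' _ _ _ ha

open Classical in
theorem sum_agree_off {R : Type*} [AddCommMonoid R] (f : κ ↪ ι) (x : Bits ι) (h : Bits ι → R) :
    (∑ w, if ∀ a, a ∉ Set.range f → x a = w a then h w else 0)
      = ∑ u : Bits κ, h (Function.extend f u x) := by
  rw [← Finset.sum_filter]
  refine Finset.sum_nbij' (fun w => w ∘ f) (fun u => Function.extend f u x) ?_ ?_ ?_ ?_ ?_
  · intro w _; simp
  · intro u _
    simp only [Finset.mem_filter, Finset.mem_univ, true_and]
    intro a ha
    rw [extend_off f u x ha]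
  · intro w hw
    simp only [Finset.mem_filter, Finset.mem_univ, true_and] at hw
    funext a
    by_cases ha : a ∈ Set.range f
    · obtain ⟨b, rfl⟩ := ha
      rw [f.injective.extend_apply]; rfl
    · rw [extend_off f _ x ha, hw a ha]
  · intro u _; exact extend_comp f u x
  · intro w hw
    simp only [Finset.mem_filter, Finset.mem_univ, true_and] at hw
    congr 1
    funext a
    by_cases ha : a ∈ Set.range f
    · obtain ⟨b, rfl⟩ := ha
      rw [f.injective.extend_apply]; rfl
    · rw [extend_off f _ x ha, hw a ha]

/-- The operator on the qubits in the range of `f` obtained by fixing the other row and column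
labels. -/
noncomputable def slice (f : κ ↪ ι) (R : Op ι) (x y : Bits ι) : Op κ :=
  Matrix.of fun u v => R (Function.extend f u x) (Function.extend f v y)

theorem slice_apply (f : κ ↪ ι) (R : Op ι) (x y : Bits ι) (u v : Bits κ) :
    slice f R x y u v = R (Function.extend f u x) (Function.extend f v y) := rfl

theorem slice_self (f : κ ↪ ι) (R : Op ι) (x y : Bits ι) :
    slice f R x y (x ∘ f) (y ∘ f) = R x y := by
  rw [slice_apply, extend_comp_self, extend_comp_self]

theorem slice_extend (f : κ ↪ ι) (R : Op ι) (x y : Bits ι) (u v : Bits κ) :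
    slice f R (Function.extend f u x) (Function.extend f v y) = slice f R x y := by
  ext a b
  simp only [slice_apply, extend_extend]

theorem embedOp_mul_apply (f : κ ↪ ι) (M : Op κ) (R : Op ι) (x y : Bits ι) :
    (embedOp f M * R) x y = ∑ u, M (x ∘ f) u * R (Function.extend f u x) y := by
  classical
  rw [Matrix.mul_apply]
  simp only [embedOp, Matrix.of_apply, ite_mul, zero_mul]
  have := sum_agree_off f x fun w => M (x ∘ f) (w ∘ f) * R w y
  simp only [extend_comp] at this
  rw [← this]

theorem embedOp_conjTranspose (f : κ ↪ ι) (M : Op κ) :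
    embedOp f M.conjTranspose = (embedOp f M).conjTranspose := by
  classical
  ext x y
  simp only [embedOp, Matrix.of_apply, Matrix.conjTranspose_apply]
  by_cases h : ∀ a, a ∉ Set.range f → x a = y a
  · rw [if_pos h, if_pos fun a ha => (h a ha).symm]
  · rw [if_neg h, if_neg fun h' => h fun a ha => (h' a ha).symm, star_zero]

theorem conj_apply (M R : Op ι) (x y : Bits ι) :
    conj M R x y = ∑ u, ∑ v, M x u * R u v * star (M y v) := by
  simp only [conj, Matrix.mul_apply, Matrix.conjTranspose_apply, Finset.sum_mul]
  rw [Finset.sum_comm]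

theorem conj_embedOp_apply (f : κ ↪ ι) (M : Op κ) (R : Op ι) (x y : Bits ι) :
    conj (embedOp f M) R x y = conj M (slice f R x y) (x ∘ f) (y ∘ f) := by
  -- Multiplication by M† on the right is reduced to multiplication by M on the left by taking
  -- adjoints.
  have h1 : conj (embedOp f M) R x y
      = star ((embedOp f M * (embedOp f M * R).conjTranspose) y x) := by
    rw [← Matrix.conjTranspose_apply, Matrix.conjTranspose_mul, Matrix.conjTranspose_conjTranspose]
    rfl
  rw [h1, embedOp_mul_apply, conj_apply, Finset.sum_comm, star_sum]
  refine Finset.sum_congr rfl fun v _ => ?_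
  rw [Matrix.conjTranspose_apply, embedOp_mul_apply, star_mul', star_star, Finset.mul_sum]
  refine Finset.sum_congr rfl fun u _ => ?_
  rw [slice_apply]
  ring

theorem slice_conj_embedOp (f : κ ↪ ι) (M : Op κ) (R : Op ι) (x y : Bits ι) :
    slice f (conj (embedOp f M) R) x y = conj M (slice f R x y) := by
  ext u v
  rw [slice_apply, conj_embedOp_apply, slice_extend, extend_comp, extend_comp]

theorem embedOp_mul (f : κ ↪ ι) (M N : Op κ) :
    embedOp f (M * N) = embedOp f M * embedOp f N := by
  classical
  ext x y
  rw [embedOp_mul_apply]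
  simp only [embedOp, Matrix.of_apply, extend_comp]
  have : ∀ u : Bits κ, (∀ a, a ∉ Set.range f → Function.extend f u x a = y a)
      ↔ ∀ a, a ∉ Set.range f → x a = y a := fun u =>
    forall₂_congr fun a ha => by rw [extend_off f u x ha]
  simp only [this]
  split_ifs
  · rw [Matrix.mul_apply]
  · simp

theorem embedOp_one (f : κ ↪ ι) : embedOp f (1 : Op κ) = 1 := by
  classical
  ext x y
  simp only [embedOp, Matrix.of_apply, Matrix.one_apply]
  by_cases h : x = y
  · subst h; simp
  · rw [if_neg h]
    split_ifs with h1 h2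
    · exact absurd (funext fun a => by
        by_cases ha : a ∈ Set.range f
        · obtain ⟨b, rfl⟩ := ha
          exact congrFun h2 b
        · exact h1 a ha) h
    · rfl
    · rfl

theorem embedOp_mem_unitaryGroup (f : κ ↪ ι) {M : Op κ} (hM : M ∈ Matrix.unitaryGroup (Bits κ) ℂ) :
    embedOp f M ∈ Matrix.unitaryGroup (Bits ι) ℂ := by
  rw [Matrix.mem_unitaryGroup_iff] at hM ⊢
  rw [Matrix.star_eq_conjTranspose, ← embedOp_conjTranspose, ← embedOp_mul,
    ← Matrix.star_eq_conjTranspose, hM, embedOp_one]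

theorem embedOp_diagonal (f : κ ↪ ι) (d : Bits κ → ℂ) :
    embedOp f (Matrix.diagonal d) = Matrix.diagonal fun x => d (x ∘ f) := by
  classical
  ext x y
  simp only [embedOp, Matrix.of_apply, Matrix.diagonal_apply]
  by_cases h : x = y
  · subst h; simp
  · rw [if_neg h]
    split_ifs with h1 h2
    · exact absurd (funext fun a => by
        by_cases ha : a ∈ Set.range f
        · obtain ⟨b, rfl⟩ := ha
          exact congrFun h2 b
        · exact h1 a ha) h
    · rfl
    · rfl

theorem embedOp_hadamardOp (f : κ ↪ ι) (i : κ) : embedOp f (hadamardOp i) = hadamardOp (f i) := by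
  classical
  ext x y
  simp only [embedOp, hadamardOp, Matrix.of_apply, Function.comp_apply]
  by_cases h : ∀ a, a ≠ f i → x a = y a
  · rw [if_pos h, if_pos, if_pos]
    · exact fun a ha => h _ (f.injective.ne ha)
    · intro a ha
      exact h a fun hh => ha ⟨i, hh.symm⟩
  · rw [if_neg h]
    split_ifs with h1 h2
    · exact absurd (fun a ha => by
        by_cases hr : a ∈ Set.range f
        · obtain ⟨b, rfl⟩ := hr
          exact h2 b fun hb => ha (by rw [hb])
        · exact h1 a hr) h
    · rfl
    · rfl

theorem embedOp_cnotOp (f : κ ↪ ι) (i j : κ) : embedOp f (cnotOp i j) = cnotOp (f i) (f j) := by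
  classical
  ext x y
  simp only [embedOp, cnotOp, Matrix.of_apply]
  by_cases h : x = Function.update y (f j) (y (f j) + y (f i))
  · rw [if_pos h, if_pos, if_pos]
    · rw [h]
      funext a
      by_cases ha : a = j
      · subst ha; simp
      · simp [Function.update_of_ne ha, Function.update_of_ne (f.injective.ne ha)]
    · intro a ha
      rw [h, Function.update_of_ne]
      exact fun hh => ha ⟨j, hh.symm⟩
  · rw [if_neg h]
    split_ifs with h1 h2
    · refine absurd (funext fun a => ?_) h
      by_cases hr : a ∈ Set.range f
      · obtain ⟨b, rfl⟩ := hr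
        have := congrFun h2 b
        by_cases hb : b = j
        · subst hb; simpa using this
        · simpa [Function.update_of_ne hb, Function.update_of_ne (f.injective.ne hb)] using this
      · rw [h1 a hr, Function.update_of_ne]
        exact fun hh => hr ⟨j, hh.symm⟩
    · rfl
    · rfl

theorem CliffordGate.op_map (f : κ ↪ ι) (g : CliffordGate κ) :
    (g.map f).op = embedOp f g.op := by
  cases g with
  | hadamard i => exact (embedOp_hadamardOp f i).symm
  | s i => exact (embedOp_diagonal f fun x => Complex.I ^ (x i).val).symm
  | cnot i j h => exact (embedOp_cnotOp f i j).symm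

theorem embedOp_projOp (f : κ ↪ ι) (i : κ) (b : ZMod 2) :
    embedOp f (projOp i b) = projOp (f i) b :=
  embedOp_diagonal f _

theorem slice_sum {α : Type*} (s : Finset α) (f : κ ↪ ι) (R : α → Op ι) (x y : Bits ι) :
    slice f (∑ a ∈ s, R a) x y = ∑ a ∈ s, slice f (R a) x y := by
  ext u v
  simp only [slice_apply, Matrix.sum_apply]

/-- A program acts only on its own qubits. -/
theorem slice_run_map (f : κ ↪ ι) (p : Prog κ) (R : Op ι) (x y : Bits ι) :
    slice f ((p.map f).run R) x y = p.run (slice f R x y) := by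
  induction p generalizing R x y with
  | skip => rfl
  | abort => rfl
  | gate g => simp only [Prog.map, Prog.run, CliffordGate.op_map, slice_conj_embedOp]
  | seq p q hp hq => simp only [Prog.map, Prog.run, hq, hp]
  | measure i next ih =>
    simp only [Prog.map, Prog.run, slice_sum, ih, ← embedOp_projOp, slice_conj_embedOp]

theorem run_map_apply (f : κ ↪ ι) (p : Prog κ) (R : Op ι) (x y : Bits ι) :
    (p.map f).run R x y = p.run (slice f R x y) (x ∘ f) (y ∘ f) := by
  rw [← slice_run_map, slice_self]

end Slices

/-! ### Linearity of runs, circuits as conjugations, product operators -/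

section Linear

variable {ι : Type} [Fintype ι] [DecidableEq ι]

/-- Conjugation as a linear map. -/
noncomputable def conjLin (M : Op ι) : Op ι →ₗ[ℂ] Op ι where
  toFun := conj M
  map_add' A B := by simp only [conj, mul_add, add_mul]
  map_smul' c A := by simp only [conj, Matrix.mul_smul, Matrix.smul_mul, RingHom.id_apply]

/-- Summing over outcomes without normalising keeps every run linear; this is what allows mixtures
of error patterns to be carried through a program term by term. -/
theorem exists_runLin (p : Prog ι) : ∃ φ : Op ι →ₗ[ℂ] Op ι, ∀ R, p.run R = φ R := by
  induction p with
  | skip => exact ⟨LinearMap.id, fun _ => rfl⟩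
  | abort => exact ⟨0, fun _ => rfl⟩
  | gate g => exact ⟨conjLin g.op, fun _ => rfl⟩
  | seq p q hp hq =>
    obtain ⟨φ, hφ⟩ := hp
    obtain ⟨ψ, hψ⟩ := hq
    exact ⟨ψ ∘ₗ φ, fun R => by simp only [Prog.run, hφ, hψ, LinearMap.comp_apply]⟩
  | measure i next ih =>
    choose φ hφ using ih
    exact ⟨∑ b, φ b ∘ₗ conjLin (projOp i b), fun R => by
      simp only [Prog.run, hφ, LinearMap.sum_apply, LinearMap.comp_apply]; rfl⟩

theorem run_smul (p : Prog ι) (c : ℂ) (R : Op ι) : p.run (c • R) = c • p.run R := by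
  obtain ⟨φ, hφ⟩ := exists_runLin p
  rw [hφ, hφ, map_smul]

theorem conj_smul (M : Op ι) (c : ℂ) (R : Op ι) : conj M (c • R) = c • conj M R :=
  map_smul (conjLin M) c R

theorem conj_mul (M N R : Op ι) : conj (M * N) R = conj M (conj N R) := by
  simp only [conj, Matrix.conjTranspose_mul, mul_assoc]

theorem conj_one (R : Op ι) : conj 1 R = R := by simp [conj]

theorem conj_diagonal_apply (d : Bits ι → ℂ) (R : Op ι) (x y : Bits ι) :
    conj (Matrix.diagonal d) R x y = d x * R x y * star (d y) := by
  simp [conj, Matrix.diagonal_conjTranspose, Matrix.mul_diagonal, Matrix.diagonal_mul]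

theorem conj_projOp_apply (i : ι) (b : ZMod 2) (R : Op ι) (x y : Bits ι) :
    conj (projOp i b) R x y = if x i = b ∧ y i = b then R x y else 0 := by
  rw [projOp, conj_diagonal_apply]
  by_cases h1 : x i = b <;> by_cases h2 : y i = b <;> simp [h1, h2]

theorem run_circuit (c : List (CliffordGate ι)) (R : Op ι) :
    (Prog.circuit c).run R = conj (circuitOp CliffordGate.op c) R := by
  induction c generalizing R with
  | nil => exact (conj_one R).symm
  | cons g c ih =>
    show (Prog.circuit c).run (conj g.op R) = _
    rw [ih, circuitOp, conj_mul]

theorem circuitOp_append {γ : Type} (f : γ → Op ι) (c d : List γ) :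
    circuitOp f (c ++ d) = circuitOp f d * circuitOp f c := by
  induction c with
  | nil => simp [circuitOp]
  | cons g c ih => simp only [List.cons_append, circuitOp, ih, mul_assoc]

/-- The product of two operators on disjoint systems. -/
noncomputable def tens {α β : Type} (A : Op α) (B : Op β) : Op (α ⊕ β) :=
  Matrix.of fun x y => A (x ∘ Sum.inl) (y ∘ Sum.inl) * B (x ∘ Sum.inr) (y ∘ Sum.inr)

theorem extend_inl {α β : Type} (u : Bits α) (x : Bits (α ⊕ β)) :
    Function.extend (Function.Embedding.inl : α ↪ α ⊕ β) u x = Sum.elim u (x ∘ Sum.inr) := by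
  funext a
  cases a with
  | inl a => exact Function.Embedding.inl.injective.extend_apply _ _ _
  | inr a => rw [Function.extend_apply' _ _ _ (by simp)]; rfl

theorem extend_inr {α β : Type} (u : Bits β) (x : Bits (α ⊕ β)) :
    Function.extend (Function.Embedding.inr : β ↪ α ⊕ β) u x = Sum.elim (x ∘ Sum.inl) u := by
  funext a
  cases a with
  | inr a => exact Function.Embedding.inr.injective.extend_apply _ _ _
  | inl a => rw [Function.extend_apply' _ _ _ (by simp)]; rfl

variable {α β : Type} [Fintype α] [DecidableEq α] [Fintype β] [DecidableEq β]

theorem slice_inl_tens (A : Op α) (B : Op β) (x y : Bits (α ⊕ β)) :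
    slice Function.Embedding.inl (tens A B) x y = B (x ∘ Sum.inr) (y ∘ Sum.inr) • A := by
  ext u v
  simp only [slice_apply, extend_inl, tens, Matrix.of_apply, Sum.elim_comp_inl, Sum.elim_comp_inr,
    Matrix.smul_apply, smul_eq_mul]
  ring

theorem slice_inr_tens (A : Op α) (B : Op β) (x y : Bits (α ⊕ β)) :
    slice Function.Embedding.inr (tens A B) x y = A (x ∘ Sum.inl) (y ∘ Sum.inl) • B := by
  ext u v
  simp only [slice_apply, extend_inr, tens, Matrix.of_apply, Sum.elim_comp_inl, Sum.elim_comp_inr,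
    Matrix.smul_apply, smul_eq_mul]

theorem run_map_inl_tens (p : Prog α) (A : Op α) (B : Op β) :
    (p.map Function.Embedding.inl).run (tens A B) = tens (p.run A) B := by
  ext x y
  rw [run_map_apply, slice_inl_tens, run_smul]
  simp only [tens, Matrix.smul_apply, Matrix.of_apply, smul_eq_mul]
  rw [mul_comm]; rfl

theorem run_map_inr_tens (p : Prog β) (A : Op α) (B : Op β) :
    (p.map Function.Embedding.inr).run (tens A B) = tens A (p.run B) := by
  ext x y
  rw [run_map_apply, slice_inr_tens, run_smul]
  rfl

theorem conj_embedOp_inl_tens (M : Op α) (A : Op α) (B : Op β) :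
    conj (embedOp Function.Embedding.inl M) (tens A B) = tens (conj M A) B := by
  ext x y
  rw [conj_embedOp_apply, slice_inl_tens, conj_smul]
  simp only [tens, Matrix.smul_apply, Matrix.of_apply, smul_eq_mul]
  rw [mul_comm]; rfl

end Linear

/-! ### Eighth roots of unity, signs, and the noisy T-state -/

section Phases

theorem omega_sq : omega ^ 2 = Complex.I := by
  rw [omega, ← Complex.exp_nat_mul]
  refine (congrArg Complex.exp ?_).trans Complex.exp_pi_div_two_mul_I
  push_cast
  ring

theorem norm_omega : ‖omega‖ = 1 := by
  rw [omega, mul_comm, Complex.norm_exp_ofReal_mul_I]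

theorem omega_mul_star : omega * star omega = 1 := by
  rw [Complex.star_def, Complex.mul_conj, Complex.normSq_eq_norm_sq, norm_omega]
  simp

theorem star_omega : star omega = -Complex.I * omega := by
  have h : omega * star omega = omega * (-Complex.I * omega) := by
    rw [omega_mul_star]
    calc (1 : ℂ) = -(Complex.I * Complex.I) := by simp
      _ = -(Complex.I * omega ^ 2) := by rw [omega_sq]
      _ = _ := by ring
  exact mul_left_cancel₀ (by intro h0; simpa [h0] using norm_omega) h

theorem sqrt_two_mul_self : (Real.sqrt 2 : ℂ) * (Real.sqrt 2 : ℂ) = 2 := by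
  rw [← Complex.ofReal_mul, Real.mul_self_sqrt (by norm_num)]
  simp

theorem inv_sqrt_two_mul_self : (Real.sqrt 2 : ℂ)⁻¹ * (Real.sqrt 2 : ℂ)⁻¹ = 2⁻¹ := by
  rw [← mul_inv, sqrt_two_mul_self]

theorem star_inv_sqrt_two : star (Real.sqrt 2 : ℂ)⁻¹ = (Real.sqrt 2 : ℂ)⁻¹ := by
  rw [Complex.star_def, map_inv₀, Complex.conj_ofReal]

/-- The sign `(-1)^b`. -/
noncomputable def sgn (b : ZMod 2) : ℂ := (-1) ^ b.val

theorem sgn_add (a b : ZMod 2) : sgn (a + b) = sgn a * sgn b := by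
  revert a b
  have : ∀ a : ZMod 2, a = 0 ∨ a = 1 := by decide
  intro a b
  rcases this a with rfl | rfl <;> rcases this b with rfl | rfl <;>
    simp [sgn, ZMod.val_one, show (1 + 1 : ZMod 2) = 0 from rfl]

theorem sgn_zero : sgn 0 = 1 := by simp [sgn]

theorem sgn_one : sgn 1 = -1 := by simp [sgn, ZMod.val_one]

theorem star_sgn (a : ZMod 2) : star (sgn a) = sgn a := by simp [sgn]

theorem sgn_mul_self (a : ZMod 2) : sgn a * sgn a = 1 := by
  rw [← sgn_add, CharTwo.add_self_eq_zero, sgn_zero]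

theorem sgn_sum {α : Type*} (s : Finset α) (f : α → ZMod 2) :
    sgn (∑ a ∈ s, f a) = ∏ a ∈ s, sgn (f a) := by
  classical
  induction s using Finset.induction_on with
  | empty => simp [sgn_zero]
  | insert a s ha ih => rw [Finset.sum_insert ha, Finset.prod_insert ha, sgn_add, ih]

/-- The probability of the error pattern `b` on one noisy `T`-state. -/
def errProb (ε : ℝ) (b : ZMod 2) : ℝ := if b = 0 then 1 - ε else ε

theorem zmod_two_cases (a : ZMod 2) : a = 0 ∨ a = 1 := by
  revert a; decide

theorem sum_zmod_two {M : Type*} [AddCommMonoid M] (f : ZMod 2 → M) :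
    ∑ b, f b = f 0 + f 1 := Fin.sum_univ_two f

/-- The factor 2 removes the normalisation of the T-state, so that what is left is the action of a T
gate on matrix entries, mixed with that of ZT. -/
theorem two_mul_noisyT (ε : ℝ) (a b : ZMod 2) :
    2 * noisyT ε a b = ∑ t : ZMod 2, (errProb ε t : ℂ) *
      ((omega ^ a.val * sgn (t * a)) * star (omega ^ b.val * sgn (t * b))) := by
  have h := inv_sqrt_two_mul_self
  have h' := star_inv_sqrt_two
  rw [sum_zmod_two]
  simp only [noisyT, Matrix.add_apply, Matrix.smul_apply, Matrix.vecMulVec_apply, Pi.star_apply,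
    magicZ, magic, div_eq_mul_inv, star_mul', h', errProb, if_true, one_ne_zero, if_false,
    zero_mul, one_mul, sgn_zero, star_sgn, smul_eq_mul]
  simp only [show ∀ a : ZMod 2, (-1 : ℂ) ^ a.val = sgn a from fun _ => rfl, star_sgn, star_one]
  linear_combination (2 * ((1 - ε : ℝ) : ℂ) * omega ^ a.val * star (omega ^ b.val)
    + 2 * (ε : ℂ) * sgn a * omega ^ a.val * sgn b * star (omega ^ b.val)) * h

/-- Up to a global phase X T|+⟩ = S† T|+⟩, and X and S both commute with Z up to sign. Hence a
conditional S makes the two measurement outcomes of an injection indistinguishable, error included.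
-/
theorem noisyT_shift (ε : ℝ) (a b t : ZMod 2) :
    noisyT ε (t + a) (t + b) *
      (if t = 1 then Complex.I ^ a.val * star (Complex.I ^ b.val) else 1) = noisyT ε a b := by
  have key : ∀ a b, noisyT ε a b = 2⁻¹ * (2 * noisyT ε a b) := fun a b => by ring
  have h11 : (1 + 1 : ZMod 2) = 0 := rfl
  have hI : Complex.I * Complex.I = -1 := Complex.I_mul_I
  rw [key (t + a), key a]
  simp only [two_mul_noisyT, sum_zmod_two]
  have h1 := omega_mul_star
  have h2 := star_omega
  rw [h2] at h1
  rcases zmod_two_cases a with rfl | rfl <;> rcases zmod_two_cases b with rfl | rfl <;>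
    rcases zmod_two_cases t with rfl | rfl <;>
    simp only [h11, add_zero, zero_add, ZMod.val_zero, ZMod.val_one, pow_zero, pow_one, mul_zero,
      mul_one, one_mul, sgn_zero, sgn_one, if_true, zero_ne_one, if_false, star_one,
      star_mul', star_neg, h2, Complex.star_def, Complex.conj_I, errProb, one_ne_zero]
  all_goals push_cast
  · linear_combination (2⁻¹ : ℂ) * h1
  · ring
  · linear_combination (2⁻¹ : ℂ) * (2 * ε - 1) * omega * hI
  · linear_combination (-(2⁻¹ : ℂ)) * hI - (2⁻¹ : ℂ) * h1

end Phases

/-! ### Linear permutations of basis states and CNOT circuits -/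

section Perm

variable {ι : Type} [Fintype ι] [DecidableEq ι]

/-- The operator `|x⟩ ↦ |π x⟩`. -/
noncomputable def permOp (π : Bits ι ≃ₗ[ZMod 2] Bits ι) : Op ι :=
  Matrix.of fun y x => if y = π x then 1 else 0

theorem permOp_apply (π : Bits ι ≃ₗ[ZMod 2] Bits ι) (y x : Bits ι) :
    permOp π y x = if y = π x then 1 else 0 := rfl

theorem permOp_refl : permOp (LinearEquiv.refl (ZMod 2) (Bits ι)) = 1 := by
  ext x y
  simp only [permOp_apply, Matrix.one_apply, LinearEquiv.refl_apply]
  congr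

theorem permOp_mul (π σ : Bits ι ≃ₗ[ZMod 2] Bits ι) :
    permOp π * permOp σ = permOp (σ.trans π) := by
  ext x y
  simp only [permOp_apply, Matrix.mul_apply, LinearEquiv.trans_apply, mul_ite, mul_one, mul_zero]
  rw [Finset.sum_eq_single (σ y)]
  · rw [if_pos rfl]
    congr
  · intro b _ hb
    rw [if_neg hb]
  · simp

theorem permOp_mul_apply (π : Bits ι ≃ₗ[ZMod 2] Bits ι) (R : Op ι) (x y : Bits ι) :
    (permOp π * R) x y = R (π.symm x) y := by
  simp only [permOp_apply, Matrix.mul_apply, ite_mul, one_mul, zero_mul]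
  rw [Finset.sum_eq_single (π.symm x)]
  · simp
  · intro b _ hb
    rw [if_neg]
    rintro rfl
    simp at hb
  · simp

theorem mul_permOp_apply (π : Bits ι ≃ₗ[ZMod 2] Bits ι) (R : Op ι) (x y : Bits ι) :
    (R * permOp π) x y = R x (π y) := by
  simp [permOp_apply, Matrix.mul_apply]

theorem permOp_conjTranspose (π : Bits ι ≃ₗ[ZMod 2] Bits ι) :
    (permOp π).conjTranspose = permOp π.symm := by
  ext x y
  simp only [Matrix.conjTranspose_apply, permOp_apply]
  by_cases h : y = π x
  · simp [h]
  · rw [if_neg h, if_neg, star_zero]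
    rintro rfl
    simp at h

theorem conj_permOp_apply (π : Bits ι ≃ₗ[ZMod 2] Bits ι) (R : Op ι) (x y : Bits ι) :
    conj (permOp π) R x y = R (π.symm x) (π.symm y) := by
  rw [conj, permOp_conjTranspose, mul_permOp_apply, permOp_mul_apply]

theorem permOp_mulVec_ket (π : Bits ι ≃ₗ[ZMod 2] Bits ι) (x : Bits ι) :
    (permOp π).mulVec (ket x) = ket (π x) := by
  ext y
  simp [ket, permOp_apply, Pi.single_apply]

theorem ket_injective : Function.Injective (ket : Bits ι → Bits ι → ℂ) := by
  intro x y h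
  by_contra hne
  have := congrFun h x
  simp [ket, hne] at this

/-- The linear map of a CNOT. -/
def cnotEquiv (i j : ι) (h : i ≠ j) : Bits ι ≃ₗ[ZMod 2] Bits ι :=
  LinearEquiv.ofInvolutive
    { toFun := fun x => Function.update x j (x j + x i)
      map_add' := fun x y => by
        funext a
        by_cases ha : a = j
        · subst ha; simp; ring
        · simp [Function.update_of_ne ha]
      map_smul' := fun c x => by
        funext a
        by_cases ha : a = j
        · subst ha; simp; ring
        · simp [Function.update_of_ne ha] }
    (fun x => by
      funext a
      by_cases ha : a = j
      · subst ha
        simp [Function.update_of_ne h, add_assoc, CharTwo.add_self_eq_zero]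
      · simp [Function.update_of_ne ha])

theorem cnotEquiv_apply (i j : ι) (h : i ≠ j) (x : Bits ι) :
    cnotEquiv i j h x = Function.update x j (x j + x i) := rfl

theorem cnotEquiv_symm (i j : ι) (h : i ≠ j) : (cnotEquiv i j h).symm = cnotEquiv i j h := rfl

theorem cnotOp_eq_permOp (i j : ι) (h : i ≠ j) : cnotOp i j = permOp (cnotEquiv i j h) := rfl

theorem conj_cnotOp_apply (i j : ι) (h : i ≠ j) (R : Op ι) (x y : Bits ι) :
    conj (cnotOp i j) R x y
      = R (Function.update x j (x j + x i)) (Function.update y j (y j + y i)) := by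
  rw [cnotOp_eq_permOp i j h, conj_permOp_apply]
  rfl

/-- The linear map of a CNOT circuit. -/
def circuitEquiv : List (CnotPair ι) → (Bits ι ≃ₗ[ZMod 2] Bits ι)
  | [] => LinearEquiv.refl _ _
  | p :: c => (cnotEquiv p.1.1 p.1.2 p.2).trans (circuitEquiv c)

theorem circuitOp_cnot (c : List (CnotPair ι)) :
    circuitOp CliffordGate.op (c.map CnotPair.gate) = permOp (circuitEquiv c) := by
  induction c with
  | nil => exact permOp_refl.symm
  | cons p c ih =>
    rw [List.map_cons, circuitOp, ih, circuitEquiv, ← permOp_mul]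
    rfl

theorem circuitOp_cnot_reverse (c : List (CnotPair ι)) :
    circuitOp CliffordGate.op (c.reverse.map CnotPair.gate) = permOp (circuitEquiv c).symm := by
  induction c with
  | nil => exact permOp_refl.symm
  | cons p c ih =>
    rw [List.reverse_cons, List.map_append, circuitOp_append, ih, circuitEquiv,
      LinearEquiv.trans_symm, ← permOp_mul, cnotEquiv_symm]
    simp only [List.map_cons, List.map_nil, circuitOp, one_mul]
    rfl

end Perm

/-! ### Layers of Hadamard gates -/

section Hadamard

variable {ι : Type} [Fintype ι] [DecidableEq ι]

theorem sum_agree_off_one {R : Type*} [AddCommMonoid R] (i : ι) (v : Bits ι) (h : Bits ι → R) :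
    (∑ w, if ∀ a, a ≠ i → w a = v a then h w else 0) = ∑ b, h (Function.update v i b) := by
  rw [← Finset.sum_filter]
  refine Finset.sum_nbij' (fun w => w i) (fun b => Function.update v i b) ?_ ?_ ?_ ?_ ?_
  · simp
  · intro b _
    simp only [Finset.mem_filter, Finset.mem_univ, true_and]
    intro a ha
    rw [Function.update_of_ne ha]
  · intro w hw
    simp only [Finset.mem_filter, Finset.mem_univ, true_and] at hw
    funext a
    by_cases ha : a = i
    · subst ha; simp
    · rw [Function.update_of_ne ha, hw a ha]
  · simp
  · intro w hw
    simp only [Finset.mem_filter, Finset.mem_univ, true_and] at hw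
    congr 1
    funext a
    by_cases ha : a = i
    · subst ha; simp
    · rw [Function.update_of_ne ha, hw a ha]

theorem mul_hadamardOp_apply (C : Op ι) (i : ι) (u v : Bits ι) :
    (C * hadamardOp i) u v
      = ∑ b : ZMod 2, C u (Function.update v i b) * ((-1) ^ (b.val * (v i).val) / (Real.sqrt 2 : ℂ)) := by
  rw [Matrix.mul_apply]
  simp only [hadamardOp, Matrix.of_apply, mul_ite, mul_zero]
  rw [sum_agree_off_one i v fun w => C u w * ((-1) ^ ((w i).val * (v i).val) / (Real.sqrt 2 : ℂ))]
  simp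

theorem circuitOp_hadamard (L : List ι) (hL : L.Nodup) (u v : Bits ι) :
    circuitOp CliffordGate.op (L.map CliffordGate.hadamard) u v
      = if ∀ a, a ∉ L → u a = v a then
          (L.map fun a => (-1 : ℂ) ^ ((u a).val * (v a).val) / (Real.sqrt 2 : ℂ)).prod else 0 := by
  induction L generalizing v with
  | nil => simp [circuitOp, Matrix.one_apply, funext_iff]
  | cons i L ih =>
    obtain ⟨hi, hL⟩ := List.nodup_cons.1 hL
    rw [List.map_cons, circuitOp]
    show (_ * hadamardOp i) u v = _
    rw [mul_hadamardOp_apply, Finset.sum_eq_single (u i)]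
    · rw [ih hL]
      have h1 : (∀ a, a ∉ L → u a = Function.update v i (u i) a) ↔
          ∀ a, a ∉ i :: L → u a = v a := by
        constructor
        · intro h a ha
          rw [List.mem_cons, not_or] at ha
          rw [h a ha.2, Function.update_of_ne ha.1]
        · intro h a ha
          by_cases hai : a = i
          · subst hai; simp
          · rw [Function.update_of_ne hai]
            exact h a (by simp [hai, ha])
      simp only [h1]
      split_ifs
      · rw [List.map_cons, List.prod_cons, mul_comm]
        congr 2
        refine List.map_congr_left fun a ha => ?_
        rw [Function.update_of_ne (by rintro rfl; exact hi ha)]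
      · simp
    · intro b _ hb
      rw [ih hL, if_neg, zero_mul]
      intro h
      have := h i hi
      simp at this
      exact hb this.symm
    · simp

theorem circuitOp_hadamard_univ (L : List ι) (hL : L.Nodup) (hm : ∀ a, a ∈ L) (u v : Bits ι) :
    circuitOp CliffordGate.op (L.map CliffordGate.hadamard) u v
      = ∏ a, ((-1 : ℂ) ^ ((u a).val * (v a).val) / (Real.sqrt 2 : ℂ)) := by
  rw [circuitOp_hadamard L hL, if_pos fun a ha => absurd (hm a) ha]
  rw [← List.prod_toFinset _ hL]
  refine Finset.prod_congr ?_ fun _ _ => rfl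
  ext a; simp [hm]

/-- The state `|0⋯0⟩⟨0⋯0|`. -/
def zeroOp (ι : Type) [Fintype ι] [DecidableEq ι] : Op ι :=
  Matrix.of fun x y => if x = 0 ∧ y = 0 then 1 else 0

theorem prod_inv_sqrt_two_sq :
    (∏ _a : ι, (1 : ℂ) / (Real.sqrt 2 : ℂ)) * star (∏ _a : ι, (1 : ℂ) / (Real.sqrt 2 : ℂ))
      = (2⁻¹ : ℂ) ^ Fintype.card ι := by
  rw [Finset.prod_const, star_pow, ← mul_pow, one_div, star_inv_sqrt_two, inv_sqrt_two_mul_self,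
    Finset.card_univ]

theorem conj_zeroOp_apply (C : Op ι) (x y : Bits ι) :
    conj C (zeroOp ι) x y = C x 0 * star (C y 0) := by
  rw [conj_apply, Finset.sum_eq_single 0, Finset.sum_eq_single 0]
  · simp [zeroOp]
  · intro v _ hv; simp [zeroOp, hv]
  · simp
  · intro u _ hu; simp [zeroOp, hu]
  · simp

theorem conj_hadamard_zeroOp (L : List ι) (hL : L.Nodup) (hm : ∀ a, a ∈ L) :
    conj (circuitOp CliffordGate.op (L.map CliffordGate.hadamard)) (zeroOp ι)
      = Matrix.of fun _ _ => (2⁻¹ : ℂ) ^ Fintype.card ι := by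
  ext x y
  rw [conj_zeroOp_apply, circuitOp_hadamard_univ L hL hm, circuitOp_hadamard_univ L hL hm]
  simp only [Pi.zero_apply, ZMod.val_zero, mul_zero, pow_zero, Matrix.of_apply]
  exact prod_inv_sqrt_two_sq

theorem conj_hadamard_apply_zero (L : List ι) (hL : L.Nodup) (hm : ∀ a, a ∈ L) (R : Op ι) :
    conj (circuitOp CliffordGate.op (L.map CliffordGate.hadamard)) R 0 0
      = (2⁻¹ : ℂ) ^ Fintype.card ι * ∑ u, ∑ v, R u v := by
  rw [conj_apply, Finset.mul_sum]
  refine Finset.sum_congr rfl fun u _ => ?_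
  rw [Finset.mul_sum]
  refine Finset.sum_congr rfl fun v _ => ?_
  rw [circuitOp_hadamard_univ L hL hm, circuitOp_hadamard_univ L hL hm]
  simp only [Pi.zero_apply, ZMod.val_zero, zero_mul, pow_zero]
  rw [← prod_inv_sqrt_two_sq]
  ring

end Hadamard

/-! ### Measuring a list of qubits, and postselection -/

section MeasureAll

variable {ι : Type} [Fintype ι] [DecidableEq ι]

/-- The outcomes are recorded in one label. It vanishes off the list because the recursion ends with
`next 0`, hence the restriction on the range of summation. -/
theorem run_measureAll (L : List ι) (hL : L.Nodup) (next : Bits ι → Prog ι) (R : Op ι) :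
    (Prog.measureAll L next).run R
      = ∑ o ∈ Finset.univ.filter (fun o : Bits ι => ∀ j, j ∉ L → o j = 0),
          (next o).run (Matrix.of fun x y =>
            if ∀ j ∈ L, x j = o j ∧ y j = o j then R x y else 0) := by
  induction L generalizing next R with
  | nil =>
    have : (Finset.univ.filter fun o : Bits ι => ∀ j, j ∉ ([] : List ι) → o j = 0) = {0} := by
      ext o; simp [funext_iff]
    rw [this, Finset.sum_singleton]
    simp only [Prog.measureAll, List.not_mem_nil, false_implies, implies_true, if_true]
    rfl
  | cons i L ih =>
    obtain ⟨hi, hL⟩ := List.nodup_cons.1 hL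
    simp only [Prog.measureAll, Prog.run]
    simp only [ih hL]
    rw [← Finset.sum_product']
    -- The outcome of qubit i is merged with the label of the tail. That label is 0 at i since the
    -- list has no duplicates, so merging is a bijection.
    refine Finset.sum_nbij' (fun q => Function.update q.2 i q.1)
      (fun o => (o i, Function.update o i 0)) ?_ ?_ ?_ ?_ ?_
    · rintro ⟨b, o⟩ h
      simp only [Finset.mem_product, Finset.mem_univ, true_and, Finset.mem_filter] at h ⊢
      intro j hj
      rw [List.mem_cons, not_or] at hj
      rw [Function.update_of_ne hj.1, h j hj.2]
    · intro o h
      simp only [Finset.mem_product, Finset.mem_univ, true_and, Finset.mem_filter] at h ⊢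
      intro j hj
      by_cases hji : j = i
      · subst hji; simp
      · rw [Function.update_of_ne hji]
        exact h j (by simp [hji, hj])
    · rintro ⟨b, o⟩ h
      simp only [Finset.mem_product, Finset.mem_univ, true_and, Finset.mem_filter] at h
      simp [(h i hi).symm]
    · intro o _; simp
    · rintro ⟨b, o⟩ h
      congr 1
      ext x y
      simp only [Matrix.of_apply, conj_projOp_apply, List.forall_mem_cons, Function.update_self]
      have h2 : (∀ j ∈ L, x j = Function.update o i b j ∧ y j = Function.update o i b j)
          ↔ ∀ j ∈ L, x j = o j ∧ y j = o j :=
        forall₂_congr fun j hj => by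
          have hji : j ≠ i := by rintro rfl; exact hi hj
          rw [Function.update_of_ne hji]
      simp only [h2]
      by_cases h3 : ∀ j ∈ L, x j = o j ∧ y j = o j <;> by_cases h4 : x i = b ∧ y i = b <;>
        simp [h3, h4]

theorem map_measureAll {κ : Type} [DecidableEq κ] (f : κ ↪ ι) (L : List κ)
    (next : Bits κ → Prog κ) :
    (Prog.measureAll L next).map f
      = Prog.measureAll (L.map f) fun o => (next (o ∘ f)).map f := by
  induction L generalizing next with
  | nil => rfl
  | cons i L ih =>
    simp only [Prog.measureAll, Prog.map, List.map_cons, ih]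
    congr 1
    funext b
    congr 1
    funext o
    rw [Function.update_comp_eq_of_injective _ f.injective]

theorem map_circuit {κ : Type} (f : κ ↪ ι) (c : List (CliffordGate κ)) :
    (Prog.circuit c).map f = Prog.circuit (c.map (CliffordGate.map f)) := by
  induction c with
  | nil => rfl
  | cons g c ih =>
    show Prog.seq _ ((Prog.circuit c).map f) = _
    rw [ih]; rfl

theorem map_trans {κ ν : Type} (f : κ ↪ ν) (g : ν ↪ ι) (p : Prog κ) :
    p.map (f.trans g) = (p.map f).map g := by
  induction p with
  | skip => rfl
  | abort => rfl
  | gate h => cases h <;> rfl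
  | seq p q hp hq => simp only [Prog.map, hp, hq]
  | measure i next ih => simp only [Prog.map, ih]; rfl

/-- Postselection of the outcome `+` on all listed qubits. -/
def acceptPlus {κ : Type} [DecidableEq κ] (L : List κ) : Prog κ :=
  .seq (Prog.circuit (L.map CliffordGate.hadamard))
    (Prog.measureAll L fun o => if ∀ w ∈ L, o w = 0 then .skip else .abort)

/-- All outcomes but 0 abort, and after the Hadamard layer the entry at 0 is the expectation of
|+⋯+⟩⟨+⋯+|, a normalised sum of all entries. -/
theorem run_acceptPlus (L : List ι) (hL : L.Nodup) (hm : ∀ a, a ∈ L) (R : Op ι) :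
    (acceptPlus L).run R = ((2⁻¹ : ℂ) ^ Fintype.card ι * ∑ u, ∑ v, R u v) • zeroOp ι := by
  rw [acceptPlus, Prog.run, run_circuit, run_measureAll L hL, Finset.sum_eq_single 0]
  · ext x y
    simp only [Pi.zero_apply, implies_true, if_true, Prog.run, Matrix.of_apply, Matrix.smul_apply,
      zeroOp, smul_eq_mul, mul_ite, mul_one, mul_zero]
    have : (∀ j ∈ L, x j = 0 ∧ y j = 0) ↔ x = 0 ∧ y = 0 :=
      ⟨fun h => ⟨funext fun j => (h j (hm j)).1, funext fun j => (h j (hm j)).2⟩,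
        fun h j _ => ⟨congrFun h.1 j, congrFun h.2 j⟩⟩
    simp only [this]
    split_ifs with h
    · rw [h.1, h.2, conj_hadamard_apply_zero L hL hm]
    · rfl
  · intro o _ ho
    rw [if_neg fun h => ho (funext fun j => h j (hm j))]
    rfl
  · simp

end MeasureAll

/-! ### Injection of noisy T-states -/

section Injection

variable {β γ : Type} [Fintype β] [DecidableEq β] [Fintype γ] [DecidableEq γ]

/-- A product of one-qubit operators. -/
noncomputable def prodOp (τ : γ → Matrix (ZMod 2) (ZMod 2) ℂ) : Op γ :=
  Matrix.of fun x y => ∏ c, τ c (x c) (y c)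

/-- The maximally mixed state of one qubit. -/
noncomputable def mixed : Matrix (ZMod 2) (ZMod 2) ℂ := (2⁻¹ : ℂ) • 1

theorem prodOp_apply_eq (τ : γ → Matrix (ZMod 2) (ZMod 2) ℂ) (c : γ) (x y : Bits γ) :
    prodOp τ x y = τ c (x c) (y c) * ∏ a ∈ Finset.univ.erase c, τ a (x a) (y a) :=
  (Finset.mul_prod_erase _ _ (Finset.mem_univ c)).symm

/-- Injection of the `T`-state on qubit `c` as a `T` gate on qubit `i`. -/
def injectAt (i : β) (c : γ) : Prog (β ⊕ γ) :=
  .seq (.gate (.cnot (Sum.inl i) (Sum.inr c) Sum.inl_ne_inr))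
    (.measure (Sum.inr c) fun b => if b = 1 then .gate (.s (Sum.inl i)) else .skip)

/-- By `noisyT_shift` each outcome multiplies the block by the same matrix. The measured qubit ends
up maximally mixed, and its factor 1/2 is balanced by the 2 in front of `noisyT`. -/
theorem run_injectAt (ε : ℝ) (i : β) (c : γ) (A : Op β)
    (τ : γ → Matrix (ZMod 2) (ZMod 2) ℂ) (hτ : τ c = noisyT ε) :
    (injectAt i c).run (tens A (prodOp τ))
      = tens (Matrix.of fun x y => A x y * (2 * noisyT ε (x i) (y i)))
          (prodOp (Function.update τ c mixed)) := by
  set R := tens A (prodOp τ) with hR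
  have hcond : ∀ (b : ZMod 2) (R' : Op (β ⊕ γ)) (x y : Bits (β ⊕ γ)),
      (if b = 1 then Prog.gate (.s (Sum.inl i)) else .skip : Prog (β ⊕ γ)).run R' x y
        = R' x y * (if b = 1 then
            Complex.I ^ (x (Sum.inl i)).val * star (Complex.I ^ (y (Sum.inl i)).val) else 1) := by
    intro b R' x y
    split_ifs
    · simp only [Prog.run, CliffordGate.op, phaseOp]
      rw [conj_diagonal_apply]
      ring
    · simp [Prog.run]
  ext x y
  simp only [injectAt, Prog.run, CliffordGate.op]
  rw [Matrix.sum_apply]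
  simp only [hcond, conj_projOp_apply, conj_cnotOp_apply _ _ Sum.inl_ne_inr]
  have hval : R (Function.update x (Sum.inr c) (x (Sum.inr c) + x (Sum.inl i)))
      (Function.update y (Sum.inr c) (y (Sum.inr c) + y (Sum.inl i)))
      = A (x ∘ Sum.inl) (y ∘ Sum.inl) *
        (noisyT ε (x (Sum.inr c) + x (Sum.inl i)) (y (Sum.inr c) + y (Sum.inl i)) *
          ∏ a ∈ Finset.univ.erase c, τ a (x (Sum.inr a)) (y (Sum.inr a))) := by
    rw [hR]
    simp only [tens, Matrix.of_apply, Sum.update_inr_comp_inl, Sum.update_inr_comp_inr]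
    rw [prodOp_apply_eq τ c, hτ]
    simp only [Function.update_self]
    congr 2
    refine Finset.prod_congr rfl fun a ha => ?_
    have hac := Finset.ne_of_mem_erase ha
    rw [Function.update_of_ne hac, Function.update_of_ne hac]
    rfl
  rw [hval]
  simp only [tens, Matrix.of_apply]
  rw [prodOp_apply_eq _ c, Function.update_self]
  have hrest : ∏ a ∈ Finset.univ.erase c,
        Function.update τ c mixed a ((x ∘ Sum.inr) a) ((y ∘ Sum.inr) a)
      = ∏ a ∈ Finset.univ.erase c, τ a (x (Sum.inr a)) (y (Sum.inr a)) := by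
    refine Finset.prod_congr rfl fun a ha => ?_
    rw [Function.update_of_ne (Finset.ne_of_mem_erase ha)]
    rfl
  -- Only the outcome that agrees with the row label of the measured qubit contributes, and entries
  -- whose column label differs from it vanish.
  rw [hrest, Finset.sum_eq_single (x (Sum.inr c))]
  · simp only [Function.comp_apply, true_and, mixed, Matrix.smul_apply, Matrix.one_apply,
      smul_eq_mul]
    by_cases h : y (Sum.inr c) = x (Sum.inr c)
    · rw [if_pos h, if_pos h.symm, h, ← noisyT_shift ε (x (Sum.inl i)) (y (Sum.inl i)) (x (Sum.inr c))]
      ring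
    · have h2 : ¬ x (Sum.inr c) = y (Sum.inr c) := fun h' => h h'.symm
      rw [if_neg h, if_neg h2]
      ring
  · intro b _ hb
    rw [if_neg fun h => hb h.1.symm, zero_mul]
  · simp

theorem run_injectAt_list (ε : ℝ) (site : γ → β) (L : List γ) (hL : L.Nodup) (A : Op β)
    (τ : γ → Matrix (ZMod 2) (ZMod 2) ℂ) (hτ : ∀ c ∈ L, τ c = noisyT ε) :
    (Prog.ofList (L.map fun c => injectAt (site c) c)).run (tens A (prodOp τ))
      = tens (Matrix.of fun x y =>
            A x y * (L.map fun c => 2 * noisyT ε (x (site c)) (y (site c))).prod)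
          (prodOp fun c => if c ∈ L then mixed else τ c) := by
  induction L generalizing A τ with
  | nil =>
    simp only [List.map_nil, List.prod_nil, mul_one, List.not_mem_nil, if_false]
    rfl
  | cons c L ih =>
    obtain ⟨hc, hL⟩ := List.nodup_cons.1 hL
    show (Prog.ofList (L.map _)).run ((injectAt (site c) c).run _) = _
    rw [run_injectAt ε (site c) c A τ (hτ c (by simp)), ih hL]
    · congr 1
      · ext x y
        simp only [Matrix.of_apply, List.map_cons, List.prod_cons]
        ring
      · congr 1
        funext a
        by_cases ha : a = c
        · subst ha; simp
        · simp [ha]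
    · intro a ha
      have hac : a ≠ c := by rintro rfl; exact hc ha
      rw [Function.update_of_ne hac, hτ a (by simp [ha])]

theorem run_injectAt_univ (ε : ℝ) (site : γ → β) (L : List γ) (hL : L.Nodup) (hm : ∀ c, c ∈ L)
    (A : Op β) :
    (Prog.ofList (L.map fun c => injectAt (site c) c)).run (tens A (prodOp fun _ => noisyT ε))
      = tens (Matrix.of fun x y => A x y * ∏ c, 2 * noisyT ε (x (site c)) (y (site c)))
          (prodOp fun _ => mixed) := by
  rw [run_injectAt_list ε site L hL A _ fun _ _ => rfl]
  simp only [hm, if_true]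
  congr 1
  ext x y
  simp only [Matrix.of_apply]
  rw [← List.prod_toFinset _ hL]
  congr 2
  ext a; simp [hm]

end Injection

/-! ### Character sums and expansion into error patterns -/

section Gauge

variable {ι : Type} [Fintype ι] [DecidableEq ι]

theorem sum_sgn_mul (a : ZMod 2) : ∑ t : ZMod 2, sgn (a * t) = if a = 0 then 2 else 0 := by
  rw [sum_zmod_two]
  rcases zmod_two_cases a with rfl | rfl
  · simp [sgn_zero]; norm_num
  · simp [sgn_zero, sgn_one]

/-- Orthogonality of characters: the sum factorises over the qubits, and a factor with nonzero σ i
is 1 − 1. -/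
theorem sum_sgn_dotProduct (σ : Bits ι) :
    ∑ u : Bits ι, sgn (σ ⬝ᵥ u) = if σ = 0 then 2 ^ Fintype.card ι else 0 := by
  simp only [dotProduct, sgn_sum]
  have h := Finset.prod_univ_sum (fun _ : ι => (Finset.univ : Finset (ZMod 2)))
    fun i t => sgn (σ i * t)
  rw [Fintype.piFinset_univ] at h
  rw [← h]
  simp only [sum_sgn_mul]
  split_ifs with h0
  · simp [h0]
  · obtain ⟨i, hi⟩ := Function.ne_iff.1 h0
    exact Finset.prod_eq_zero (Finset.mem_univ i) (if_neg hi)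

/-- The probability of the error pattern `e`. -/
noncomputable def patternProb (ε : ℝ) (e : Bits ι) : ℝ := ∏ c, errProb ε (e c)

/-- Multiplying out the mixtures site by site gives one term for each pattern e of Z errors, the
errors acting by the sign of e · a. -/
theorem prod_two_mul_noisyT (ε : ℝ) (a b : Bits ι) :
    ∏ c, 2 * noisyT ε (a c) (b c)
      = ∑ e : Bits ι, (patternProb ε e : ℂ) *
          ((omega ^ (∑ c, (a c).val) * sgn (e ⬝ᵥ a))
            * star (omega ^ (∑ c, (b c).val) * sgn (e ⬝ᵥ b))) := by
  simp only [two_mul_noisyT]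
  have h := Finset.prod_univ_sum (fun _ : ι => (Finset.univ : Finset (ZMod 2)))
    fun c t => (errProb ε t : ℂ) *
      ((omega ^ (a c).val * sgn (t * a c)) * star (omega ^ (b c).val * sgn (t * b c)))
  rw [Fintype.piFinset_univ] at h
  rw [h]
  refine Finset.sum_congr rfl fun e _ => ?_
  rw [Finset.prod_mul_distrib, Finset.prod_mul_distrib, Finset.prod_mul_distrib, ← star_prod,
    Finset.prod_mul_distrib, Finset.prod_pow_eq_pow_sum, Finset.prod_pow_eq_pow_sum]
  simp only [dotProduct, sgn_sum, patternProb, Complex.ofReal_prod]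

end Gauge

/-! ### Preparation of the resource state -/

namespace Synthillation

variable {l : ℕ} {k : Fin l → ℕ} {U : ∀ j, Op (Fin (k j))}

/-- The block and `T`-state qubits when the logical qubits are in the state `A`, the other block
qubits in `|0⟩`, and the used `T`-state qubits are maximally mixed. -/
noncomputable def labOp (P : Synthillation k U) (A : Op (Reg k)) : Op P.Lab :=
  tens (tens (tens A (zeroOp (Fin P.s))) (zeroOp (Fin P.m))) (prodOp fun _ => mixed)

theorem zeroOp_sum {α β : Type} [Fintype α] [DecidableEq α] [Fintype β] [DecidableEq β] :
    zeroOp (α ⊕ β) = tens (zeroOp α) (zeroOp β) := by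
  ext x y
  simp only [zeroOp, tens, Matrix.of_apply]
  have : ∀ z : Bits (α ⊕ β), z = 0 ↔ z ∘ Sum.inl = 0 ∧ z ∘ Sum.inr = 0 := fun z =>
    ⟨by rintro rfl; exact ⟨rfl, rfl⟩, fun h => funext fun a => by
      cases a with
      | inl a => exact congrFun h.1 a
      | inr a => exact congrFun h.2 a⟩
  rw [ite_zero_mul_ite_zero, mul_one]
  refine if_congr ?_ rfl rfl
  rw [this x, this y]
  tauto

theorem initial_eq (P : Synthillation k U) {D : Type} [Fintype D] [DecidableEq D] (ε : ℝ)
    (ρ : Op D) :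
    P.initial ε ρ = tens ρ (tens (tens (zeroOp (Reg k ⊕ Fin P.s)) (zeroOp (Fin P.m)))
      (prodOp fun _ => noisyT ε)) := by
  rw [← zeroOp_sum]
  ext x y
  simp only [initial, tens, zeroOp, prodOp, Matrix.of_apply, Function.comp_apply, funext_iff,
    Pi.zero_apply]
  ring

theorem mem_regList (a : Reg k) : a ∈ regList k := by
  obtain ⟨j, i⟩ := a
  simp [regList]

theorem nodup_regList : (regList k).Nodup := by
  rw [regList, List.nodup_flatMap]
  refine ⟨fun j _ => (List.nodup_finRange _).map fun a b h => by simpa using h, ?_⟩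
  refine (List.nodup_finRange l).imp fun {a b} hab => ?_
  rw [Function.onFun, List.disjoint_left]
  intro c hc hc'
  simp only [List.mem_map, List.mem_finRange, true_and] at hc hc'
  obtain ⟨i, rfl⟩ := hc
  obtain ⟨i', h⟩ := hc'
  exact hab (congrArg Sigma.fst h).symm

/-- All logical and gauge qubits. -/
def rowList (k : Fin l → ℕ) (s : ℕ) : List (Reg k ⊕ Fin s) :=
  (regList k).map Sum.inl ++ (List.finRange s).map Sum.inr

theorem mem_rowList (s : ℕ) (a : Reg k ⊕ Fin s) : a ∈ rowList k s := by
  cases a <;> simp [rowList, mem_regList]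

theorem nodup_rowList (s : ℕ) : (rowList k s).Nodup := by
  rw [rowList, List.nodup_append]
  refine ⟨nodup_regList.map Sum.inl_injective, (List.nodup_finRange s).map Sum.inr_injective, ?_⟩
  intro a ha b hb
  simp only [List.mem_map] at ha hb
  obtain ⟨a, _, rfl⟩ := ha
  obtain ⟨b, _, rfl⟩ := hb
  simp

/-- The change of the measured signs caused by the errors `e`. -/
def syndrome (P : Synthillation k U) (e : Bits (Fin P.n)) : Bits (Reg k ⊕ Fin P.s) :=
  (P.G.submatrix id P.site).mulVec e

/-- Pulling Z errors at the T sites back through the encoder transposes the generator matrix: e ·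
(Gᵀz) = (Ge) · z. -/
theorem dotProduct_sites (P : Synthillation k U) (e : Bits (Fin P.n))
    (z : Bits (Reg k ⊕ Fin P.s)) :
    (e ⬝ᵥ fun c => (P.G.transpose.mulVec z) (P.site c)) = P.syndrome e ⬝ᵥ z := by
  have : (fun c => (P.G.transpose.mulVec z) (P.site c))
      = Matrix.vecMul z (P.G.submatrix id P.site) := by
    funext c
    rw [Matrix.mulVec_transpose]
    rfl
  rw [this, dotProduct_comm, syndrome, dotProduct_comm _ z, Matrix.dotProduct_mulVec]

/-- The state of the logical qubits after the errors `κ`. -/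
noncomputable def resourceOp (U : ∀ j, Op (Fin (k j))) (κ : Bits (Reg k)) : Op (Reg k) :=
  Matrix.of fun x y => (2⁻¹ : ℂ) ^ Fintype.card (Reg k) *
    ((tensorOp U x x * sgn (κ ⬝ᵥ x)) * star (tensorOp U y y * sgn (κ ⬝ᵥ y)))

theorem circuitEquiv_encoder (P : Synthillation k U) (z : Bits (Reg k ⊕ Fin P.s)) :
    circuitEquiv P.encoder (Sum.elim z 0) = P.G.transpose.mulVec z := by
  have h := P.encoder_spec z
  rw [circuitOp_cnot, permOp_mulVec_ket] at h
  exact ket_injective h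

/-- The state of the logical and gauge qubits after decoding. -/
noncomputable def decoded (P : Synthillation k U) (ε : ℝ) : Op (Reg k ⊕ Fin P.s) :=
  Matrix.of fun z z' => (2⁻¹ : ℂ) ^ Fintype.card (Reg k ⊕ Fin P.s) *
    ∏ c, 2 * noisyT ε ((P.G.transpose.mulVec z) (P.site c)) ((P.G.transpose.mulVec z') (P.site c))

/-- The noisy T gates multiply entries, so between encoder and decoder they are evaluated at the
encoded labels; the block itself returns to its unencoded form. -/
theorem run_encode_inject_decode (P : Synthillation k U) (ε : ℝ) :
    ((Prog.circuit (P.encoder.reverse.map CnotPair.gate)).map Function.Embedding.inl).run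
      ((Prog.ofList ((List.finRange P.n).map P.inject)).run
        (((Prog.circuit (P.encoder.map CnotPair.gate)).map Function.Embedding.inl).run
          (tens (tens (Matrix.of fun _ _ => (2⁻¹ : ℂ) ^ Fintype.card (Reg k ⊕ Fin P.s))
            (zeroOp (Fin P.m))) (prodOp fun _ => noisyT ε))))
    = tens (tens (P.decoded ε) (zeroOp (Fin P.m))) (prodOp fun _ => mixed) := by
  have h := run_injectAt_univ ε P.site (List.finRange P.n) (List.nodup_finRange _)
    (fun c => List.mem_finRange c)
  rw [run_map_inl_tens]
  refine (congrArg _ (h _)).trans ?_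
  rw [run_map_inl_tens]
  congr 1
  rw [run_circuit, run_circuit, circuitOp_cnot_reverse, circuitOp_cnot]
  ext x y
  rw [conj_permOp_apply]
  simp only [Matrix.of_apply, conj_permOp_apply, LinearEquiv.symm_symm, LinearEquiv.symm_apply_apply]
  simp only [tens, Matrix.of_apply, zeroOp, decoded]
  -- The encoder is specified by G only on labels with zeros on the m extra qubits; the other
  -- entries vanish on both sides.
  by_cases h0 : x ∘ Sum.inr = 0 ∧ y ∘ Sum.inr = 0
  · have hx : ∀ w : Bits (Block k P.s P.m), w ∘ Sum.inr = 0 →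
        circuitEquiv P.encoder w = P.G.transpose.mulVec (w ∘ Sum.inl) := fun w hw => by
      rw [← circuitEquiv_encoder, ← hw, Sum.elim_comp_inl_inr]
    rw [if_pos h0, hx x h0.1, hx y h0.2]
    ring
  · rw [if_neg h0]
    ring

/-- The correction d and the weight on the T sites combine to the phase of U_F, which does not
involve the gauge bits; these survive only in the signs of the errors. -/
theorem run_correction (P : Synthillation k U) (ε : ℝ) :
    (Prog.circuit P.correction).run (P.decoded ε)
      = Matrix.of fun z z' => (2⁻¹ : ℂ) ^ Fintype.card (Reg k ⊕ Fin P.s) *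
          ∑ e : Bits (Fin P.n), (patternProb ε e : ℂ) *
            ((tensorOp U (z ∘ Sum.inl) (z ∘ Sum.inl) * sgn (P.syndrome e ⬝ᵥ z))
              * star (tensorOp U (z' ∘ Sum.inl) (z' ∘ Sum.inl) * sgn (P.syndrome e ⬝ᵥ z'))) := by
  obtain ⟨d, hd, hspec⟩ := P.correction_spec
  ext z z'
  rw [run_circuit, hd, conj_diagonal_apply]
  simp only [decoded, Matrix.of_apply]
  rw [prod_two_mul_noisyT ε (fun c => (P.G.transpose.mulVec z) (P.site c))
    (fun c => (P.G.transpose.mulVec z') (P.site c)), mul_left_comm, mul_assoc, Finset.mul_sum,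
    Finset.sum_mul]
  congr 1
  refine Finset.sum_congr rfl fun e _ => ?_
  rw [dotProduct_sites, dotProduct_sites, ← hspec z, ← hspec z']
  simp only [star_mul']
  ring

theorem sgn_dotProduct_elim {α β : Type} [Fintype α] [Fintype β] (σ : Bits (α ⊕ β)) (x : Bits α)
    (u : Bits β) :
    sgn (σ ⬝ᵥ Sum.elim x u) = sgn ((σ ∘ Sum.inl) ⬝ᵥ x) * sgn ((σ ∘ Sum.inr) ⬝ᵥ u) := by
  rw [← sgn_add]
  simp [dotProduct, Fintype.sum_sum_type]

/-- The error patterns that the gauge measurements do not detect. -/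
def undetected (P : Synthillation k U) : Finset (Bits (Fin P.n)) :=
  Finset.univ.filter fun e => P.syndrome e ∘ Sum.inr = 0

/-- Projecting the gauge qubits onto |+⟩ sums the error signs over all gauge labels, on the row and
on the column side. Each sum is 2^s or 0 according to whether the gauge syndrome vanishes, so
detected patterns drop out. -/
theorem run_gauge (P : Synthillation k U) (ε : ℝ) :
    ((acceptPlus (List.finRange P.s)).map Function.Embedding.inr).run
        ((Prog.circuit P.correction).run (P.decoded ε))
      = tens (∑ e ∈ P.undetected, (patternProb ε e : ℂ) • resourceOp U (P.syndrome e ∘ Sum.inl))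
          (zeroOp (Fin P.s)) := by
  rw [run_correction]
  ext x y
  rw [run_map_apply, run_acceptPlus _ (List.nodup_finRange _) fun a => List.mem_finRange a]
  simp only [Matrix.smul_apply, smul_eq_mul, slice_apply, extend_inr, Matrix.of_apply, tens,
    Sum.elim_comp_inl, sgn_dotProduct_elim]
  have hinl : ∀ z : Bits (Reg k ⊕ Fin P.s), z ∘ (Function.Embedding.inr : Fin P.s ↪ Reg k ⊕ Fin P.s)
    = z ∘ Sum.inr := fun _ => rfl
  rw [hinl, hinl]
  congr 1
  rw [undetected, Finset.sum_filter, Matrix.sum_apply]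
  simp only [← Finset.mul_sum]
  rw [mul_left_comm, ← mul_assoc]
  have hswap : ∀ F : Bits (Fin P.s) → Bits (Fin P.s) → Bits (Fin P.n) → ℂ,
      ∑ u, ∑ v, ∑ e, F u v e = ∑ e, ∑ u, ∑ v, F u v e := fun F => by
    rw [Finset.sum_comm]
    simp only [Finset.sum_comm (γ := Bits (Fin P.n))]
    rw [Finset.sum_comm]
  rw [hswap, Finset.mul_sum]
  refine Finset.sum_congr rfl fun e _ => ?_
  set σ := P.syndrome e
  set κ := σ ∘ Sum.inl
  set g := σ ∘ Sum.inr
  have hfac : ∑ u : Bits (Fin P.s), ∑ v : Bits (Fin P.s), (patternProb ε e : ℂ) *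
      (tensorOp U (x ∘ Sum.inl) (x ∘ Sum.inl) * (sgn (κ ⬝ᵥ (x ∘ Sum.inl)) * sgn (g ⬝ᵥ u)) *
        star (tensorOp U (y ∘ Sum.inl) (y ∘ Sum.inl) * (sgn (κ ⬝ᵥ (y ∘ Sum.inl)) * sgn (g ⬝ᵥ v))))
      = (patternProb ε e : ℂ) * ((tensorOp U (x ∘ Sum.inl) (x ∘ Sum.inl) * sgn (κ ⬝ᵥ (x ∘ Sum.inl)))
          * star (tensorOp U (y ∘ Sum.inl) (y ∘ Sum.inl) * sgn (κ ⬝ᵥ (y ∘ Sum.inl)))) *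
        ((∑ u, sgn (g ⬝ᵥ u)) * ∑ v, sgn (g ⬝ᵥ v)) := by
    rw [Finset.sum_mul_sum, Finset.mul_sum]
    refine Finset.sum_congr rfl fun u _ => ?_
    rw [Finset.mul_sum]
    refine Finset.sum_congr rfl fun v _ => ?_
    simp only [star_mul', star_sgn]
    ring
  refine (congrArg _ hfac).trans ?_
  rw [sum_sgn_dotProduct]
  split_ifs with hg
  · simp only [Matrix.smul_apply, resourceOp, Matrix.of_apply, smul_eq_mul, Fintype.card_sum,
      Fintype.card_fin, pow_add]
    -- One factor 2⁻ˢ comes from the uniform gauge state and one from the projection, against two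
    -- character sums. So t² = 1 is needed for t = 2⁻ˢ2ˢ, obtained below as (t + 1)(t − 1) = 0.
    have h2 : (2⁻¹ : ℂ) ^ P.s * 2 ^ P.s = 1 := by rw [← mul_pow]; norm_num
    linear_combination ((2⁻¹ : ℂ) ^ Fintype.card (Reg k) * ((patternProb ε e : ℂ) *
      ((tensorOp U (x ∘ Sum.inl) (x ∘ Sum.inl) * sgn (κ ⬝ᵥ (x ∘ Sum.inl)))
          * star (tensorOp U (y ∘ Sum.inl) (y ∘ Sum.inl) * sgn (κ ⬝ᵥ (y ∘ Sum.inl)))))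
        * ((2⁻¹ : ℂ) ^ P.s * 2 ^ P.s + 1)) * h2
  · simp

theorem run_ofList_cons {ι : Type} [Fintype ι] [DecidableEq ι] (p : Prog ι) (ps : List (Prog ι))
    (R : Op ι) : (Prog.ofList (p :: ps)).run R = (Prog.ofList ps).run (p.run R) := rfl

theorem map_acceptPlus {κ ι : Type} [Fintype κ] [DecidableEq κ] [Fintype ι] [DecidableEq ι]
    (f : κ ↪ ι) (L : List κ) : (acceptPlus L).map f = acceptPlus (L.map f) := by
  simp only [acceptPlus, Prog.map, map_circuit, map_measureAll, List.map_map]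
  congr 2
  funext o
  simp only [List.forall_mem_map, Function.comp_apply]
  split_ifs <;> rfl

theorem run_prepare (P : Synthillation k U) (ε : ℝ) :
    P.prepare.run (tens (tens (zeroOp (Reg k ⊕ Fin P.s)) (zeroOp (Fin P.m)))
        (prodOp fun _ => noisyT ε))
      = P.labOp (∑ e ∈ P.undetected,
          (patternProb ε e : ℂ) • resourceOp U (P.syndrome e ∘ Sum.inl)) := by
  have hhad : Prog.circuit ((((regList k).map fun a => (Sum.inl (Sum.inl (Sum.inl a)) : P.Lab)) ++
      ((List.finRange P.s).map fun i => (Sum.inl (Sum.inl (Sum.inr i)) : P.Lab))).map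
        CliffordGate.hadamard)
      = ((Prog.circuit ((rowList k P.s).map CliffordGate.hadamard)).map
          Function.Embedding.inl).map Function.Embedding.inl := by
    rw [map_circuit, map_circuit]
    simp only [rowList, List.map_append, List.map_map]
    rfl
  have hgauge : ∀ R : Op P.Lab, (acceptPlus ((List.finRange P.s).map
        fun i => (Sum.inl (Sum.inl (Sum.inr i)) : P.Lab))).run R
      = ((((acceptPlus (List.finRange P.s)).map Function.Embedding.inr).map
          Function.Embedding.inl).map Function.Embedding.inl).run R := by
    intro R
    rw [map_acceptPlus, map_acceptPlus, map_acceptPlus, List.map_map, List.map_map]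
    rfl
  simp only [prepare, run_ofList_cons]
  rw [hhad, run_map_inl_tens,
    run_map_inl_tens (Prog.circuit ((rowList k P.s).map CliffordGate.hadamard)),
    run_circuit ((rowList k P.s).map CliffordGate.hadamard),
    conj_hadamard_zeroOp _ (nodup_rowList _) (mem_rowList _), run_encode_inject_decode,
    map_trans, run_map_inl_tens, run_map_inl_tens]
  refine (hgauge _).trans ?_
  rw [run_map_inl_tens, run_map_inl_tens, run_gauge]
  rfl

end Synthillation

theorem bits_add_self {ι : Type} (x : Bits ι) : x + x = 0 :=
  funext fun _ => CharTwo.add_self_eq_zero _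

/-! ### Swapping two registers by CNOT gates -/

section Swap

variable {κ : Type} [Fintype κ] [DecidableEq κ]

/-- CNOTs from the second copy of the listed qubits to the first. -/
def pairsLeft (L : List κ) : List (CnotPair (κ ⊕ κ)) :=
  L.map fun i => ⟨(Sum.inr i, Sum.inl i), Sum.inr_ne_inl⟩

/-- CNOTs from the first copy of the listed qubits to the second. -/
def pairsRight (L : List κ) : List (CnotPair (κ ⊕ κ)) :=
  L.map fun i => ⟨(Sum.inl i, Sum.inr i), Sum.inl_ne_inr⟩

theorem circuitEquiv_pairsLeft (L : List κ) (hL : L.Nodup) (z : Bits (κ ⊕ κ)) :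
    circuitEquiv (pairsLeft L) z
      = Sum.elim (fun i => z (Sum.inl i) + if i ∈ L then z (Sum.inr i) else 0) (z ∘ Sum.inr) := by
  induction L generalizing z with
  | nil =>
    funext a
    cases a <;> simp [pairsLeft, circuitEquiv]
  | cons c L ih =>
    obtain ⟨hc, hL⟩ := List.nodup_cons.1 hL
    show circuitEquiv (pairsLeft L) (cnotEquiv _ _ _ z) = _
    rw [ih hL]
    simp only [cnotEquiv_apply]
    funext a
    cases a with
    | inl i =>
      by_cases h : i = c
      · subst h; simp [hc]
      · simp [h, Function.update_of_ne]
    | inr i => simp [Function.update_of_ne]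

theorem circuitEquiv_pairsRight (L : List κ) (hL : L.Nodup) (z : Bits (κ ⊕ κ)) :
    circuitEquiv (pairsRight L) z
      = Sum.elim (z ∘ Sum.inl) (fun i => z (Sum.inr i) + if i ∈ L then z (Sum.inl i) else 0) := by
  induction L generalizing z with
  | nil =>
    funext a
    cases a <;> simp [pairsRight, circuitEquiv]
  | cons c L ih =>
    obtain ⟨hc, hL⟩ := List.nodup_cons.1 hL
    show circuitEquiv (pairsRight L) (cnotEquiv _ _ _ z) = _
    rw [ih hL]
    simp only [cnotEquiv_apply]
    funext a
    cases a with
    | inr i =>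
      by_cases h : i = c
      · subst h; simp [hc]
      · simp [h, Function.update_of_ne]
    | inl i => simp [Function.update_of_ne]

theorem circuitEquiv_pairsLeft_univ (L : List κ) (hL : L.Nodup)
    (hm : ∀ a, a ∈ L) (z : Bits (κ ⊕ κ)) :
    circuitEquiv (pairsLeft L) z = Sum.elim (z ∘ Sum.inl + z ∘ Sum.inr) (z ∘ Sum.inr) := by
  rw [circuitEquiv_pairsLeft L hL]
  simp only [hm, if_true]
  rfl

theorem circuitEquiv_pairsRight_univ (L : List κ) (hL : L.Nodup)
    (hm : ∀ a, a ∈ L) (z : Bits (κ ⊕ κ)) :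
    circuitEquiv (pairsRight L) z = Sum.elim (z ∘ Sum.inl) (z ∘ Sum.inr + z ∘ Sum.inl) := by
  rw [circuitEquiv_pairsRight L hL]
  simp only [hm, if_true]
  rfl

theorem conj_pairsLeft_apply (L : List κ) (hL : L.Nodup)
    (hm : ∀ a, a ∈ L) (R : Op (κ ⊕ κ)) (x y : Bits (κ ⊕ κ)) :
    conj (circuitOp CliffordGate.op ((pairsLeft L).map CnotPair.gate)) R x y
      = R (Sum.elim (x ∘ Sum.inl + x ∘ Sum.inr) (x ∘ Sum.inr))
          (Sum.elim (y ∘ Sum.inl + y ∘ Sum.inr) (y ∘ Sum.inr)) := by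
  have h : ∀ z, (circuitEquiv (pairsLeft L)).symm z
      = Sum.elim (z ∘ Sum.inl + z ∘ Sum.inr) (z ∘ Sum.inr) := fun z => by
    rw [LinearEquiv.symm_apply_eq, circuitEquiv_pairsLeft_univ L hL hm]
    simp only [Sum.elim_comp_inl, Sum.elim_comp_inr, add_assoc, bits_add_self, add_zero,
      Sum.elim_comp_inl_inr]
  rw [circuitOp_cnot, conj_permOp_apply, h, h]

theorem conj_pairsRight_apply (L : List κ) (hL : L.Nodup)
    (hm : ∀ a, a ∈ L) (R : Op (κ ⊕ κ)) (x y : Bits (κ ⊕ κ)) :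
    conj (circuitOp CliffordGate.op ((pairsRight L).map CnotPair.gate)) R x y
      = R (Sum.elim (x ∘ Sum.inl) (x ∘ Sum.inr + x ∘ Sum.inl))
          (Sum.elim (y ∘ Sum.inl) (y ∘ Sum.inr + y ∘ Sum.inl)) := by
  have h : ∀ z, (circuitEquiv (pairsRight L)).symm z
      = Sum.elim (z ∘ Sum.inl) (z ∘ Sum.inr + z ∘ Sum.inl) := fun z => by
    rw [LinearEquiv.symm_apply_eq, circuitEquiv_pairsRight_univ L hL hm]
    simp only [Sum.elim_comp_inl, Sum.elim_comp_inr, add_assoc, bits_add_self, add_zero,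
      Sum.elim_comp_inl_inr]
  rw [circuitOp_cnot, conj_permOp_apply, h, h]

theorem conj_swap_tens (L : List κ) (hL : L.Nodup)
    (hm : ∀ a, a ∈ L) (A B : Op κ) :
    conj (circuitOp CliffordGate.op ((pairsLeft L).map CnotPair.gate
      ++ (pairsRight L).map CnotPair.gate ++ (pairsLeft L).map CnotPair.gate)) (tens A B)
      = tens B A := by
  ext x y
  rw [circuitOp_append, circuitOp_append, conj_mul, conj_mul, conj_pairsLeft_apply L hL hm,
    conj_pairsRight_apply L hL hm, conj_pairsLeft_apply L hL hm]
  simp only [tens, Matrix.of_apply, Sum.elim_comp_inl, Sum.elim_comp_inr]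
  have h : ∀ u v : Bits κ, v + (u + v) = u := fun u v => by
    rw [add_comm u v, ← add_assoc, bits_add_self, zero_add]
  rw [h, h, h, h, mul_comm]

end Swap

/-! ### Gate teleportation with Z errors -/

section Teleport

variable {κ : Type} [Fintype κ] [DecidableEq κ]

/-- The product of Pauli `Z` operators `Z[b]`. -/
noncomputable def zOp (b : Bits κ) : Op κ := Matrix.diagonal fun x => sgn (b ⬝ᵥ x)

/-- The projector onto the basis state `a`. -/
def basisOp (a : Bits κ) : Op κ := Matrix.of fun x y => if x = a ∧ y = a then 1 else 0

theorem mul_shiftOp_apply (M : Op κ) (a x y : Bits κ) : (M * shiftOp a) x y = M x (y + a) := by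
  simp [Matrix.mul_apply, shiftOp]

theorem shiftOp_mul_apply (a : Bits κ) (R : Op κ) (x y : Bits κ) :
    (shiftOp a * R) x y = R (x + a) y := by
  rw [Matrix.mul_apply, Finset.sum_eq_single (x + a)]
  · simp [shiftOp, add_assoc, bits_add_self]
  · intro b _ hb
    simp only [shiftOp, Matrix.of_apply]
    rw [if_neg, zero_mul]
    rintro rfl
    apply hb
    rw [add_assoc, bits_add_self, add_zero]
  · simp

theorem zOp_mul_shiftOp (b a : Bits κ) :
    zOp b * shiftOp a = sgn (b ⬝ᵥ a) • (shiftOp a * zOp b) := by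
  ext x y
  rw [mul_shiftOp_apply]
  simp only [zOp, Matrix.smul_apply, Matrix.mul_diagonal, Matrix.diagonal_apply, shiftOp,
    Matrix.of_apply, smul_eq_mul]
  split_ifs with h
  · rw [h, dotProduct_add, sgn_add]; ring
  · ring

theorem conj_smul_left (c : ℂ) (M R : Op κ) (hc : ‖c‖ = 1) : conj (c • M) R = conj M R := by
  have h : star c * c = 1 := by
    rw [mul_comm, Complex.star_def, Complex.mul_conj, Complex.normSq_eq_norm_sq, hc]; simp
  simp only [conj, Matrix.conjTranspose_smul, Matrix.smul_mul, Matrix.mul_smul, smul_smul]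
  rw [h, one_smul]

theorem norm_sgn (a : ZMod 2) : ‖sgn a‖ = 1 := by simp [sgn]

theorem conj_mul_shiftOp_apply (d : Bits κ → ℂ) (a : Bits κ) (σ : Op κ) (x y : Bits κ) :
    conj (Matrix.diagonal d * shiftOp a) σ x y = d x * σ (x + a) (y + a) * star (d y) := by
  rw [conj_mul, conj_diagonal_apply]
  have h2 : conj (shiftOp a) σ x y = σ (x + a) (y + a) := by
    rw [conj, mul_assoc, shiftOp_mul_apply]
    rw [← Matrix.conjTranspose_conjTranspose σ, ← Matrix.conjTranspose_mul,
      Matrix.conjTranspose_apply, shiftOp_mul_apply]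
    rfl
  rw [h2]

/-- The resource state for the diagonal unitary `W`. -/
noncomputable def diagState (W : Op κ) : Op κ :=
  Matrix.of fun x y => (2⁻¹ : ℂ) ^ Fintype.card κ * (W x x * star (W y y))

/-- After outcome a the resource carries W Z[b] X[a] applied to σ, up to normalisation. Z[b] and
X[a] commute up to a sign, which conjugation ignores, so X[a] can be brought next to W, where the
fixup removes it and Z[b] remains. -/
theorem fixup_conj {W C : Op κ} {d : Bits κ → ℂ} (hW : W = Matrix.diagonal d) {ζ : ℂ}
    (hζ : ‖ζ‖ = 1) {a : Bits κ} (hC : C * (W * shiftOp a) = ζ • W) (b : Bits κ) (σ : Op κ) :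
    conj C (Matrix.of fun x y => σ (a + x) (a + y) * diagState (W * zOp b) x y)
      = (2⁻¹ : ℂ) ^ Fintype.card κ • conj (W * zOp b) σ := by
  have hd : W * zOp b = Matrix.diagonal fun x => d x * sgn (b ⬝ᵥ x) := by
    rw [hW, zOp, Matrix.diagonal_mul_diagonal]
  have h1 : (Matrix.of fun x y => σ (a + x) (a + y) * diagState (W * zOp b) x y : Op κ)
      = (2⁻¹ : ℂ) ^ Fintype.card κ • conj (W * zOp b * shiftOp a) σ := by
    ext x y
    rw [hd, Matrix.smul_apply, conj_mul_shiftOp_apply]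
    simp only [diagState, Matrix.of_apply, Matrix.diagonal_apply_eq, smul_eq_mul]
    rw [add_comm a x, add_comm a y]
    ring
  rw [h1, conj_smul, ← conj_mul, mul_assoc W, zOp_mul_shiftOp, Matrix.mul_smul, Matrix.mul_smul,
    conj_smul_left _ _ _ (norm_sgn _), ← mul_assoc W, ← mul_assoc C, hC, Matrix.smul_mul,
    conj_smul_left _ _ _ hζ]

theorem sum_filter_inl {α : Type*} [AddCommMonoid α] (L : List κ) (hm : ∀ a, a ∈ L)
    {_ : DecidablePred fun o : Bits (κ ⊕ κ) => ∀ i, i ∉ L.map Sum.inl → o i = 0}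
    (F : Bits (κ ⊕ κ) → α) :
    ∑ o ∈ Finset.univ.filter (fun o : Bits (κ ⊕ κ) => ∀ i, i ∉ L.map Sum.inl → o i = 0), F o
      = ∑ a : Bits κ, F (Sum.elim a 0) := by
  refine Finset.sum_nbij' (fun o => o ∘ Sum.inl) (fun a => Sum.elim a 0) ?_ ?_ ?_ ?_ ?_
  · simp
  · intro a _
    simp only [Finset.mem_filter, Finset.mem_univ, true_and]
    intro i hi
    cases i with
    | inl i => exact absurd (List.mem_map_of_mem (hm i)) hi
    | inr i => rfl
  · intro o ho
    simp only [Finset.mem_filter, Finset.mem_univ, true_and] at ho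
    funext i
    cases i with
    | inl i => rfl
    | inr i => exact (ho _ (by simp)).symm
  · intro a _; rfl
  · intro o ho
    simp only [Finset.mem_filter, Finset.mem_univ, true_and] at ho
    congr 1
    funext i
    cases i with
    | inl i => rfl
    | inr i => exact ho _ (by simp)

theorem sum_basisOp : ∑ a : Bits κ, basisOp a = 1 := by
  ext x y
  rw [Matrix.sum_apply, Matrix.one_apply, Finset.sum_eq_single x]
  · simp only [basisOp, Matrix.of_apply, true_and]
    exact if_congr eq_comm rfl rfl
  · intro b _ hb
    simp [basisOp, Ne.symm hb]
  · simp

end Teleport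

namespace Synthillation

variable {l : ℕ} {k : Fin l → ℕ} {U : ∀ j, Op (Fin (k j))}

/-- Every outcome a has probability weight 2^(−k_j) and leaves the same state on the resource, with
|a⟩ on the measured qubits. After the swap, summing over a leaves the used register maximally mixed
and in a product with the data. -/
theorem run_teleport (P : Synthillation k U) (j : Fin l) {d : Bits (Fin (k j)) → ℂ}
    (hU : U j = Matrix.diagonal d) (b : Bits (Fin (k j))) (σ : Op (Fin (k j))) :
    (P.teleport j).run (tens σ (diagState (U j * zOp b)))
      = tens (conj (U j * zOp b) σ) ((2⁻¹ : ℂ) ^ k j • 1) := by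
  have hL := List.nodup_finRange (k j)
  have hm : ∀ a, a ∈ List.finRange (k j) := List.mem_finRange
  have hleft : ((List.finRange (k j)).map fun i =>
      (CliffordGate.cnot (Sum.inr i) (Sum.inl i) Sum.inr_ne_inl : CliffordGate (Fin (k j) ⊕ Fin (k j))))
      = (pairsLeft (List.finRange (k j))).map CnotPair.gate := by
    rw [pairsLeft, List.map_map]; rfl
  have hright : ((List.finRange (k j)).map fun i =>
      (CliffordGate.cnot (Sum.inl i) (Sum.inr i) Sum.inl_ne_inr : CliffordGate (Fin (k j) ⊕ Fin (k j))))
      = (pairsRight (List.finRange (k j))).map CnotPair.gate := by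
    rw [pairsRight, List.map_map]; rfl
  simp only [teleport, hleft, hright]
  rw [Prog.run, run_circuit, run_measureAll _ (hL.map Sum.inl_injective)]
  have hstep : ∀ a : Bits (Fin (k j)),
      (Prog.seq ((Prog.circuit (P.fixup j a)).map Function.Embedding.inr)
        (Prog.circuit ((pairsLeft (List.finRange (k j))).map CnotPair.gate
          ++ (pairsRight (List.finRange (k j))).map CnotPair.gate
          ++ (pairsLeft (List.finRange (k j))).map CnotPair.gate))).run
        (tens (basisOp a) (Matrix.of fun x y => σ (a + x) (a + y) * diagState (U j * zOp b) x y))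
      = (2⁻¹ : ℂ) ^ k j • tens (conj (U j * zOp b) σ) (basisOp a) := by
    intro a
    obtain ⟨ζ, hζ, hC⟩ := P.fixup_spec j a
    rw [Prog.run, run_map_inr_tens, run_circuit, run_circuit, conj_swap_tens _ hL hm,
      fixup_conj hU hζ hC, Fintype.card_fin]
    ext x y
    simp only [tens, Matrix.of_apply, Matrix.smul_apply, smul_eq_mul]
    ring
  refine (sum_filter_inl _ hm _).trans ?_
  have hfinal : tens (conj (U j * zOp b) σ) ((2⁻¹ : ℂ) ^ k j • (1 : Op (Fin (k j))))
      = ∑ a, (2⁻¹ : ℂ) ^ k j • tens (conj (U j * zOp b) σ) (basisOp a) := by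
    rw [← Finset.smul_sum, ← sum_basisOp]
    ext x y
    simp only [tens, Matrix.of_apply, Matrix.smul_apply, Matrix.sum_apply, smul_eq_mul,
      Finset.mul_sum]
    refine Finset.sum_congr rfl fun a _ => ?_
    ring
  rw [hfinal]
  refine Finset.sum_congr rfl fun a _ => ?_
  rw [← hstep a, Sum.elim_comp_inl]
  congr 1
  ext x y
  simp only [Matrix.of_apply, conj_pairsLeft_apply _ hL hm, tens, basisOp, Sum.elim_comp_inl,
    Sum.elim_comp_inr, List.forall_mem_map, Sum.elim_inl, hm, true_implies]
  have : (∀ i, x (Sum.inl i) = a i ∧ y (Sum.inl i) = a i)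
      ↔ x ∘ Sum.inl = a ∧ y ∘ Sum.inl = a := by
    rw [funext_iff, funext_iff, forall_and]; rfl
  simp only [this]
  split_ifs with h
  · rw [h.1, h.2, one_mul]
  · rw [zero_mul]

end Synthillation

/-! ### Teleportation inside the whole system -/

section EmbeddedSlices

theorem extend_sumMap {α β α' β' : Type} (f : α ↪ α') (g : β ↪ β') (u : Bits (α ⊕ β))
    (x : Bits (α' ⊕ β')) :
    Function.extend (Function.Embedding.sumMap f g) u x
      = Sum.elim (Function.extend f (u ∘ Sum.inl) (x ∘ Sum.inl))
          (Function.extend g (u ∘ Sum.inr) (x ∘ Sum.inr)) := by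
  funext a
  cases a with
  | inl a =>
    by_cases h : ∃ b, f b = a
    · obtain ⟨b, rfl⟩ := h
      rw [Sum.elim_inl, f.injective.extend_apply]
      exact (Function.Embedding.sumMap f g).injective.extend_apply u x (Sum.inl b)
    · rw [Sum.elim_inl, Function.extend_apply' _ _ _ h, Function.extend_apply']
      · rfl
      · rintro ⟨b, hb⟩
        cases b with
        | inl b => exact h ⟨b, Sum.inl_injective hb⟩
        | inr b => exact Sum.inr_ne_inl hb
  | inr a =>
    by_cases h : ∃ b, g b = a
    · obtain ⟨b, rfl⟩ := h
      rw [Sum.elim_inr, g.injective.extend_apply]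
      exact (Function.Embedding.sumMap f g).injective.extend_apply u x (Sum.inr b)
    · rw [Sum.elim_inr, Function.extend_apply' _ _ _ h, Function.extend_apply']
      · rfl
      · rintro ⟨b, hb⟩
        cases b with
        | inr b => exact h ⟨b, Sum.inr_injective hb⟩
        | inl b => exact Sum.inl_ne_inr hb

theorem slice_sumMap_tens {α β α' β' : Type} (f : α ↪ α') (g : β ↪ β') (A : Op α') (B : Op β')
    (x y : Bits (α' ⊕ β')) :
    slice (Function.Embedding.sumMap f g) (tens A B) x y
      = tens (slice f A (x ∘ Sum.inl) (y ∘ Sum.inl)) (slice g B (x ∘ Sum.inr) (y ∘ Sum.inr)) := by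
  ext u v
  simp only [slice_apply, extend_sumMap, tens, Matrix.of_apply, Sum.elim_comp_inl,
    Sum.elim_comp_inr]

theorem extend_trans {α β γ : Type} (f : α ↪ β) (g : β ↪ γ) (u : Bits α) (x : Bits γ) :
    Function.extend (f.trans g) u x = Function.extend g (Function.extend f u (x ∘ g)) x := by
  funext c
  by_cases h : ∃ b, g b = c
  · obtain ⟨b, rfl⟩ := h
    rw [g.injective.extend_apply]
    by_cases h' : ∃ a, f a = b
    · obtain ⟨a, rfl⟩ := h'
      rw [f.injective.extend_apply]
      exact (f.trans g).injective.extend_apply u x a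
    · rw [Function.extend_apply' _ _ _ h', Function.extend_apply']
      · rfl
      · rintro ⟨a, ha⟩
        exact h' ⟨a, g.injective ha⟩
  · rw [Function.extend_apply' _ _ _ h, Function.extend_apply']
    rintro ⟨a, ha⟩
    exact h ⟨f a, ha⟩

theorem slice_trans {α β γ : Type} (f : α ↪ β) (g : β ↪ γ) (R : Op γ) (x y : Bits γ) :
    slice (f.trans g) R x y = slice f (slice g R x y) (x ∘ g) (y ∘ g) := by
  ext u v
  simp only [slice_apply, extend_trans]

theorem slice_smul {α β : Type} (f : α ↪ β) (c : ℂ) (R : Op β) (x y : Bits β) :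
    slice f (c • R) x y = c • slice f R x y := rfl

theorem tens_smul_left {α β : Type} (c : ℂ) (A : Op α) (B : Op β) :
    tens (c • A) B = c • tens A B := by
  ext x y; simp [tens, mul_assoc]

theorem tens_smul_right {α β : Type} (c : ℂ) (A : Op α) (B : Op β) :
    tens A (c • B) = c • tens A B := by
  ext x y; simp [tens, mul_left_comm]

theorem tens_sum_left {γ α β : Type} (s : Finset γ) (A : γ → Op α) (B : Op β) :
    tens (∑ c ∈ s, A c) B = ∑ c ∈ s, tens (A c) B := by
  ext x y; simp [tens, Matrix.sum_apply, Finset.sum_mul]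

theorem tens_sum_right {γ α β : Type} (s : Finset γ) (A : Op α) (B : γ → Op β) :
    tens A (∑ c ∈ s, B c) = ∑ c ∈ s, tens A (B c) := by
  ext x y; simp [tens, Matrix.sum_apply, Finset.mul_sum]

theorem trace_tens {α β : Type} [Fintype α] [DecidableEq α] [Fintype β] [DecidableEq β]
    (A : Op α) (B : Op β) : (tens A B).trace = A.trace * B.trace := by
  simp only [Matrix.trace, Matrix.diag_apply, Finset.sum_mul_sum]
  rw [← Finset.sum_product', Finset.univ_product_univ]
  exact Fintype.sum_equiv (Equiv.sumArrowEquivProdArrow α β (ZMod 2)) _ _ fun _ => rfl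

theorem ptrace_tens {α β : Type} [Fintype β] [DecidableEq β] (A : Op α) (B : Op β) :
    ptrace (tens A B) = B.trace • A := by
  ext x y
  simp only [ptrace, tens, Matrix.of_apply, Sum.elim_comp_inl, Sum.elim_comp_inr,
    ← Finset.mul_sum, Matrix.smul_apply, smul_eq_mul, Matrix.trace, Matrix.diag_apply]
  rw [mul_comm]

theorem trace_zeroOp (ι : Type) [Fintype ι] [DecidableEq ι] : (zeroOp ι).trace = 1 := by
  simp [Matrix.trace, zeroOp]

theorem trace_prodOp_mixed (ι : Type) [Fintype ι] [DecidableEq ι] :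
    (prodOp fun _ : ι => mixed).trace = 1 := by
  simp [Matrix.trace, prodOp, mixed]

theorem trace_uniform (ι : Type) [Fintype ι] [DecidableEq ι] :
    ∑ _x : Bits ι, (2⁻¹ : ℂ) ^ Fintype.card ι = 1 := by
  simp

end EmbeddedSlices

namespace Synthillation

variable {l : ℕ} {k : Fin l → ℕ} {U : ∀ j, Op (Fin (k j))}

/-- A product state of the parts of the register. -/
noncomputable def regProd (τ : ∀ j, Op (Fin (k j))) : Op (Reg k) :=
  Matrix.of fun x y => ∏ j, τ j (fun i => x ⟨j, i⟩) (fun i => y ⟨j, i⟩)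

/-- The inclusion of the `j`-th part of the register. -/
def part (j : Fin l) : Fin (k j) ↪ Reg k := ⟨fun i => ⟨j, i⟩, fun a b h => by simpa using h⟩

theorem extend_part_self (j : Fin l) (u : Bits (Fin (k j))) (x : Bits (Reg k)) :
    (fun i => Function.extend (part j) u x ⟨j, i⟩) = u := by
  funext i
  exact (part j).injective.extend_apply u x i

theorem extend_part_ne {j a : Fin l} (h : a ≠ j) (u : Bits (Fin (k j))) (x : Bits (Reg k)) :
    (fun i => Function.extend (part j) u x ⟨a, i⟩) = fun i => x ⟨a, i⟩ := by
  funext i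
  refine Function.extend_apply' _ _ _ ?_
  rintro ⟨b, hb⟩
  exact h (congrArg Sigma.fst hb).symm

theorem slice_regProd (τ : ∀ j, Op (Fin (k j))) (j : Fin l) (M : Op (Fin (k j)))
    (x y : Bits (Reg k)) :
    slice (part j) (regProd (Function.update τ j M)) x y
      = (∏ a ∈ Finset.univ.erase j, τ a (fun i => x ⟨a, i⟩) (fun i => y ⟨a, i⟩)) • M := by
  ext u v
  simp only [slice_apply, regProd, Matrix.of_apply, Matrix.smul_apply, smul_eq_mul]
  rw [← Finset.mul_prod_erase _ _ (Finset.mem_univ j), Function.update_self, extend_part_self,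
    extend_part_self, mul_comm]
  congr 1
  refine Finset.prod_congr rfl fun a ha => ?_
  have h := Finset.ne_of_mem_erase ha
  rw [Function.update_of_ne h, extend_part_ne h, extend_part_ne h]

/-- The scalar is chosen before M, so it is the same before and after a teleportation that changes
only the j-th part of the register. -/
theorem exists_slice_labOp (P : Synthillation k U) (τ : ∀ j, Op (Fin (k j))) (j : Fin l)
    (x y : Bits P.Lab) :
    ∃ c : ℂ, ∀ M, slice (P.resource j) (P.labOp (regProd (Function.update τ j M))) x y = c • M := by
  have hres : P.resource j
      = (((part j).trans Function.Embedding.inl).trans Function.Embedding.inl).trans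
          Function.Embedding.inl := rfl
  simp only [hres, slice_trans, labOp, slice_inl_tens, slice_smul, slice_regProd, smul_smul]
  exact ⟨_, fun M => rfl⟩

theorem run_teleport_tens (P : Synthillation k U) {D : Type} [Fintype D] [DecidableEq D]
    (place : ∀ j, Fin (k j) ↪ D) (j : Fin l) {d : Bits (Fin (k j)) → ℂ}
    (hU : U j = Matrix.diagonal d) (b : Bits (Fin (k j))) (σ : Op D) (τ : ∀ j, Op (Fin (k j)))
    (hτ : τ j = diagState (U j * zOp b)) :
    ((P.teleport j).map (Function.Embedding.sumMap (place j) (P.resource j))).run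
        (tens σ (P.labOp (regProd τ)))
      = tens (conj (embedOp (place j) (U j * zOp b)) σ)
          (P.labOp (regProd (Function.update τ j ((2⁻¹ : ℂ) ^ k j • 1)))) := by
  ext x y
  obtain ⟨c, hc⟩ := P.exists_slice_labOp τ j (x ∘ Sum.inr) (y ∘ Sum.inr)
  have h1 := hc (τ j)
  rw [Function.update_eq_self] at h1
  rw [run_map_apply, slice_sumMap_tens, h1, hτ, tens_smul_right, run_smul, P.run_teleport j hU]
  simp only [tens, Matrix.smul_apply, Matrix.of_apply, smul_eq_mul]
  rw [conj_embedOp_apply, ← slice_self (P.resource j) (P.labOp _) (x ∘ Sum.inr) (y ∘ Sum.inr), hc]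
  simp only [Matrix.smul_apply, smul_eq_mul]
  rw [mul_left_comm]
  rfl

/-- The unitaries `U_j Z[κ_j]`. -/
noncomputable def withErrors (U : ∀ j, Op (Fin (k j))) (κ : Bits (Reg k)) (j : Fin l) :
    Op (Fin (k j)) :=
  U j * zOp fun i => κ ⟨j, i⟩

/-- Both U_F and the sign of κ · x factorise over the parts, so even a correlated error acts on each
U_j by its own Z[κ_j] once its pattern is fixed. -/
theorem resourceOp_eq (hU : ∀ j, ∃ d, U j = Matrix.diagonal d) (κ : Bits (Reg k)) :
    resourceOp U κ = regProd fun j => diagState (withErrors U κ j) := by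
  choose d hd using hU
  ext x y
  simp only [resourceOp, regProd, diagState, Matrix.of_apply, withErrors, Finset.prod_mul_distrib,
    Fintype.card_fin, Finset.prod_pow_eq_pow_sum, Fintype.card_sigma, ← star_prod]
  have h : ∀ x : Bits (Reg k), tensorOp U x x * sgn (κ ⬝ᵥ x)
      = ∏ j, (U j * zOp fun i => κ ⟨j, i⟩) (fun i => x ⟨j, i⟩) (fun i => x ⟨j, i⟩) := fun x => by
    simp only [hd, zOp, Matrix.diagonal_mul_diagonal, Matrix.diagonal_apply_eq, tensorOp,
      Matrix.of_apply, Finset.prod_mul_distrib]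
    congr 1
    rw [← sgn_sum]
    simp only [dotProduct, Fintype.sum_sigma]
  rw [h, h]

/-- The induction keeps computer and laboratory in a product state: parts already used are maximally
mixed, the others still hold their resource states. -/
theorem foldl_teleport (P : Synthillation k U) {D : Type} [Fintype D] [DecidableEq D]
    (place : ∀ j, Fin (k j) ↪ D) (V : Fin l → Op D) (hU : ∀ j, ∃ d, U j = Matrix.diagonal d)
    (κ : Bits (Reg k)) (L : List (Fin l)) (hL : L.Nodup) (σ : Op D) (τ : ∀ j, Op (Fin (k j)))
    (hτ : ∀ j ∈ L, τ j = diagState (withErrors U κ j)) :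
    L.foldl (fun σ j => ((P.teleport j).map
          (Function.Embedding.sumMap (place j) (P.resource j))).run
        (conj (embedOp Function.Embedding.inl (V j)) σ)) (tens σ (P.labOp (regProd τ)))
      = tens (L.foldl (fun σ j => conj (embedOp (place j) (withErrors U κ j)) (conj (V j) σ)) σ)
          (P.labOp (regProd fun j => if j ∈ L then (2⁻¹ : ℂ) ^ k j • 1 else τ j)) := by
  induction L generalizing σ τ with
  | nil => simp
  | cons j L ih =>
    obtain ⟨hj, hL⟩ := List.nodup_cons.1 hL
    obtain ⟨d, hd⟩ := hU j
    rw [List.foldl_cons, conj_embedOp_inl_tens,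
      P.run_teleport_tens place j hd (fun i => κ ⟨j, i⟩) _ τ (hτ j (by simp)), ih hL]
    · rw [List.foldl_cons]
      congr 3
      funext a
      by_cases ha : a = j
      · subst ha; simp
      · simp [ha]
    · intro a ha
      have haj : a ≠ j := by rintro rfl; exact hj ha
      rw [Function.update_of_ne haj, hτ a (by simp [ha])]

theorem trace_labOp_uniform (P : Synthillation k U) :
    (P.labOp (regProd fun j => (2⁻¹ : ℂ) ^ k j • 1)).trace = 1 := by
  rw [labOp, trace_tens, trace_tens, trace_tens, trace_zeroOp, trace_zeroOp, trace_prodOp_mixed,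
    mul_one, mul_one, mul_one, ← trace_uniform (Reg k)]
  simp only [Matrix.trace, Matrix.diag_apply, regProd, Matrix.of_apply, Matrix.smul_apply,
    Matrix.one_apply_eq, smul_eq_mul, mul_one, Finset.prod_pow_eq_pow_sum, Fintype.card_sigma,
    Fintype.card_fin]

theorem ptrace_foldl_teleport (P : Synthillation k U) {D : Type} [Fintype D] [DecidableEq D]
    (place : ∀ j, Fin (k j) ↪ D) (V : Fin l → Op D) (hU : ∀ j, ∃ d, U j = Matrix.diagonal d)
    (κ : Bits (Reg k)) (ρ : Op D) :
    ptrace ((List.finRange l).foldl (fun σ j => ((P.teleport j).map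
          (Function.Embedding.sumMap (place j) (P.resource j))).run
        (conj (embedOp Function.Embedding.inl (V j)) σ)) (tens ρ (P.labOp (resourceOp U κ))))
      = ideal (withErrors U κ) place V ρ := by
  rw [resourceOp_eq hU, P.foldl_teleport place V hU κ _ (List.nodup_finRange l) _ _ fun _ _ => rfl]
  simp only [List.mem_finRange, if_true]
  rw [ptrace_tens, trace_labOp_uniform, one_smul]
  rfl

theorem exists_foldlLin {ι α : Type} [Fintype ι] [DecidableEq ι] (F : Op ι → α → Op ι)
    (hF : ∀ a, ∃ φ : Op ι →ₗ[ℂ] Op ι, ∀ R, F R a = φ R) (L : List α) :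
    ∃ φ : Op ι →ₗ[ℂ] Op ι, ∀ R, L.foldl F R = φ R := by
  induction L with
  | nil => exact ⟨LinearMap.id, fun _ => rfl⟩
  | cons a L ih =>
    obtain ⟨φ, hφ⟩ := ih
    obtain ⟨ψ, hψ⟩ := hF a
    exact ⟨φ ∘ₗ ψ, fun R => by rw [List.foldl_cons, hφ, hψ]; rfl⟩

/-- Partial trace as a linear map. -/
def ptraceLin {ι κ : Type} [Fintype κ] [DecidableEq κ] : Op (ι ⊕ κ) →ₗ[ℂ] Op ι where
  toFun := ptrace
  map_add' A B := by ext x y; simp [ptrace, Finset.sum_add_distrib]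
  map_smul' c A := by ext x y; simp [ptrace, Finset.mul_sum]

/-- The state after a successful run is a mixture of the ideal computations with `Z` errors that
the undetected error patterns cause. -/
theorem accepted_eq (P : Synthillation k U) {D : Type} [Fintype D] [DecidableEq D]
    (place : ∀ j, Fin (k j) ↪ D) (V : Fin l → Op D) (hU : ∀ j, ∃ d, U j = Matrix.diagonal d)
    (ε : ℝ) (ρ : Op D) :
    P.accepted place V ε ρ = ∑ e ∈ P.undetected,
      (patternProb ε e : ℂ) • ideal (withErrors U (P.syndrome e ∘ Sum.inl)) place V ρ := by
  rw [accepted, initial_eq, run_map_inr_tens, run_prepare]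
  -- The whole teleportation stage is linear, so the mixture over error patterns can be treated one
  -- pattern at a time.
  obtain ⟨φ, hφ⟩ := exists_foldlLin (fun σ j => ((P.teleport j).map
          (Function.Embedding.sumMap (place j) (P.resource j))).run
        (conj (embedOp Function.Embedding.inl (V j)) σ)) (fun j => by
      obtain ⟨ψ, hψ⟩ := exists_runLin
        ((P.teleport j).map (Function.Embedding.sumMap (place j) (P.resource j)))
      exact ⟨ψ ∘ₗ conjLin (embedOp Function.Embedding.inl (V j)), fun R => hψ _⟩)
      (List.finRange l)
  have hlin : tens ρ (P.labOp (∑ e ∈ P.undetected,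
        (patternProb ε e : ℂ) • resourceOp U (P.syndrome e ∘ Sum.inl)))
      = ∑ e ∈ P.undetected, (patternProb ε e : ℂ) •
          tens ρ (P.labOp (resourceOp U (P.syndrome e ∘ Sum.inl))) := by
    simp only [labOp, tens_sum_left, tens_sum_right, tens_smul_left, tens_smul_right]
  rw [hlin, hφ]
  show ptraceLin _ = _
  rw [map_sum, map_sum]
  refine Finset.sum_congr rfl fun e _ => ?_
  rw [map_smul, map_smul, ← P.ptrace_foldl_teleport place V hU, hφ]
  rfl

end Synthillation

/-! ### Density matrices and sizes of pattern probabilities -/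

section States

variable {ι : Type} [Fintype ι] [DecidableEq ι]

theorem IsState.conj {ρ M : Op ι} (hρ : IsState ρ) (hM : M ∈ Matrix.unitaryGroup (Bits ι) ℂ) :
    IsState (conj M ρ) := by
  refine ⟨hρ.1.mul_mul_conjTranspose_same M, ?_⟩
  rw [Synth.conj, Matrix.trace_mul_cycle, ← Matrix.star_eq_conjTranspose,
    Matrix.mem_unitaryGroup_iff'.1 hM, one_mul]
  exact hρ.2

theorem zOp_mem_unitaryGroup (b : Bits ι) : zOp b ∈ Matrix.unitaryGroup (Bits ι) ℂ := by
  rw [Matrix.mem_unitaryGroup_iff, Matrix.star_eq_conjTranspose, zOp,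
    Matrix.diagonal_conjTranspose, Matrix.diagonal_mul_diagonal, ← Matrix.diagonal_one]
  congr 1
  funext x
  rw [Pi.star_apply, star_sgn, sgn_mul_self]

theorem zOp_zero : zOp (0 : Bits ι) = 1 := by
  rw [zOp, ← Matrix.diagonal_one]
  congr 1
  funext x
  rw [zero_dotProduct, sgn_zero]

theorem isState_ideal {l : ℕ} {k : Fin l → ℕ} {U : ∀ j, Op (Fin (k j))}
    (hU : ∀ j, U j ∈ Matrix.unitaryGroup (Bits (Fin (k j))) ℂ) (place : ∀ j, Fin (k j) ↪ ι)
    {V : Fin l → Op ι} (hV : ∀ j, V j ∈ Matrix.unitaryGroup (Bits ι) ℂ) {ρ : Op ι}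
    (hρ : IsState ρ) : IsState (ideal U place V ρ) := by
  rw [ideal]
  generalize List.finRange l = L
  induction L generalizing ρ with
  | nil => exact hρ
  | cons j L ih => exact ih ((hρ.conj (hV j)).conj (embedOp_mem_unitaryGroup _ (hU j)))

theorem isState_sum {α : Type*} {s : Finset α} {w : α → ℝ} (hw : ∀ a ∈ s, 0 ≤ w a)
    (h1 : ∑ a ∈ s, w a = 1) {R : α → Op ι} (hR : ∀ a ∈ s, IsState (R a)) :
    IsState (∑ a ∈ s, (w a : ℂ) • R a) := by
  constructor
  · refine Matrix.posSemidef_sum s fun a ha => ?_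
    exact (hR a ha).1.smul (by exact_mod_cast hw a ha)
  · rw [Matrix.trace_sum]
    rw [Finset.sum_congr rfl fun a ha => by rw [Matrix.trace_smul, (hR a ha).2, smul_eq_mul, mul_one],
      ← Complex.ofReal_sum, h1, Complex.ofReal_one]

theorem patternProb_nonneg {ε : ℝ} (hε : ε ∈ Set.Icc (0 : ℝ) 1) (e : Bits ι) :
    0 ≤ patternProb ε e := by
  refine Finset.prod_nonneg fun c _ => ?_
  rw [errProb]
  split_ifs
  · linarith [hε.2]
  · exact hε.1

theorem errProb_le_one {ε : ℝ} (hε : ε ∈ Set.Icc (0 : ℝ) 1) (b : ZMod 2) :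
    errProb ε b ≤ 1 := by
  rw [errProb]
  split_ifs
  · linarith [hε.1]
  · exact hε.2

theorem errProb_nonneg {ε : ℝ} (hε : ε ∈ Set.Icc (0 : ℝ) 1) (b : ZMod 2) :
    0 ≤ errProb ε b := by
  rw [errProb]
  split_ifs
  · linarith [hε.2]
  · exact hε.1

theorem patternProb_le_sq {ε : ℝ} (hε : ε ∈ Set.Icc (0 : ℝ) 1) {e : Bits ι} {c c' : ι}
    (hne : c' ≠ c) (hc : e c ≠ 0) (hc' : e c' ≠ 0) : patternProb ε e ≤ ε ^ 2 := by
  rw [patternProb, ← Finset.mul_prod_erase _ _ (Finset.mem_univ c),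
    ← Finset.mul_prod_erase _ _ (Finset.mem_erase.2 ⟨hne, Finset.mem_univ c'⟩), errProb, if_neg hc,
    errProb, if_neg hc', sq, ← mul_assoc]
  exact mul_le_of_le_one_right (mul_nonneg hε.1 hε.1)
    (Finset.prod_le_one (fun a _ => errProb_nonneg hε _) fun a _ => errProb_le_one hε _)

theorem patternProb_zero_right (ε : ℝ) :
    patternProb ε (0 : Bits ι) = (1 - ε) ^ Fintype.card ι := by
  simp [patternProb, errProb]

theorem continuous_patternProb (e : Bits ι) : Continuous fun ε => patternProb ε e := by
  unfold patternProb errProb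
  refine continuous_finsetProd _ fun c _ => ?_
  split_ifs
  · exact continuous_const.sub continuous_id
  · exact continuous_id

theorem one_sub_pow_sub_isBigO (n : ℕ) (f : Filter ℝ) (hf : f ≤ 𝓝 0) :
    (fun ε : ℝ => (1 - ε) ^ n - (1 - n * ε)) =O[f] fun ε : ℝ => ε ^ 2 := by
  induction n with
  | zero => simpa using Asymptotics.isBigO_zero _ _
  | succ n ih =>
    have h1 : (fun ε : ℝ => 1 - ε) =O[f] fun _ => (1 : ℝ) := by
      have : Filter.Tendsto (fun ε : ℝ => 1 - ε) (𝓝 0) (𝓝 (1 - 0)) :=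
        (continuous_const.sub continuous_id).tendsto 0
      exact (this.mono_left hf).isBigO_one ℝ
    -- The recursion is (1 − ε)ⁿ⁺¹ − (1 − (n+1)ε) = (1 − ε)((1 − ε)ⁿ − (1 − nε)) + nε².
    have h2 := (h1.mul ih).add ((Asymptotics.isBigO_refl (fun ε : ℝ => ε ^ 2) f).const_mul_left (n : ℝ)
      |>.congr_right fun ε => (one_mul (ε ^ 2)).symm)
    refine (h2.congr_left fun ε => ?_).congr_right fun ε => one_mul _
    push_cast
    ring

end States

/-! ### Success probability and error rate -/

namespace Synthillation

variable {l : ℕ} {k : Fin l → ℕ} {U : ∀ j, Op (Fin (k j))}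

/-- The probability that no error is detected. -/
noncomputable def successProb (P : Synthillation k U) (ε : ℝ) : ℝ :=
  ∑ e ∈ P.undetected, patternProb ε e

/-- The undetected error patterns that disturb the resource state. -/
def harmful (P : Synthillation k U) : Finset (Bits (Fin P.n)) :=
  P.undetected.filter fun e => P.syndrome e ∘ Sum.inl ≠ 0

/-- The probability of an error given success. -/
noncomputable def errorRate (P : Synthillation k U) (ε : ℝ) : ℝ :=
  (∑ e ∈ P.harmful, patternProb ε e) / P.successProb ε

theorem syndrome_zero (P : Synthillation k U) : P.syndrome 0 = 0 := Matrix.mulVec_zero _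

theorem zero_mem_undetected (P : Synthillation k U) : 0 ∈ P.undetected := by
  rw [undetected, Finset.mem_filter, syndrome_zero]
  exact ⟨Finset.mem_univ _, rfl⟩

/-- Every single error is detected. -/
def DetectsSingle (P : Synthillation k U) : Prop :=
  ∀ c, P.syndrome (Pi.single c 1) ∘ Sum.inr ≠ 0

/-- A nonzero pattern with only one error would be a unit vector, which is detected. So there are
two errors, each with probability ε. -/
theorem patternProb_isBigO (P : Synthillation k U) (hP : P.DetectsSingle) {e : Bits (Fin P.n)}
    (he : e ∈ P.undetected) (h0 : e ≠ 0) :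
    (fun ε : ℝ => patternProb ε e) =O[𝓝[≥] (0 : ℝ)] fun ε : ℝ => ε ^ 2 := by
  obtain ⟨c, hc⟩ := Function.ne_iff.1 h0
  have hc' : ∃ c', c' ≠ c ∧ e c' ≠ 0 := by
    by_contra hcon
    push Not at hcon
    have : e = Pi.single c 1 := by
      funext a
      by_cases ha : a = c
      · subst ha
        rw [Pi.single_eq_same]
        exact (zmod_two_cases (e a)).resolve_left hc
      · rw [Pi.single_eq_of_ne ha, hcon a ha]
    rw [undetected, Finset.mem_filter, this] at he
    exact hP c he.2
  obtain ⟨c', hne, hc'⟩ := hc'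
  refine Asymptotics.IsBigO.of_bound 1 ?_
  filter_upwards [Icc_mem_nhdsGE (show (0 : ℝ) < 1 by norm_num)] with ε hε
  rw [Real.norm_of_nonneg (patternProb_nonneg hε e), Real.norm_of_nonneg (sq_nonneg ε), one_mul]
  exact patternProb_le_sq hε hne hc hc'

theorem successProb_isBigO (P : Synthillation k U) (hP : P.DetectsSingle) :
    (fun ε : ℝ => P.successProb ε - (1 - P.n * ε)) =O[𝓝[≥] (0 : ℝ)] fun ε : ℝ => ε ^ 2 := by
  have h : ∀ ε, P.successProb ε - (1 - P.n * ε)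
      = ((1 - ε) ^ P.n - (1 - P.n * ε)) + ∑ e ∈ P.undetected.erase 0, patternProb ε e := by
    intro ε
    rw [successProb, ← Finset.add_sum_erase _ _ P.zero_mem_undetected, patternProb_zero_right,
      Fintype.card_fin]
    ring
  simp only [h]
  refine (one_sub_pow_sub_isBigO _ _ nhdsWithin_le_nhds).add (Asymptotics.IsBigO.fun_sum fun e he => ?_)
  rw [Finset.mem_erase] at he
  exact P.patternProb_isBigO hP he.2 he.1

theorem errorRate_isBigO (P : Synthillation k U) (hP : P.DetectsSingle) :
    P.errorRate =O[𝓝[≥] (0 : ℝ)] fun ε : ℝ => ε ^ 2 := by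
  have hnum : (fun ε => ∑ e ∈ P.harmful, patternProb ε e) =O[𝓝[≥] (0 : ℝ)]
      fun ε : ℝ => ε ^ 2 := by
    refine Asymptotics.IsBigO.fun_sum fun e he => ?_
    rw [harmful, Finset.mem_filter] at he
    refine P.patternProb_isBigO hP he.1 ?_
    rintro rfl
    exact he.2 (by rw [syndrome_zero]; rfl)
  -- The success probability is continuous with value 1 at ε = 0, so its inverse stays bounded near
  -- 0.
  have hden : (fun ε => (P.successProb ε)⁻¹) =O[𝓝[≥] (0 : ℝ)] fun _ => (1 : ℝ) := by
    have hc : Continuous P.successProb :=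
      continuous_finsetSum _ fun e _ => continuous_patternProb e
    have h0 : P.successProb 0 = 1 := by
      rw [successProb, Finset.sum_eq_single 0]
      · rw [patternProb_zero_right]; simp
      · intro e _ he
        obtain ⟨c, hc⟩ := Function.ne_iff.1 he
        exact Finset.prod_eq_zero (Finset.mem_univ c) (if_neg hc)
      · exact fun h => absurd P.zero_mem_undetected h
    have ht := (hc.tendsto 0).inv₀ (by rw [h0]; exact one_ne_zero)
    exact (ht.mono_left nhdsWithin_le_nhds).isBigO_one ℝ
  exact ((hnum.mul hden).congr_right fun ε => mul_one _).congr_left fun ε => rfl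

theorem harmful_le (P : Synthillation k U) {ε : ℝ} (hε : ε ∈ Set.Icc (0 : ℝ) 1) :
    ∑ e ∈ P.harmful, patternProb ε e ≤ P.successProb ε :=
  Finset.sum_le_sum_of_subset_of_nonneg (Finset.filter_subset _ _)
    fun e _ _ => patternProb_nonneg hε e

theorem harmful_nonneg (P : Synthillation k U) {ε : ℝ} (hε : ε ∈ Set.Icc (0 : ℝ) 1) :
    0 ≤ ∑ e ∈ P.harmful, patternProb ε e :=
  Finset.sum_nonneg fun e _ => patternProb_nonneg hε e

theorem errorRate_mem (P : Synthillation k U) {ε : ℝ} (hε : ε ∈ Set.Icc (0 : ℝ) 1) :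
    0 ≤ P.errorRate ε ∧ P.errorRate ε ≤ 1 :=
  ⟨div_nonneg (P.harmful_nonneg hε) ((P.harmful_nonneg hε).trans (P.harmful_le hε)),
    div_le_one_of_le₀ (P.harmful_le hε) ((P.harmful_nonneg hε).trans (P.harmful_le hε))⟩

/-- If the success probability is 0, the quotient defining the error rate has the default value 0,
but then the harmful weight vanishes as well. -/
theorem successProb_mul_errorRate (P : Synthillation k U) {ε : ℝ}
    (hε : ε ∈ Set.Icc (0 : ℝ) 1) :
    P.successProb ε * P.errorRate ε = ∑ e ∈ P.harmful, patternProb ε e := by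
  by_cases h : P.successProb ε = 0
  · rw [h, zero_mul]
    exact le_antisymm (P.harmful_nonneg hε) (h ▸ P.harmful_le hε)
  · rw [errorRate, mul_div_cancel₀ _ h]

/-- Undetected patterns with trivial logical syndrome reproduce the ideal computation. The harmful
ones, normalised by their total weight, form η; unitarity gives every term trace 1, so the success
probability is independent of the computation. -/
theorem accepted_spec (P : Synthillation k U) (hU : ∀ j, ∃ d, U j = Matrix.diagonal d)
    (hU' : ∀ j, U j ∈ Matrix.unitaryGroup (Bits (Fin (k j))) ℂ)
    {D : Type} [Fintype D] [DecidableEq D] (place : ∀ j, Fin (k j) ↪ D)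
    (V : Fin l → Op D) (hV : ∀ j, V j ∈ Matrix.unitaryGroup (Bits D) ℂ) {ε : ℝ}
    (hε : ε ∈ Set.Icc (0 : ℝ) 1) {ρ : Op D} (hρ : IsState ρ) :
    (P.accepted place V ε ρ).trace = (P.successProb ε : ℂ) ∧
      ∃ η : Op D, IsState η ∧ P.accepted place V ε ρ
        = (P.successProb ε : ℂ) • (((1 - P.errorRate ε : ℝ) : ℂ) • ideal U place V ρ
            + (P.errorRate ε : ℂ) • η) := by
  set R : Bits (Fin P.n) → Op D := fun e =>
    ideal (withErrors U (P.syndrome e ∘ Sum.inl)) place V ρ with hR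
  have hRs : ∀ e, IsState (R e) := fun e => isState_ideal
    (fun j => mul_mem (hU' j) (zOp_mem_unitaryGroup _)) place hV hρ
  have hR0 : ∀ e, P.syndrome e ∘ Sum.inl = 0 → R e = ideal U place V ρ := by
    intro e he
    have : withErrors U (0 : Bits (Reg k)) = U := by
      funext j
      have : zOp (fun i => (0 : Bits (Reg k)) ⟨j, i⟩) = 1 := zOp_zero
      rw [withErrors, this, mul_one]
    rw [hR]
    simp only [he, this]
  rw [P.accepted_eq place V hU]
  constructor
  · rw [Matrix.trace_sum, successProb, Complex.ofReal_sum]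
    refine Finset.sum_congr rfl fun e _ => ?_
    rw [Matrix.trace_smul, (hRs e).2, smul_eq_mul, mul_one]
  · set h := ∑ e ∈ P.harmful, patternProb ε e with hh
    have hprod : P.successProb ε * P.errorRate ε = h := P.successProb_mul_errorRate hε
    have hsplit : ∑ e ∈ P.undetected, (patternProb ε e : ℂ) • R e
        = ((P.successProb ε - h : ℝ) : ℂ) • ideal U place V ρ
          + ∑ e ∈ P.harmful, (patternProb ε e : ℂ) • R e := by
      have hs := Finset.sum_filter_add_sum_filter_not P.undetected
        (fun e => P.syndrome e ∘ Sum.inl ≠ 0) fun e => patternProb ε e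
      rw [← Finset.sum_filter_add_sum_filter_not P.undetected
        (fun e => P.syndrome e ∘ Sum.inl ≠ 0), add_comm]
      congr 1
      have hs' : P.successProb ε - h = ∑ e ∈ P.undetected.filter
          (fun e => ¬ P.syndrome e ∘ Sum.inl ≠ 0), patternProb ε e := by
        rw [successProb, ← hs, hh, harmful]
        ring
      rw [hs', Complex.ofReal_sum, Finset.sum_smul]
      refine Finset.sum_congr rfl fun e he => ?_
      rw [hR0 e (not_not.1 (Finset.mem_filter.1 he).2)]
    have key : ∀ η : Op D, (h : ℂ) • η = ∑ e ∈ P.harmful, (patternProb ε e : ℂ) • R e →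
        ∑ e ∈ P.undetected, (patternProb ε e : ℂ) • R e
        = (P.successProb ε : ℂ) • (((1 - P.errorRate ε : ℝ) : ℂ) • ideal U place V ρ
            + (P.errorRate ε : ℂ) • η) := by
      intro η hη
      rw [hsplit, ← hη, ← hprod, smul_add, smul_smul, smul_smul]
      push_cast
      congr 2
      ring
    by_cases h0 : h = 0
    -- The harmful part has weight 0, so any state may serve as η.
    · refine ⟨ideal U place V ρ, isState_ideal hU' place hV hρ, key _ ?_⟩
      rw [h0, Complex.ofReal_zero, zero_smul, Finset.sum_eq_zero]
      intro e he
      rw [hh, Finset.sum_eq_zero_iff_of_nonneg fun e _ => patternProb_nonneg hε e] at h0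
      rw [h0 e he, Complex.ofReal_zero, zero_smul]
    · refine ⟨∑ e ∈ P.harmful, ((patternProb ε e / h : ℝ) : ℂ) • R e, isState_sum
        (fun e _ => div_nonneg (patternProb_nonneg hε e) (P.harmful_nonneg hε)) ?_
        fun e _ => hRs e, key _ ?_⟩
      · rw [← Finset.sum_div, div_self h0]
      · rw [Finset.smul_sum]
        refine Finset.sum_congr rfl fun e _ => ?_
        rw [smul_smul, ← Complex.ofReal_mul, mul_div_cancel₀ _ h0]

end Synthillation

/-! ### Phases modulo 8 as combinations of parities -/

section PhaseFunctions

variable {ι κ : Type} [Fintype ι] [DecidableEq ι] [Fintype κ] [DecidableEq κ]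

/-- Linear forms on bit strings. -/
abbrev Form (ι : Type) := Bits ι →ₗ[ZMod 2] ZMod 2

/-- The lift of a bit to `ℤ/8`. -/
def bit (b : ZMod 2) : ZMod 8 := (b.val : ZMod 8)

theorem bit_add (a b : ZMod 2) : bit (a + b) = bit a + bit b - 2 * bit a * bit b := by
  revert a b; decide

theorem bit_zero : bit 0 = 0 := rfl

/-- The integer combinations of parities modulo 8. -/
def parityPhases (ι : Type) : AddSubgroup (Bits ι → ZMod 8) :=
  AddSubgroup.closure (Set.range fun (φ : Form ι) x => bit (φ x))

/-- The even combinations of parities: the phases of diagonal Clifford unitaries. -/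
def cliffordPhases (ι : Type) : AddSubgroup (Bits ι → ZMod 8) :=
  (parityPhases ι).map (AddMonoidHom.mulLeft 2)

theorem bit_form_mem (φ : Form ι) : (fun x => bit (φ x)) ∈ parityPhases ι :=
  AddSubgroup.subset_closure ⟨φ, rfl⟩

theorem two_mul_mem {g : Bits ι → ZMod 8} (hg : g ∈ parityPhases ι) :
    (fun x => 2 * g x) ∈ cliffordPhases ι :=
  ⟨g, hg, rfl⟩

theorem exists_of_mem_cliffordPhases {f : Bits ι → ZMod 8} (hf : f ∈ cliffordPhases ι) :
    ∃ g ∈ parityPhases ι, ∀ x, f x = 2 * g x := by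
  obtain ⟨g, hg, rfl⟩ := hf
  exact ⟨g, hg, fun _ => rfl⟩

theorem const_mul_mem {H : AddSubgroup (Bits ι → ZMod 8)} (c : ZMod 8) {g : Bits ι → ZMod 8}
    (hg : g ∈ H) : (fun x => c * g x) ∈ H := by
  have : (fun x => c * g x) = c.val • g := by
    funext x
    rw [Pi.smul_apply, nsmul_eq_mul, ZMod.natCast_zmod_val]
  rw [this]
  exact H.nsmul_mem hg _

theorem fun_sum_mem {α : Type*} {H : AddSubgroup (Bits ι → ZMod 8)} (s : Finset α)
    {g : α → Bits ι → ZMod 8} (hg : ∀ a ∈ s, g a ∈ H) : (fun x => ∑ a ∈ s, g a x) ∈ H := by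
  have : (fun x => ∑ a ∈ s, g a x) = ∑ a ∈ s, g a := by
    funext x; rw [Finset.sum_apply]
  rw [this]
  exact H.sum_mem hg

theorem list_sum_mem {α : Type*} {H : AddSubgroup (Bits ι → ZMod 8)} (L : List α)
    {g : α → Bits ι → ZMod 8} (hg : ∀ a ∈ L, g a ∈ H) :
    (fun x => (L.map fun a => g a x).sum) ∈ H := by
  induction L with
  | nil => exact H.zero_mem
  | cons a L ih =>
    simp only [List.map_cons, List.sum_cons]
    exact H.add_mem (hg a (by simp)) (ih fun b hb => hg b (by simp [hb]))

theorem two_mul_bit_mul_bit (a b : ZMod 2) :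
    2 * bit a * bit b = bit a + bit b - bit (a + b) := by
  rw [bit_add]; ring

theorem two_mul_bit_mul_bit_mem (φ ψ : Form ι) :
    (fun x => 2 * bit (φ x) * bit (ψ x)) ∈ parityPhases ι := by
  simp only [two_mul_bit_mul_bit]
  exact AddSubgroup.sub_mem _ (AddSubgroup.add_mem _ (bit_form_mem φ) (bit_form_mem ψ))
    (bit_form_mem (φ + ψ))

/-- The rule 2ab = a + b − (a ⊕ b) is used twice: it is multiplied by 2c, and each resulting term is
again of the form 2ab. -/
theorem four_mul_bit_mul_bit_mul_bit_mem (φ ψ χ : Form ι) :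
    (fun x => 4 * bit (φ x) * bit (ψ x) * bit (χ x)) ∈ parityPhases ι := by
  have h : (fun x => 4 * bit (φ x) * bit (ψ x) * bit (χ x))
      = (fun x => 2 * bit (φ x) * bit (χ x)) + (fun x => 2 * bit (ψ x) * bit (χ x))
        - fun x => 2 * bit ((φ + ψ) x) * bit (χ x) := by
    funext x
    simp only [Pi.sub_apply, Pi.add_apply, LinearMap.add_apply, bit_add]
    ring
  rw [h]
  exact AddSubgroup.sub_mem _ (AddSubgroup.add_mem _ (two_mul_bit_mul_bit_mem φ χ)
    (two_mul_bit_mul_bit_mem ψ χ)) (two_mul_bit_mul_bit_mem (φ + ψ) χ)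

/-- The weights 1, 2, 4 of linear, quadratic and cubic monomials are just what is needed to write
each monomial through parities with integer coefficients. -/
theorem weightedPoly_mem (a : ι → ZMod 8) (b : ι → ι → ZMod 8) (c : ι → ι → ι → ZMod 8) :
    weightedPoly a b c ∈ parityPhases ι := by
  have h : weightedPoly a b c
      = (fun x => ∑ i, a i * bit (LinearMap.proj (R := ZMod 2) i x))
        + (fun x => ∑ i, ∑ j, b i j * (2 * bit (LinearMap.proj (R := ZMod 2) i x)
            * bit (LinearMap.proj (R := ZMod 2) j x)))
        + fun x => ∑ i, ∑ j, ∑ m, c i j m * (4 * bit (LinearMap.proj (R := ZMod 2) i x)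
            * bit (LinearMap.proj (R := ZMod 2) j x) * bit (LinearMap.proj (R := ZMod 2) m x)) := by
    funext x
    simp only [weightedPoly, Pi.add_apply, Finset.mul_sum, bit, LinearMap.proj_apply]
    congr 1
    · congr 1
      refine Finset.sum_congr rfl fun i _ => Finset.sum_congr rfl fun j _ => ?_
      ring
    · refine Finset.sum_congr rfl fun i _ => Finset.sum_congr rfl fun j _ =>
        Finset.sum_congr rfl fun m _ => ?_
      ring
  rw [h]
  refine AddSubgroup.add_mem _ (AddSubgroup.add_mem _ ?_ ?_) ?_
  · exact fun_sum_mem _ fun i _ => const_mul_mem _ (bit_form_mem _)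
  · exact fun_sum_mem _ fun i _ => fun_sum_mem _ fun j _ =>
      const_mul_mem _ (two_mul_bit_mul_bit_mem _ _)
  · exact fun_sum_mem _ fun i _ => fun_sum_mem _ fun j _ => fun_sum_mem _ fun m _ =>
      const_mul_mem _ (four_mul_bit_mul_bit_mul_bit_mem _ _ _)

theorem parityPhases_comp {f : Bits ι → ZMod 8} (hf : f ∈ parityPhases ι)
    (T : Bits κ →ₗ[ZMod 2] Bits ι) : (fun x => f (T x)) ∈ parityPhases κ := by
  induction hf using AddSubgroup.closure_induction with
  | mem f hf =>
    obtain ⟨φ, rfl⟩ := hf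
    exact bit_form_mem (φ ∘ₗ T)
  | zero => exact AddSubgroup.zero_mem _
  | add f g _ _ hf hg => exact AddSubgroup.add_mem _ hf hg
  | neg f _ hf => exact AddSubgroup.neg_mem _ hf

theorem cliffordPhases_comp {f : Bits ι → ZMod 8} (hf : f ∈ cliffordPhases ι)
    (T : Bits κ →ₗ[ZMod 2] Bits ι) : (fun x => f (T x)) ∈ cliffordPhases κ := by
  obtain ⟨g, hg, h⟩ := exists_of_mem_cliffordPhases hf
  simp only [h]
  exact two_mul_mem (parityPhases_comp hg T)

/-- On a single parity ψ this is 4φψ = 2 · 2φψ, and 2φψ is a combination of parities. It is the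
source of all mixed Clifford terms of the code. -/
theorem four_mul_bit_mul_mem (φ : Form ι) {g : Bits ι → ZMod 8} (hg : g ∈ parityPhases ι) :
    (fun x => 4 * bit (φ x) * g x) ∈ cliffordPhases ι := by
  induction hg using AddSubgroup.closure_induction with
  | mem g hg =>
    obtain ⟨ψ, rfl⟩ := hg
    have h := two_mul_mem (two_mul_bit_mul_bit_mem φ ψ)
    have e : (fun x => 4 * bit (φ x) * bit (ψ x)) = fun x => 2 * (2 * bit (φ x) * bit (ψ x)) := by
      funext x; ring
    rw [e]
    exact h
  | zero => simp only [Pi.zero_apply, mul_zero]; exact AddSubgroup.zero_mem _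
  | add f g _ _ hf hg =>
    simp only [Pi.add_apply, mul_add]; exact AddSubgroup.add_mem _ hf hg
  | neg f _ hf =>
    simp only [Pi.neg_apply, mul_neg]; exact AddSubgroup.neg_mem _ hf

/-- The eighth roots of unity. -/
noncomputable def ph (a : ZMod 8) : ℂ := omega ^ a.val

theorem omega_pow_eight : omega ^ 8 = 1 := by
  rw [show 8 = 2 * 4 from rfl, pow_mul, omega_sq, Complex.I_pow_four]

theorem ph_natCast (n : ℕ) : ph n = omega ^ n := by
  rw [ph, ZMod.val_natCast, ← pow_eq_pow_mod n omega_pow_eight]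

theorem ph_add (a b : ZMod 8) : ph (a + b) = ph a * ph b := by
  rw [← ZMod.natCast_zmod_val a, ← ZMod.natCast_zmod_val b, ← Nat.cast_add, ph_natCast, ph_natCast,
    ph_natCast, pow_add]

theorem ph_zero : ph 0 = 1 := by simp [ph]

theorem ph_ne_zero (a : ZMod 8) : ph a ≠ 0 := by
  refine pow_ne_zero _ ?_
  intro h0
  simpa [h0] using norm_omega

theorem norm_ph (a : ZMod 8) : ‖ph a‖ = 1 := by
  rw [ph, norm_pow, norm_omega, one_pow]

theorem ph_injective : Function.Injective ph := by
  have hprim : IsPrimitiveRoot omega 8 := by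
    have h := Complex.isPrimitiveRoot_exp 8 (by norm_num)
    have e : omega = Complex.exp (2 * Real.pi * Complex.I / (8 : ℕ)) := by
      rw [omega]
      congr 1
      push_cast
      ring
    rw [e]
    exact h
  intro a b h
  exact ZMod.val_injective 8 (hprim.pow_inj (ZMod.val_lt a) (ZMod.val_lt b) h)

theorem ph_bit (b : ZMod 2) : ph (bit b) = omega ^ b.val := ph_natCast _

theorem ph_two_mul_bit (b : ZMod 2) : ph (2 * bit b) = Complex.I ^ b.val := by
  rw [two_mul, ph_add, ph_bit, ← omega_sq, ← pow_mul, ← pow_add, two_mul]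

end PhaseFunctions

/-! ### Synthesis and normal form of circuits -/

section Circuits

variable {ι : Type} [Fintype ι] [DecidableEq ι]

theorem circuitOp_map {γ δ : Type} (f : γ → Op ι) (g : δ → γ) (L : List δ) :
    circuitOp f (L.map g) = circuitOp (fun a => f (g a)) L := by
  induction L with
  | nil => rfl
  | cons a L ih => rw [List.map_cons, circuitOp, circuitOp, ih]

/-- Every invertible linear map is realised by a CNOT circuit. -/
theorem exists_circuitEquiv_eq (π : Bits ι ≃ₗ[ZMod 2] Bits ι) :
    ∃ E : List (CnotPair ι), circuitEquiv E = π := by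
  have happ : ∀ (E E' : List (CnotPair ι)) (x : Bits ι),
      circuitEquiv (E ++ E') x = circuitEquiv E' (circuitEquiv E x) := by
    intro E E' x
    induction E generalizing x with
    | nil => rfl
    | cons p E ih => exact ih _
  have key : ∃ E : List (CnotPair ι), ∀ x,
      circuitEquiv E x = (LinearMap.toMatrix' π.toLinearMap).mulVec x := by
    refine Matrix.diagonal_transvection_induction_of_det_ne_zero
      (fun M => ∃ E : List (CnotPair ι), ∀ x, circuitEquiv E x = M.mulVec x) _ ?_ ?_ ?_ ?_
    · exact (LinearEquiv.isUnit_det' π).ne_zero |> fun h => by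
        rwa [LinearMap.det_toMatrix']
    · intro d hd
      rw [Matrix.det_diagonal, Finset.prod_ne_zero_iff] at hd
      refine ⟨[], fun x => ?_⟩
      funext i
      -- Over the field with two elements an invertible diagonal matrix is the identity.
      rw [Matrix.mulVec_diagonal, (zmod_two_cases (d i)).resolve_left (hd i (Finset.mem_univ i)),
        one_mul]
      rfl
    · rintro ⟨i, j, hij, c⟩
      rcases zmod_two_cases c with rfl | rfl
      · refine ⟨[], fun x => ?_⟩
        simp [Matrix.TransvectionStruct.toMatrix, Matrix.transvection, circuitEquiv]
      -- The transvection adds coordinate j to coordinate i, so j is the control and i the target.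
      · refine ⟨[⟨(j, i), hij.symm⟩], fun x => ?_⟩
        show cnotEquiv j i hij.symm x = _
        rw [cnotEquiv_apply]
        simp only [Matrix.TransvectionStruct.toMatrix, Matrix.transvection, Matrix.add_mulVec,
          Matrix.one_mulVec, Matrix.single_mulVec]
        funext a
        by_cases ha : a = i
        · subst ha; simp
        · simp [ha]
    · rintro A B _ _ ⟨E, hE⟩ ⟨E', hE'⟩
      refine ⟨E' ++ E, fun x => ?_⟩
      rw [happ, hE, hE', Matrix.mulVec_mulVec]
  obtain ⟨E, hE⟩ := key
  refine ⟨E, LinearEquiv.ext fun x => ?_⟩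
  rw [hE, ← Matrix.toLin'_apply, Matrix.toLin'_toMatrix']
  rfl

theorem form_update (φ : Form ι) (x : Bits ι) (i : ι) (t : ZMod 2) :
    φ (Function.update x i t) = φ x + (t - x i) * φ (Pi.single i 1) := by
  have : Function.update x i t = x + (t - x i) • Pi.single i 1 := by
    funext a
    by_cases h : a = i
    · subst h; simp
    · simp [h]
  rw [this, map_add, map_smul, smul_eq_mul]

theorem exists_pivot {φ : Form ι} (hφ : φ ≠ 0) : ∃ i, φ (Pi.single i 1) = 1 := by
  by_contra! h
  refine hφ (LinearMap.pi_ext' fun i => LinearMap.ext_ring ?_)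
  exact (zmod_two_cases _).resolve_right (h i)

/-- A CNOT circuit computes any non-zero parity into one of the qubits. -/
theorem exists_cnot_parity {φ : Form ι} (hφ : φ ≠ 0) :
    ∃ (E : List (CnotPair ι)) (i : ι), ∀ x, circuitEquiv E x i = φ x := by
  obtain ⟨i, hi⟩ := exists_pivot hφ
  -- Replacing coordinate i by φ(x) is an involution exactly because φ takes the value 1 on the i-th
  -- basis vector.
  let T : Bits ι →ₗ[ZMod 2] Bits ι :=
    { toFun := fun x => Function.update x i (φ x)
      map_add' := fun x y => by
        funext a
        by_cases ha : a = i
        · subst ha; simp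
        · simp [ha]
      map_smul' := fun c x => by
        funext a
        by_cases ha : a = i
        · subst ha; simp
        · simp [ha] }
  have hT : Function.Involutive T := fun x => by
    show Function.update (Function.update x i (φ x)) i (φ (Function.update x i (φ x))) = x
    rw [Function.update_idem, form_update, hi, mul_one, ← add_sub_assoc,
      CharTwo.add_self_eq_zero, zero_sub, CharTwo.neg_eq, Function.update_eq_self]
  obtain ⟨E, hE⟩ := exists_circuitEquiv_eq (LinearEquiv.ofInvolutive T hT)
  refine ⟨E, i, fun x => ?_⟩
  rw [hE]
  exact Function.update_self _ _ _

theorem permOp_conj_diagonal (π : Bits ι ≃ₗ[ZMod 2] Bits ι) (d : Bits ι → ℂ) :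
    permOp π.symm * (Matrix.diagonal d * permOp π) = Matrix.diagonal fun x => d (π x) := by
  ext x y
  rw [permOp_mul_apply, mul_permOp_apply, LinearEquiv.symm_symm, Matrix.diagonal_apply,
    Matrix.diagonal_apply]
  exact if_congr π.injective.eq_iff rfl rfl

theorem diagonal_mul_permOp (π : Bits ι ≃ₗ[ZMod 2] Bits ι) (d : Bits ι → ℂ) :
    Matrix.diagonal (fun x => d x) * permOp π
      = permOp π * Matrix.diagonal fun x => d (π x) := by
  rw [← permOp_conj_diagonal, ← mul_assoc, permOp_mul, LinearEquiv.symm_trans_self, permOp_refl,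
    one_mul]

/-- If a gate set contains the CNOTs and the phase gate `diag(1, ph t)`, then it realises all
phases `t * f` with `f` a combination of parities. -/
theorem exists_circuit_of_parityPhases {γ : Type} (op : γ → Op ι) (cnot : CnotPair ι → γ)
    (hcnot : ∀ p, op (cnot p) = CliffordGate.op p.gate) (t : ZMod 8) (phase : ι → γ)
    (hphase : ∀ i, op (phase i) = Matrix.diagonal fun x => ph (t * bit (x i)))
    {f : Bits ι → ZMod 8} (hf : f ∈ parityPhases ι) :
    ∃ c : List γ, circuitOp op c = Matrix.diagonal fun x => ph (t * f x) := by
  have hadd : ∀ f g : Bits ι → ZMod 8,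
      (∃ c : List γ, circuitOp op c = Matrix.diagonal fun x => ph (t * f x)) →
      (∃ c : List γ, circuitOp op c = Matrix.diagonal fun x => ph (t * g x)) →
      ∃ c : List γ, circuitOp op c = Matrix.diagonal fun x => ph (t * (f + g) x) := by
    rintro f g ⟨c, hc⟩ ⟨c', hc'⟩
    refine ⟨c' ++ c, ?_⟩
    rw [circuitOp_append, hc, hc', Matrix.diagonal_mul_diagonal]
    simp only [Pi.add_apply, mul_add, ph_add]
  have hzero : ∃ c : List γ, circuitOp op c
      = Matrix.diagonal fun x => ph (t * (0 : Bits ι → ZMod 8) x) :=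
    ⟨[], by simp [ph_zero, circuitOp]⟩
  induction hf using AddSubgroup.closure_induction with
  | mem f hf =>
    obtain ⟨φ, rfl⟩ := hf
    by_cases hφ : φ = 0
    · subst hφ
      exact hzero
    · obtain ⟨E, i, hE⟩ := exists_cnot_parity hφ
      refine ⟨E.map cnot ++ ([phase i] ++ E.reverse.map cnot), ?_⟩
      have h : ∀ E' : List (CnotPair ι), circuitOp op (E'.map cnot)
          = circuitOp CliffordGate.op (E'.map CnotPair.gate) := fun E' => by
        rw [circuitOp_map, circuitOp_map]
        simp only [hcnot]
      rw [circuitOp_append, circuitOp_append, h, h, circuitOp_cnot_reverse, circuitOp_cnot,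
        circuitOp, circuitOp, one_mul, hphase, mul_assoc, permOp_conj_diagonal]
      simp only [hE]
  | zero => exact hzero
  | add f g _ _ hf hg => exact hadd f g hf hg
  | neg f _ hf =>
    -- The gate set need not contain inverses, but phases have order dividing 8, so seven
    -- repetitions invert.
    have h7 : -f = 7 • f := by
      funext x
      simp only [Pi.neg_apply, Pi.smul_apply, nsmul_eq_mul]
      generalize f x = a
      revert a
      decide
    rw [h7]
    have : ∀ n : ℕ, ∃ c : List γ, circuitOp op c
        = Matrix.diagonal fun x => ph (t * (n • f) x) := by
      intro n
      induction n with
      | zero => rw [zero_smul]; exact hzero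
      | succ n ih => rw [add_smul, one_smul]; exact hadd _ _ ih hf
    exact this 7

theorem exists_synth_circuit {f : Bits ι → ZMod 8} (hf : f ∈ parityPhases ι) :
    ∃ c : List (SynthGate ι), circuitOp SynthGate.op c = Matrix.diagonal fun x => ph (f x) := by
  have h := exists_circuit_of_parityPhases (SynthGate.op (ι := ι))
    (fun p => .cnot p.1.1 p.1.2 p.2) (fun _ => rfl) 1 .t
    (fun i => by simp only [one_mul, ph_bit]; rfl) hf
  simpa only [one_mul] using h

theorem exists_clifford_circuit {f : Bits ι → ZMod 8} (hf : f ∈ cliffordPhases ι) :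
    ∃ c : List (CliffordGate ι), circuitOp CliffordGate.op c
      = Matrix.diagonal fun x => ph (f x) := by
  obtain ⟨g, hg, h⟩ := exists_of_mem_cliffordPhases hf
  simp only [h]
  exact exists_circuit_of_parityPhases CliffordGate.op CnotPair.gate (fun _ => rfl) 2 .s
    (fun i => by simp only [ph_two_mul_bit]; rfl) hg

/-- The normal form of circuits over `{CNOT, S, T}`. -/
theorem synth_normal_form (c : List (SynthGate ι)) :
    ∃ (π : Bits ι ≃ₗ[ZMod 2] Bits ι) (A : List (Form ι)), A.length = numT c ∧
      ∃ f ∈ cliffordPhases ι, circuitOp SynthGate.op c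
        = permOp π * Matrix.diagonal fun x => ph ((A.map fun φ => bit (φ x)).sum + f x) := by
  induction c with
  | nil =>
    refine ⟨LinearEquiv.refl _ _, [], rfl, 0, AddSubgroup.zero_mem _, ?_⟩
    simp [permOp_refl, circuitOp, ph_zero]
  | cons g c ih =>
    obtain ⟨π, A, hA, f, hf, hc⟩ := ih
    rw [circuitOp, hc]
    cases g with
    | cnot i j h =>
      refine ⟨(cnotEquiv i j h).trans π, A.map fun φ => φ ∘ₗ (cnotEquiv i j h).toLinearMap,
        by rw [List.length_map, hA]; rfl, _, cliffordPhases_comp hf (cnotEquiv i j h).toLinearMap, ?_⟩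
      show _ * permOp (cnotEquiv i j h) = _
      rw [mul_assoc, diagonal_mul_permOp (cnotEquiv i j h), ← mul_assoc, permOp_mul]
      simp only [List.map_map]
      rfl
    | s i =>
      refine ⟨π, A, hA, _, AddSubgroup.add_mem _ hf
        (two_mul_mem (bit_form_mem (LinearMap.proj i))), ?_⟩
      show _ * Matrix.diagonal _ = _
      rw [mul_assoc, Matrix.diagonal_mul_diagonal]
      simp only [Pi.add_apply, ← add_assoc, ph_add _ (2 * _), ph_two_mul_bit]
      rfl
    | t i =>
      refine ⟨π, LinearMap.proj i :: A, by rw [List.length_cons, hA]; rfl, f, hf, ?_⟩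
      show _ * Matrix.diagonal _ = _
      rw [mul_assoc, Matrix.diagonal_mul_diagonal]
      simp only [List.map_cons, List.sum_cons, add_assoc, ph_add (bit _), ph_bit, mul_comm]
      rfl

/-- In the normal form, a nonzero entry at (x, x) is possible only if the permutation fixes x; hence
it fixes every x and the phases can be read off. -/
theorem synth_diagonal {c : List (SynthGate ι)} {d : Bits ι → ℂ} (hd : ∀ x, d x ≠ 0)
    (hc : circuitOp SynthGate.op c = Matrix.diagonal d) :
    ∃ A : List (Form ι), A.length = numT c ∧ ∃ f ∈ cliffordPhases ι,
      ∀ x, d x = ph ((A.map fun φ => bit (φ x)).sum + f x) := by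
  obtain ⟨π, A, hA, f, hf, h⟩ := synth_normal_form c
  refine ⟨A, hA, f, hf, fun x => ?_⟩
  have hx : Matrix.diagonal d x x = _ := congrFun (congrFun (hc.symm.trans h) x) x
  rw [Matrix.diagonal_apply_eq, Matrix.mul_diagonal, permOp_apply] at hx
  split_ifs at hx with h1
  · rw [hx, one_mul]
  · exact absurd (hx.trans (zero_mul _)) (hd x)

end Circuits

/-! ### Teleportation corrections and optimal circuits -/

section DiagonalUnitaries

variable {ι : Type} [Fintype ι] [DecidableEq ι]

theorem exists_parityPhase_of_mem_D3 {U : Op ι} (hU : U ∈ D3 ι) :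
    ∃ F ∈ parityPhases ι, U = Matrix.diagonal fun x => ph (F x) := by
  obtain ⟨a, b, c, rfl⟩ := hU
  exact ⟨_, weightedPoly_mem a b c, rfl⟩

theorem diagonal_ph_mem_unitaryGroup (F : Bits ι → ZMod 8) :
    Matrix.diagonal (fun x => ph (F x)) ∈ Matrix.unitaryGroup (Bits ι) ℂ := by
  rw [Matrix.mem_unitaryGroup_iff, Matrix.star_eq_conjTranspose, Matrix.diagonal_conjTranspose,
    Matrix.diagonal_mul_diagonal, ← Matrix.diagonal_one]
  congr 1
  funext x
  rw [Pi.star_apply, Complex.star_def, Complex.mul_conj, Complex.normSq_eq_norm_sq, norm_ph]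
  simp

theorem tensorOp_diagonal {l : ℕ} {k : Fin l → ℕ} {U : ∀ j, Op (Fin (k j))}
    (F : ∀ j, Bits (Fin (k j)) → ZMod 8) (hF : ∀ j, F j ∈ parityPhases (Fin (k j)))
    (hU : ∀ j, U j = Matrix.diagonal fun x => ph (F j x)) :
    ∃ G ∈ parityPhases (Reg k), tensorOp U = Matrix.diagonal fun x => ph (G x) := by
  refine ⟨fun x => ∑ j, F j (LinearMap.funLeft (ZMod 2) (ZMod 2) (Sigma.mk j) x),
    fun_sum_mem _ fun j _ => parityPhases_comp (hF j) _, ?_⟩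
  ext x y
  have hprod : ∀ s : Finset (Fin l), ∀ g : Fin l → ZMod 8, ph (∑ j ∈ s, g j) = ∏ j ∈ s, ph (g j) := by
    intro s g
    induction s using Finset.induction_on with
    | empty => simp [ph_zero]
    | insert a s ha ih => rw [Finset.sum_insert ha, Finset.prod_insert ha, ph_add, ih]
  simp only [tensorOp, Matrix.of_apply, hU]
  by_cases h : x = y
  · subst h
    simp only [Matrix.diagonal_apply_eq, hprod]
    rfl
  · rw [Matrix.diagonal_apply_ne _ h]
    obtain ⟨⟨j, i⟩, hij⟩ := Function.ne_iff.1 h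
    exact Finset.prod_eq_zero (Finset.mem_univ j)
      (Matrix.diagonal_apply_ne _ fun h' => hij (congrFun h' i))

theorem shiftOp_mul_shiftOp (a b : Bits ι) : shiftOp a * shiftOp b = shiftOp (a + b) := by
  ext x y
  rw [mul_shiftOp_apply]
  simp only [shiftOp, Matrix.of_apply]
  rw [add_assoc, add_comm b a]

theorem shiftOp_zero : shiftOp (0 : Bits ι) = 1 := by
  ext x y
  simp only [shiftOp, Matrix.of_apply, add_zero, Matrix.one_apply]

/-- X = H Z H with Z = S². -/
theorem circuitOp_pauliX (i : ι) :
    circuitOp CliffordGate.op [CliffordGate.hadamard i, .s i, .s i, .hadamard i]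
      = shiftOp (Pi.single i 1) := by
  simp only [circuitOp, one_mul, CliffordGate.op]
  ext u v
  rw [mul_hadamardOp_apply, sum_zmod_two]
  simp only [phaseOp, Matrix.mul_diagonal, hadamardOp, Matrix.of_apply, Function.update_self,
    shiftOp]
  have h1 : ∀ b, (∀ a, a ≠ i → u a = Function.update v i b a) ↔ ∀ a, a ≠ i → u a = v a :=
    fun b => forall₂_congr fun a ha => by rw [Function.update_of_ne ha]
  have h2 : u = v + Pi.single i 1 ↔ (∀ a, a ≠ i → u a = v a) ∧ u i = v i + 1 := by
    constructor
    · rintro rfl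
      refine ⟨fun a ha => ?_, ?_⟩
      · rw [Pi.add_apply, Pi.single_eq_of_ne ha, add_zero]
      · rw [Pi.add_apply, Pi.single_eq_same]
    · rintro ⟨h, h'⟩
      funext a
      by_cases ha : a = i
      · subst ha; rw [Pi.add_apply, Pi.single_eq_same, h']
      · rw [Pi.add_apply, Pi.single_eq_of_ne ha, add_zero, h a ha]
  simp only [h1, h2]
  by_cases h : ∀ a, a ≠ i → u a = v a
  · have hs := inv_sqrt_two_mul_self
    have hI : Complex.I * Complex.I = -1 := Complex.I_mul_I
    have h11 : (1 + 1 : ZMod 2) = 0 := rfl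
    have hT : (∀ a, a ≠ i → u a = v a) = True := eq_true h
    simp only [hT, if_true, true_and, div_eq_mul_inv]
    rcases zmod_two_cases (u i) with hu | hu <;> rcases zmod_two_cases (v i) with hv | hv <;>
      simp only [hu, hv, ZMod.val_zero, ZMod.val_one, mul_zero, mul_one, one_mul, pow_zero,
        pow_one, zero_add, h11, if_true, one_ne_zero, zero_ne_one, if_false]
    · linear_combination (1 + Complex.I * Complex.I) * hs + (2⁻¹ : ℂ) * hI
    · linear_combination (1 - Complex.I * Complex.I) * hs - (2⁻¹ : ℂ) * hI
    · linear_combination (1 - Complex.I * Complex.I) * hs - (2⁻¹ : ℂ) * hI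
    · linear_combination (1 + Complex.I * Complex.I) * hs + (2⁻¹ : ℂ) * hI
  · simp [h]

theorem exists_shift_circuit (a : Bits ι) :
    ∃ c : List (CliffordGate ι), circuitOp CliffordGate.op c = shiftOp a := by
  have h : ∀ s : Finset ι, ∃ c : List (CliffordGate ι), circuitOp CliffordGate.op c
      = shiftOp (∑ i ∈ s, Pi.single i (a i)) := by
    intro s
    induction s using Finset.induction_on with
    | empty => exact ⟨[], by rw [Finset.sum_empty, shiftOp_zero]; rfl⟩
    | insert i s hi ih =>
      obtain ⟨c, hc⟩ := ih
      rw [Finset.sum_insert hi]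
      rcases zmod_two_cases (a i) with h0 | h1
      · exact ⟨c, by rw [h0, Pi.single_zero, zero_add, hc]⟩
      · exact ⟨c ++ [CliffordGate.hadamard i, .s i, .s i, .hadamard i], by
          rw [circuitOp_append, hc, circuitOp_pauliX, shiftOp_mul_shiftOp, h1]⟩
  obtain ⟨c, hc⟩ := h Finset.univ
  exact ⟨c, by rw [hc, Finset.univ_sum_single]⟩

/-- The discrete derivative of the phase of an element of `D₃` is a Clifford phase. -/
theorem exists_derivative {F : Bits ι → ZMod 8} (hF : F ∈ parityPhases ι) (a : Bits ι) :
    ∃ c : ZMod 8, ∃ g ∈ cliffordPhases ι, ∀ x, g x + F (x + a) = c + F x := by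
  induction hF using AddSubgroup.closure_induction with
  | mem F hF =>
    obtain ⟨φ, rfl⟩ := hF
    -- The bit of φ(x) ⊕ φ(a) is φ(x) + φ(a) − 2φ(a)φ(x): a constant and an even multiple of a
    -- parity.
    refine ⟨bit (φ a), _, const_mul_mem (bit (φ a)) (two_mul_mem (bit_form_mem φ)), fun x => ?_⟩
    simp only [map_add, bit_add]
    ring
  | zero => exact ⟨0, 0, AddSubgroup.zero_mem _, fun x => by simp⟩
  | add F F' _ _ h h' =>
    obtain ⟨c, g, hg, h⟩ := h
    obtain ⟨c', g', hg', h'⟩ := h'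
    refine ⟨c + c', g + g', AddSubgroup.add_mem _ hg hg', fun x => ?_⟩
    simp only [Pi.add_apply]
    linear_combination h x + h' x
  | neg F _ h =>
    obtain ⟨c, g, hg, h⟩ := h
    refine ⟨-c, -g, AddSubgroup.neg_mem _ hg, fun x => ?_⟩
    simp only [Pi.neg_apply]
    linear_combination -h x

/-- U X[a] U† is X[a] times a diagonal unitary whose phase is a derivative of F, and this derivative
is a Clifford phase up to a constant. -/
theorem exists_fixup {F : Bits ι → ZMod 8} (hF : F ∈ parityPhases ι) {U : Op ι}
    (hU : U = Matrix.diagonal fun x => ph (F x)) (a : Bits ι) :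
    ∃ (c : List (CliffordGate ι)) (ζ : ℂ), ‖ζ‖ = 1 ∧
      circuitOp CliffordGate.op c * (U * shiftOp a) = ζ • U := by
  obtain ⟨c, g, hg, h⟩ := exists_derivative hF a
  obtain ⟨c₁, hc₁⟩ := exists_shift_circuit a
  obtain ⟨c₂, hc₂⟩ := exists_clifford_circuit hg
  refine ⟨c₁ ++ c₂, ph c, norm_ph c, ?_⟩
  rw [circuitOp_append, hc₁, hc₂, hU]
  ext x y
  rw [mul_assoc, Matrix.diagonal_mul, shiftOp_mul_apply, mul_shiftOp_apply, Matrix.smul_apply,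
    Matrix.diagonal_apply, Matrix.diagonal_apply, smul_eq_mul]
  simp only [add_left_inj]
  split_ifs
  · rw [← ph_add, ← ph_add, h]
  · simp

/-- Later it matters only that the exponent is a multiple of 4, which doubling annihilates; hence no
degree bound on C. -/
theorem exists_phase_of_mem_cczCircuits {W : Op ι} (hW : W ∈ cczCircuits ι) :
    ∃ C : Bits ι → ZMod 8, W = Matrix.diagonal fun x => ph (4 * C x) := by
  induction hW using Submonoid.closure_induction with
  | mem W hW =>
    obtain ⟨i, j, m, _, _, _, rfl⟩ := hW
    refine ⟨fun x => (((x i).val * (x j).val * (x m).val : ℕ) : ZMod 8), ?_⟩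
    rw [cczOp]
    congr 1
    funext x
    rw [show (4 : ZMod 8) = ((4 : ℕ) : ZMod 8) from rfl, ← Nat.cast_mul, ph_natCast, pow_mul omega 4,
      show 4 = 2 * 2 from rfl, pow_mul omega 2 2, omega_sq, Complex.I_sq]
  | one => exact ⟨0, by simp [ph_zero]⟩
  | mul W W' _ _ h h' =>
    obtain ⟨C, rfl⟩ := h
    obtain ⟨C', rfl⟩ := h'
    refine ⟨C + C', ?_⟩
    rw [Matrix.diagonal_mul_diagonal]
    simp only [Pi.add_apply, mul_add, ph_add]

/-- `ℕ∞` is well-ordered, so the infimum is attained once some circuit exists; a value below ⊤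
guarantees one. -/
theorem exists_numT_eq_tau {U : Op ι} (h : tau U ≠ ⊤) :
    ∃ c : List (SynthGate ι), circuitOp SynthGate.op c = U ∧ (numT c : ℕ∞) = tau U := by
  have htau : tau U = sInf ((fun c : List (SynthGate ι) => (numT c : ℕ∞)) ''
      {c | circuitOp SynthGate.op c = U}) := by
    rw [sInf_image]; rfl
  have hne : {c : List (SynthGate ι) | circuitOp SynthGate.op c = U}.Nonempty := by
    by_contra hempty
    rw [Set.not_nonempty_iff_eq_empty] at hempty
    rw [htau, hempty, Set.image_empty, sInf_empty] at h
    exact h rfl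
  have hmem := csInf_mem (hne.image fun c : List (SynthGate ι) => (numT c : ℕ∞))
  rw [← htau] at hmem
  obtain ⟨c, hc, hc'⟩ := hmem
  exact ⟨c, hc, hc'⟩

theorem tau_ne_top {F : Bits ι → ZMod 8} (hF : F ∈ parityPhases ι) :
    tau (Matrix.diagonal fun x => ph (F x)) ≠ ⊤ := by
  obtain ⟨c, hc⟩ := exists_synth_circuit hF
  have h : tau (Matrix.diagonal fun x => ph (F x)) ≤ (numT c : ℕ∞) := iInf₂_le c hc
  exact (h.trans_lt (ENat.natCast_lt_top _)).ne

theorem mu_le_tau (U : Op ι) : mu U ≤ tau U :=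
  iInf_le_of_le U <| iInf_le_of_le 1 <| iInf_le_of_le (Submonoid.one_mem _) <|
    iInf_le_of_le (mul_one U).symm le_rfl

theorem exists_tau_eq_mu {U : Op ι} :
    ∃ V W : Op ι, W ∈ cczCircuits ι ∧ U = V * W ∧ tau V = mu U := by
  set T : Set ℕ∞ := {t | ∃ V W : Op ι, W ∈ cczCircuits ι ∧ U = V * W ∧ tau V = t} with hT
  have hmu : mu U = sInf T := by
    refine le_antisymm (le_sInf ?_) ?_
    · rintro t ⟨V, W, hW, h, rfl⟩
      exact iInf_le_of_le V <| iInf_le_of_le W <| iInf_le_of_le hW <| iInf_le_of_le h le_rfl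
    · exact le_iInf fun V => le_iInf fun W => le_iInf fun hW => le_iInf fun h =>
        sInf_le ⟨V, W, hW, h, rfl⟩
  have hne : T.Nonempty := ⟨tau U, U, 1, Submonoid.one_mem _, (mul_one U).symm, rfl⟩
  have h := csInf_mem hne
  rw [← hmu] at h
  exact h

/-- Optimal circuits for `U` and for a factor of `U` that differs from it by CCZ gates. -/
theorem exists_optimal_forms {F : Bits ι → ZMod 8} (hF : F ∈ parityPhases ι) {U : Op ι}
    (hU : U = Matrix.diagonal fun x => ph (F x)) :
    ∃ A B : List (Form ι), (A.length : ℕ∞) = tau U ∧ (B.length : ℕ∞) = mu U ∧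
      ∃ f ∈ cliffordPhases ι, ∃ g ∈ cliffordPhases ι, ∃ C : Bits ι → ZMod 8,
        (∀ x, F x = (A.map fun φ => bit (φ x)).sum + f x) ∧
        ∀ x, F x = (B.map fun φ => bit (φ x)).sum + g x + 4 * C x := by
  have htop : tau U ≠ ⊤ := hU ▸ tau_ne_top hF
  obtain ⟨c, hc, hcn⟩ := exists_numT_eq_tau htop
  obtain ⟨A, hA, f, hf, hAf⟩ := synth_diagonal (fun x => ph_ne_zero (F x)) (hc.trans hU)
  obtain ⟨V, W, hW, hVW, hV⟩ := exists_tau_eq_mu (U := U)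
  have hVtop : tau V ≠ ⊤ := by
    rw [hV]
    exact ((mu_le_tau U).trans_lt (lt_top_iff_ne_top.2 htop)).ne
  obtain ⟨c', hc', hcn'⟩ := exists_numT_eq_tau hVtop
  obtain ⟨C, rfl⟩ := exists_phase_of_mem_cczCircuits hW
  have hent : ∀ x y, V x y * ph (4 * C y) = U x y := fun x y => by
    rw [hVW, Matrix.mul_diagonal]
  have hVx : ∀ x, V x x * ph (4 * C x) = ph (F x) := fun x => by
    rw [hent, hU, Matrix.diagonal_apply_eq]
  -- V is not assumed diagonal, but U is, and U = VW with W diagonal and without zeros on the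
  -- diagonal.
  have hVd : V = Matrix.diagonal fun x => V x x := by
    ext x y
    by_cases h : x = y
    · subst h; rw [Matrix.diagonal_apply_eq]
    · rw [Matrix.diagonal_apply_ne _ h]
      have := hent x y
      rw [hU, Matrix.diagonal_apply_ne _ h] at this
      exact (mul_eq_zero.1 this).resolve_right (ph_ne_zero _)
  have hV0 : ∀ x, V x x ≠ 0 := fun x h => ph_ne_zero (F x) (by rw [← hVx x, h, zero_mul])
  obtain ⟨B, hB, g, hg, hBg⟩ := synth_diagonal hV0 (hc'.trans hVd)
  refine ⟨A, B, by rw [hA, hcn], by rw [hB, hcn', hV], f, hf, g, hg, C,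
    fun x => ph_injective (hAf x), fun x => ph_injective ?_⟩
  rw [ph_add, ← hBg x, hVx x]

end DiagonalUnitaries

/-! ### Completing the columns to an encodable generator matrix -/

section Encoder

variable {R : Type} [Fintype R] [DecidableEq R]

/-- An injective linear map into a larger space of bit strings extends to an invertible one. -/
theorem exists_linearEquiv_extending {m : ℕ} (γ : Bits R →ₗ[ZMod 2] Bits (R ⊕ Fin m))
    (hγ : Function.Injective γ) :
    ∃ T : Bits (R ⊕ Fin m) ≃ₗ[ZMod 2] Bits (R ⊕ Fin m), ∀ z, T (Sum.elim z 0) = γ z := by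
  obtain ⟨C, hC⟩ := Submodule.exists_isCompl (LinearMap.range γ)
  have hdim : Module.finrank (ZMod 2) (Bits (Fin m)) = Module.finrank (ZMod 2) C := by
    have h1 := Submodule.finrank_add_eq_of_isCompl hC
    rw [LinearMap.finrank_range_of_inj hγ] at h1
    simp only [Module.finrank_fintype_fun_eq_card, Fintype.card_sum, Fintype.card_fin] at h1 ⊢
    omega
  let η := LinearEquiv.ofFinrankEq (Bits (Fin m)) C hdim
  let T : Bits (R ⊕ Fin m) →ₗ[ZMod 2] Bits (R ⊕ Fin m) :=
    γ ∘ₗ LinearMap.funLeft (ZMod 2) (ZMod 2) Sum.inl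
      + C.subtype ∘ₗ η.toLinearMap ∘ₗ LinearMap.funLeft (ZMod 2) (ZMod 2) Sum.inr
  have hTa : ∀ z, T z = γ (z ∘ Sum.inl) + (η (z ∘ Sum.inr) : Bits (R ⊕ Fin m)) := fun z => rfl
  have hT : Function.Injective T := by
    rw [injective_iff_map_eq_zero]
    intro z hz
    rw [hTa] at hz
    have h1 : γ (z ∘ Sum.inl) = -(η (z ∘ Sum.inr) : Bits (R ⊕ Fin m)) := eq_neg_of_add_eq_zero_left hz
    have h2 : γ (z ∘ Sum.inl) = 0 := by
      have := Submodule.disjoint_def.1 hC.disjoint (γ (z ∘ Sum.inl)) (LinearMap.mem_range_self _ _)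
      refine this ?_
      rw [h1]
      exact C.neg_mem (η _).2
    have h3 : η (z ∘ Sum.inr) = 0 := by
      rw [h2, zero_add] at hz
      exact Subtype.ext hz
    have h4 := (injective_iff_map_eq_zero γ).1 hγ _ h2
    have h5 := η.map_eq_zero_iff.1 h3
    funext a
    cases a with
    | inl a => exact congrFun h4 a
    | inr a => exact congrFun h5 a
  refine ⟨LinearEquiv.ofInjectiveEndo T hT, fun z => ?_⟩
  rw [LinearEquiv.coe_ofInjectiveEndo, hTa, Sum.elim_comp_inl, Sum.elim_comp_inr, map_zero]
  simp

/-- Any matrix becomes the restriction to `n` of the columns of an encodable generator matrix after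
as many columns as its rank deficiency have been added. -/
theorem exists_encoder {n : ℕ} (ψ : Matrix R (Fin n) (ZMod 2)) :
    ∃ (m : ℕ) (G : Matrix R (R ⊕ Fin m) (ZMod 2)) (site : Fin n ↪ R ⊕ Fin m)
      (E : List (CnotPair (R ⊕ Fin m))),
      m + ψ.rank = n ∧ G.submatrix id site = ψ ∧
        ∀ z, circuitEquiv E (Sum.elim z 0) = G.transpose.mulVec z := by
  have hn : ψ.rank ≤ n := by simpa using ψ.rank_le_card_width
  have hR : ψ.rank ≤ Fintype.card R := ψ.rank_le_card_height
  -- Adding t columns raises the rank to the number of rows; the block then has n + t = |R| + m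
  -- qubits.
  set m := n - ψ.rank with hm
  set t := Fintype.card R - ψ.rank with ht
  have e : Fin n ⊕ Fin t ≃ R ⊕ Fin m := Fintype.equivOfCardEq (by
    simp only [Fintype.card_sum, Fintype.card_fin]; omega)
  have hker : Module.finrank (ZMod 2) (LinearMap.ker ψ.transpose.mulVecLin)
      = Module.finrank (ZMod 2) (Bits (Fin t)) := by
    have h1 := LinearMap.finrank_range_add_finrank_ker ψ.transpose.mulVecLin
    have h2 : Module.finrank (ZMod 2) (LinearMap.range ψ.transpose.mulVecLin) = ψ.rank := by
      rw [← Matrix.rank_transpose ψ]; rfl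
    simp only [Module.finrank_fintype_fun_eq_card, Fintype.card_fin] at h1 ⊢
    omega
  let κ := LinearEquiv.ofFinrankEq _ _ hker
  -- The new coordinates have to separate only the kernel of ψᵀ, where the given ones vanish, so any
  -- extension of κ will do.
  obtain ⟨q, hq⟩ := LinearMap.exists_extend κ.toLinearMap
  let γ : Bits R →ₗ[ZMod 2] Bits (R ⊕ Fin m) :=
    { toFun := fun z b => Sum.elim (ψ.transpose.mulVec z) (q z) (e.symm b)
      map_add' := fun z z' => by
        funext b
        simp only [Matrix.mulVec_add, map_add, Pi.add_apply]
        cases e.symm b <;> rfl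
      map_smul' := fun c z => by
        funext b
        simp only [Matrix.mulVec_smul, map_smul, Pi.smul_apply, RingHom.id_apply]
        cases e.symm b <;> rfl }
  have hγa : ∀ z b, γ z b = Sum.elim (ψ.transpose.mulVec z) (q z) (e.symm b) := fun _ _ => rfl
  have hγ : Function.Injective γ := by
    rw [injective_iff_map_eq_zero]
    intro z hz
    have h1 : ∀ a, Sum.elim (ψ.transpose.mulVec z) (q z) a = 0 := fun a => by
      have := congrFun hz (e a)
      rwa [hγa, Equiv.symm_apply_apply] at this
    have hzk : z ∈ LinearMap.ker ψ.transpose.mulVecLin :=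
      LinearMap.mem_ker.2 (funext fun c => h1 (Sum.inl c))
    have h2 : κ ⟨z, hzk⟩ = 0 := by
      have := LinearMap.congr_fun hq ⟨z, hzk⟩
      refine this.symm.trans (funext fun c => h1 (Sum.inr c))
    exact congrArg Subtype.val (κ.map_eq_zero_iff.1 h2)
  obtain ⟨T, hT⟩ := exists_linearEquiv_extending γ hγ
  obtain ⟨E, hE⟩ := exists_circuitEquiv_eq T
  refine ⟨m, (LinearMap.toMatrix' γ).transpose,
    ⟨fun c => e (Sum.inl c), fun a b h => Sum.inl_injective (e.injective h)⟩, E, by omega, ?_, ?_⟩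
  · ext a c
    rw [Matrix.submatrix_apply, Matrix.transpose_apply, LinearMap.toMatrix'_apply, hγa]
    show Sum.elim _ _ (e.symm (e (Sum.inl c))) = _
    rw [Equiv.symm_apply_apply, Sum.elim_inl, Matrix.mulVec_single_one]
    rfl
  · intro z
    rw [hE, hT, Matrix.transpose_transpose, ← Matrix.toLin'_apply, Matrix.toLin'_toMatrix']

end Encoder

/-! ### The columns at the T sites and quasitransversality -/

section Columns

variable {ι : Type} [Fintype ι] [DecidableEq ι]

/-- A form on the logical qubits as a form on the logical and gauge qubits. -/
def liftForm (φ : Form ι) : Form (ι ⊕ Fin 3) :=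
  φ ∘ₗ LinearMap.funLeft (ZMod 2) (ZMod 2) Sum.inl

/-- The value of the `i`-th gauge qubit. -/
def gaugeForm (ι : Type) (i : Fin 3) : Form (ι ⊕ Fin 3) := LinearMap.proj (Sum.inr i)

theorem liftForm_apply (φ : Form ι) (z : Bits (ι ⊕ Fin 3)) : liftForm φ z = φ (z ∘ Sum.inl) := rfl

/-- The eight columns that cancel the CCZ phase of the first two gauge qubits and `v`. -/
def cancelColumns (v : Form (ι ⊕ Fin 3)) : List (Form (ι ⊕ Fin 3)) :=
  [gaugeForm ι 2, gaugeForm ι 2 + gaugeForm ι 0, gaugeForm ι 2 + gaugeForm ι 1,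
    gaugeForm ι 2 + (gaugeForm ι 0 + gaugeForm ι 1), gaugeForm ι 2 + v,
    gaugeForm ι 2 + (gaugeForm ι 0 + v), gaugeForm ι 2 + (gaugeForm ι 1 + v),
    gaugeForm ι 2 + (gaugeForm ι 0 + gaugeForm ι 1 + v)]

/-- The columns of the generator matrix at the `T` sites. -/
def columns (A B : List (Form ι)) : List (Form (ι ⊕ Fin 3)) :=
  A.map (fun φ => liftForm φ + gaugeForm ι 0)
    ++ B.map (fun φ => liftForm φ + (gaugeForm ι 0 + gaugeForm ι 1))
    ++ B.map (fun φ => liftForm φ + gaugeForm ι 1)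
    ++ cancelColumns (liftForm B.sum)
    ++ (if Even A.length then [] else [gaugeForm ι 0])
    ++ (if Even B.length then [] else [gaugeForm ι 0 + gaugeForm ι 1, gaugeForm ι 1])

/-- Eight columns cancel the CCZ phase; an odd number of forms in A costs one padding column, and an
odd number in B costs one for each of the two copies. -/
theorem length_columns (A B : List (Form ι)) :
    ∃ Δ ≤ 11, (columns A B).length = A.length + 2 * B.length + Δ := by
  refine ⟨8 + (if Even A.length then 0 else 1) + if Even B.length then 0 else 2, ?_, ?_⟩
  · split_ifs <;> norm_num
  · simp only [columns, cancelColumns, List.length_append, List.length_map, List.length_cons,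
      List.length_nil]
    split_ifs <;> simp only [List.length_cons, List.length_nil] <;> ring

/-- Setting one gauge bit to 1 and everything else to 0 exposes the gauge part of a column: y₀ shows
in A and the first copy of B, y₁ in the second copy, y₂ in the cancelling columns. -/
theorem columns_detect (A B : List (Form ι)) :
    ∀ φ ∈ columns A B, ∃ i : Fin 3, φ (Pi.single (Sum.inr i) 1) ≠ 0 := by
  have hl : ∀ (φ : Form ι) (i : Fin 3), liftForm φ (Pi.single (Sum.inr i) 1) = 0 := fun φ i => by
    rw [liftForm_apply]
    have h0 : (Pi.single (Sum.inr i) 1 : Bits (ι ⊕ Fin 3)) ∘ Sum.inl = 0 := by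
      funext a; simp
    rw [h0, map_zero]
  have hg : ∀ i j : Fin 3, gaugeForm ι i (Pi.single (Sum.inr j) 1) = if i = j then 1 else 0 :=
    fun i j => by
      simp only [gaugeForm, LinearMap.proj_apply, Pi.single_apply, Sum.inr.injEq]
  intro φ hφ
  simp only [columns, List.mem_append, List.mem_map] at hφ
  rcases hφ with ((((⟨ψ, _, rfl⟩ | ⟨ψ, _, rfl⟩) | ⟨ψ, _, rfl⟩) | h) | h) | h
  · exact ⟨0, by simp [hl, hg]⟩
  · exact ⟨0, by simp [hl, hg]⟩
  · exact ⟨1, by simp [hl, hg]⟩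
  · refine ⟨2, ?_⟩
    simp only [cancelColumns, List.mem_cons, List.not_mem_nil, or_false] at h
    rcases h with rfl | rfl | rfl | rfl | rfl | rfl | rfl | rfl <;> simp [hl, hg]
  · split_ifs at h
    · simp at h
    · rw [List.mem_singleton] at h
      subst h
      exact ⟨0, by simp [hg]⟩
  · split_ifs at h
    · simp at h
    · refine ⟨1, ?_⟩
      simp only [List.mem_cons, List.not_mem_nil, or_false] at h
      rcases h with rfl | rfl <;> simp [hg]

theorem fun_add_mem {κ : Type} {H : AddSubgroup (Bits κ → ZMod 8)} {f g : Bits κ → ZMod 8}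
    (hf : f ∈ H) (hg : g ∈ H) : (fun x => f x + g x) ∈ H :=
  H.add_mem hf hg

theorem fun_sub_mem {κ : Type} {H : AddSubgroup (Bits κ → ZMod 8)} {f g : Bits κ → ZMod 8}
    (hf : f ∈ H) (hg : g ∈ H) : (fun x => f x - g x) ∈ H :=
  H.sub_mem hf hg

theorem sum_bit_add (L : List (Form ι)) (x : Bits ι) (b : ZMod 2) :
    (L.map fun φ => bit (φ x + b)).sum
      = (L.map fun φ => bit (φ x)).sum + L.length * bit b
        - 2 * bit b * (L.map fun φ => bit (φ x)).sum := by
  induction L with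
  | nil => simp
  | cons φ L ih =>
    rw [List.map_cons, List.sum_cons, ih, bit_add, List.map_cons, List.sum_cons, List.length_cons]
    push_cast
    ring

/-- Modulo 8, four times an integer depends only on its parity, and the parity of a sum of bits is
the bit of the sum of the forms. -/
theorem four_mul_sum_bit (L : List (Form ι)) (x : Bits ι) :
    4 * (L.map fun φ => bit (φ x)).sum = 4 * bit (L.sum x) := by
  have h8 : (8 : ZMod 8) = 0 := rfl
  induction L with
  | nil => simp [bit_zero]
  | cons φ L ih =>
    simp only [List.map_cons, List.sum_cons, LinearMap.add_apply, bit_add, mul_add, ih]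
    linear_combination (bit (φ x) * bit (L.sum x)) * h8

/-- As a function on the span of a, b, c shifted by d, the weight is 4 unless a = b = c = 0, when it
is 8d = 0. Modulo 8 this is 4(1 − (1−a)(1−b)(1−c)), independent of d; so d can be a gauge bit that
makes all eight columns detectable. -/
theorem cancel_identity (a b c d : ZMod 2) :
    bit d + (bit (d + a) + (bit (d + b) + (bit (d + (a + b)) + (bit (d + c)
      + (bit (d + (a + c)) + (bit (d + (b + c)) + bit (d + (a + b + c))))))))
      = 4 * bit a + 4 * bit b + 4 * bit c + 4 * bit a * bit b + 4 * bit a * bit c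
        + 4 * bit b * bit c + 4 * bit a * bit b * bit c := by
  revert a b c d; decide

theorem natCast_add_parity (n : ℕ) :
    ∃ c : ZMod 8, (n : ZMod 8) + (if Even n then 0 else 1) = 2 * c := by
  split_ifs with h
  · obtain ⟨m, rfl⟩ := h
    exact ⟨m, by push_cast; ring⟩
  · obtain ⟨m, rfl⟩ := Nat.not_even_iff_odd.1 h
    exact ⟨m + 1, by push_cast; ring⟩

theorem sum_bit_cancelColumns (v : Form (ι ⊕ Fin 3)) (z : Bits (ι ⊕ Fin 3)) :
    ((cancelColumns v).map fun φ => bit (φ z)).sum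
      = 4 * bit (gaugeForm ι 0 z) + 4 * bit (gaugeForm ι 1 z) + 4 * bit (v z)
          + 4 * bit (gaugeForm ι 0 z) * bit (gaugeForm ι 1 z)
          + 4 * bit (gaugeForm ι 0 z) * bit (v z) + 4 * bit (gaugeForm ι 1 z) * bit (v z)
          + 4 * bit (gaugeForm ι 0 z) * bit (gaugeForm ι 1 z) * bit (v z) := by
  rw [← cancel_identity _ _ _ (gaugeForm ι 2 z)]
  simp only [cancelColumns, List.map_cons, List.map_nil, List.sum_cons, List.sum_nil, add_zero,
    LinearMap.add_apply]

theorem sum_bit_columns (A B : List (Form ι)) (z : Bits (ι ⊕ Fin 3)) :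
    ((columns A B).map fun φ => bit (φ z)).sum
      = (A.map fun φ => bit (φ (z ∘ Sum.inl) + gaugeForm ι 0 z)).sum
        + (B.map fun φ => bit (φ (z ∘ Sum.inl) + (gaugeForm ι 0 z + gaugeForm ι 1 z))).sum
        + (B.map fun φ => bit (φ (z ∘ Sum.inl) + gaugeForm ι 1 z)).sum
        + ((cancelColumns (liftForm B.sum)).map fun φ => bit (φ z)).sum
        + (if Even A.length then 0 else 1) * bit (gaugeForm ι 0 z)
        + (if Even B.length then 0 else 1)
          * (bit (gaugeForm ι 0 z + gaugeForm ι 1 z) + bit (gaugeForm ι 1 z)) := by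
  simp only [columns, List.map_append, List.sum_append, List.map_map]
  congr 1
  · congr 1
    split_ifs
    · rw [zero_mul]; rfl
    · rw [one_mul, List.map_singleton, List.sum_singleton]
  · split_ifs
    · rw [zero_mul]; rfl
    · rw [one_mul, List.map_cons, List.sum_cons, List.map_singleton, List.sum_singleton,
        LinearMap.add_apply]

/-- The code is quasitransversal: on the code the `T` gates act as the diagonal unitary with phase
`F`, up to a Clifford phase. -/
theorem columns_quasitransversal (A B : List (Form ι)) {F f f' C : Bits ι → ZMod 8}
    (hf : f ∈ cliffordPhases ι) (hf' : f' ∈ cliffordPhases ι)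
    (hA : ∀ x, F x = (A.map fun φ => bit (φ x)).sum + f x)
    (hB : ∀ x, F x = (B.map fun φ => bit (φ x)).sum + f' x + 4 * C x) :
    (fun z : Bits (ι ⊕ Fin 3) => F (z ∘ Sum.inl) - ((columns A B).map fun φ => bit (φ z)).sum)
      ∈ cliffordPhases (ι ⊕ Fin 3) := by
  obtain ⟨g, hg, hfg⟩ := exists_of_mem_cliffordPhases hf
  obtain ⟨g', hg', hfg'⟩ := exists_of_mem_cliffordPhases hf'
  obtain ⟨cA, hcA⟩ := natCast_add_parity A.length
  obtain ⟨cB, hcB⟩ := natCast_add_parity B.length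
  set Y0 := gaugeForm ι 0
  set Y1 := gaugeForm ι 1
  set v := liftForm B.sum with hv
  have hlift : ∀ {h : Bits ι → ZMod 8}, h ∈ parityPhases ι →
      (fun z : Bits (ι ⊕ Fin 3) => h (z ∘ Sum.inl)) ∈ parityPhases (ι ⊕ Fin 3) := fun hh =>
    parityPhases_comp hh (LinearMap.funLeft (ZMod 2) (ZMod 2) Sum.inl)
  have hβ : (fun x => (B.map fun φ => bit (φ x)).sum) ∈ parityPhases ι :=
    list_sum_mem B fun φ _ => bit_form_mem φ
  -- This is the difference after cancellation, written in visibly Clifford terms: f = 2g, then −2β,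
  -- then 2y₀(α + β) with the CCZ phase gone, 4y₁β, the lower-order terms of the eight columns, and
  -- the linear gauge terms made even by the padding.
  have hmem : (fun z : Bits (ι ⊕ Fin 3) =>
      2 * g (z ∘ Sum.inl)
        + (-1) * (2 * (B.map fun φ => bit (φ (z ∘ Sum.inl))).sum)
        + 4 * bit (Y0 z) * ((B.map fun φ => bit (φ (z ∘ Sum.inl))).sum + g' (z ∘ Sum.inl)
            - g (z ∘ Sum.inl))
        + 4 * bit (Y1 z) * (B.map fun φ => bit (φ (z ∘ Sum.inl))).sum
        + (-1) * (2 * (2 * bit (Y0 z)) + 2 * (2 * bit (Y1 z)) + 2 * (2 * bit (v z))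
            + 4 * bit (Y0 z) * bit (Y1 z) + 4 * bit (Y0 z) * bit (v z)
            + 4 * bit (Y1 z) * bit (v z))
        + (-cA) * (2 * bit (Y0 z))
        + (-cB) * (2 * bit ((Y0 + Y1) z) + 2 * bit (Y1 z)))
      ∈ cliffordPhases (ι ⊕ Fin 3) := by
    have hY : ∀ φ : Form (ι ⊕ Fin 3), (fun z => 2 * bit (φ z)) ∈ cliffordPhases (ι ⊕ Fin 3) :=
      fun φ => two_mul_mem (bit_form_mem φ)
    have hYY : ∀ φ ψ : Form (ι ⊕ Fin 3),
        (fun z => 4 * bit (φ z) * bit (ψ z)) ∈ cliffordPhases (ι ⊕ Fin 3) :=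
      fun φ ψ => four_mul_bit_mul_mem φ (bit_form_mem ψ)
    refine fun_add_mem (fun_add_mem (fun_add_mem (fun_add_mem (fun_add_mem (fun_add_mem ?_ ?_) ?_)
      ?_) ?_) ?_) ?_
    · exact two_mul_mem (hlift hg)
    · exact const_mul_mem (-1) (two_mul_mem (hlift hβ))
    · exact four_mul_bit_mul_mem Y0 (fun_sub_mem (fun_add_mem (hlift hβ) (hlift hg')) (hlift hg))
    · exact four_mul_bit_mul_mem Y1 (hlift hβ)
    · exact const_mul_mem (-1) (fun_add_mem (fun_add_mem (fun_add_mem (fun_add_mem (fun_add_mem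
        (const_mul_mem 2 (hY Y0)) (const_mul_mem 2 (hY Y1))) (const_mul_mem 2 (hY v)))
        (hYY Y0 Y1)) (hYY Y0 v)) (hYY Y1 v))
    · exact const_mul_mem (-cA) (hY Y0)
    · exact const_mul_mem (-cB) (fun_add_mem (hY (Y0 + Y1)) (hY Y1))
  convert hmem using 1
  funext z
  have h8 : (8 : ZMod 8) = 0 := rfl
  have hsplit := sum_bit_columns A B z
  have hvz : 4 * (B.map fun φ => bit (φ (z ∘ Sum.inl))).sum = 4 * bit (v z) :=
    four_mul_sum_bit B _
  have e1 := hA (z ∘ Sum.inl)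
  have e2 := hB (z ∘ Sum.inl)
  rw [hsplit, sum_bit_cancelColumns, sum_bit_add, sum_bit_add, sum_bit_add, LinearMap.add_apply, bit_add (Y0 z)]
  clear hsplit hmem
  have e3 := hfg (z ∘ Sum.inl)
  have e4 := hfg' (z ∘ Sum.inl)
  generalize F (z ∘ Sum.inl) = F' at *
  generalize (A.map fun φ => bit (φ (z ∘ Sum.inl))).sum = α at *
  generalize (B.map fun φ => bit (φ (z ∘ Sum.inl))).sum = β at *
  generalize bit (Y0 z) = y0 at *
  generalize bit (Y1 z) = y1 at *
  generalize bit (v z) = w at *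
  generalize f (z ∘ Sum.inl) = fx at *
  generalize f' (z ∘ Sum.inl) = fx' at *
  generalize g (z ∘ Sum.inl) = gx at *
  generalize g' (z ∘ Sum.inl) = gx' at *
  generalize C (z ∘ Sum.inl) = Cx at *
  generalize (if Even A.length then 0 else 1 : ZMod 8) = pA at *
  generalize (if Even B.length then 0 else 1 : ZMod 8) = pB at *
  generalize (A.length : ZMod 8) = nA at *
  generalize (B.length : ZMod 8) = nB at *
  -- The multiple 2y₀ of the comparison of both forms of F replaces 2y₀α by 2y₀β and even phases, at
  -- the price of 8y₀C. `hvz` identifies 4y₀y₁β with 4y₀y₁v, which adds to the cubic term of the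
  -- eight columns to give a multiple of 8.
  linear_combination e1 + e3 + 2 * y0 * (e2 - e1 + e4 - e3) + y0 * Cx * h8 - y0 * y1 * hvz
    - y0 * y1 * w * h8 - y0 * hcA - (y0 + y1 - 2 * y0 * y1 + y1) * hcB

end Columns

/-- The matrix with the given columns. -/
def formMatrix {R : Type} [DecidableEq R] (L : List (Form R)) : Matrix R (Fin L.length) (ZMod 2) :=
  Matrix.of fun a c => L.get c (Pi.single a 1)

theorem formMatrix_transpose_mulVec {R : Type} [Fintype R] [DecidableEq R] (L : List (Form R))
    (z : Bits R) (c : Fin L.length) : ((formMatrix L).transpose.mulVec z) c = L.get c z := by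
  rw [LinearMap.pi_apply_eq_sum_univ (L.get c) z, Matrix.mulVec, dotProduct]
  refine Finset.sum_congr rfl fun a _ => ?_
  rw [smul_eq_mul, mul_comm, Matrix.transpose_apply, formMatrix, Matrix.of_apply]
  congr 2
  funext b
  rw [Pi.single_apply]
  exact if_congr eq_comm rfl rfl

/-- The columns from optimal circuits for U_F and its best factor up to CCZ gates are completed to a
full-rank generator matrix with s = 3. The added columns carry no T gate and affect neither the
phase nor the detection of errors. -/
theorem exists_synthillation {l : ℕ} {k : Fin l → ℕ} {U : ∀ j, Op (Fin (k j))}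
    (Fj : ∀ j, Bits (Fin (k j)) → ZMod 8) (hFj : ∀ j, Fj j ∈ parityPhases (Fin (k j)))
    (hU : ∀ j, U j = Matrix.diagonal fun x => ph (Fj j x)) :
    ∃ (P : Synthillation k U) (Δ : ℕ), Δ ≤ 11 ∧ P.DetectsSingle ∧
      (P.n : ℕ∞) = tau (tensorOp U) + 2 * mu (tensorOp U) + Δ := by
  obtain ⟨F, hF, hUF⟩ := tensorOp_diagonal Fj hFj hU
  obtain ⟨A, B, hA, hB, f, hf, g, hg, C, hFA, hFB⟩ := exists_optimal_forms hF hUF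
  obtain ⟨Δ, hΔ, hlen⟩ := length_columns A B
  set L := columns A B with hL
  obtain ⟨m, G, site, E, hm, hG, hE⟩ := exists_encoder (formMatrix L)
  obtain ⟨corr, hcorr⟩ := exists_clifford_circuit (columns_quasitransversal A B hf hg hFA hFB)
  choose fix hfix using fun j a => exists_fixup (hFj j) (hU j) a
  have hsite : ∀ z c, (G.transpose.mulVec z) (site c) = L.get c z := fun z c => by
    rw [← formMatrix_transpose_mulVec, ← hG]
    rfl
  refine ⟨{ n := L.length, s := 3, m := m, G := G, site := site, site_spec := by rw [hG]; exact hm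
            encoder := E, encoder_spec := fun z => ?_
            correction := corr, correction_spec := ⟨_, hcorr, fun z => ?_⟩
            fixup := fix, fixup_spec := hfix }, Δ, hΔ, fun c => ?_, ?_⟩
  · rw [circuitOp_cnot, permOp_mulVec_ket, hE]
  · simp only [hsite]
    rw [← ph_natCast, ← ph_add, hUF, Matrix.diagonal_apply_eq]
    congr 1
    have hsum : ((∑ c, (L.get c z).val : ℕ) : ZMod 8) = (L.map fun φ => bit (φ z)).sum := by
      rw [Nat.cast_sum, ← List.sum_ofFn, ← List.ofFn_getElem_eq_map]
      rfl
    rw [hsum, sub_add_cancel]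
  -- The syndrome of a single error at c is the column of G at that site, so its gauge part is the
  -- gauge part of the c-th form.
  · obtain ⟨i, hi⟩ := columns_detect A B (L.get c) (List.get_mem _ _)
    refine fun h => hi ?_
    have h1 := congrFun h i
    simp only [Function.comp_apply, Synthillation.syndrome, hG, Matrix.mulVec_single_one] at h1
    exact h1
  · show ((L.length : ℕ) : ℕ∞) = _
    rw [hlen, ← hA, ← hB]
    push_cast
    rfl

end Synth

theorem theorem1 {l : ℕ} (k : Fin l → ℕ) (U : ∀ j : Fin l, Synth.Op (Fin (k j)))
    (hU : ∀ j, U j ∈ Synth.D3 (Fin (k j))) :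
    ∃ (P : Synth.Synthillation k U) (Δ : ℕ) (p err : ℝ → ℝ),
      Δ ≤ 11 ∧
      (P.n : ℕ∞) = Synth.tau (Synth.tensorOp U) + 2 * Synth.mu (Synth.tensorOp U) + Δ ∧
      (P.n : ℕ∞) ≤ 3 * Synth.tau (Synth.tensorOp U) + Δ ∧
      (fun ε : ℝ => p ε - (1 - P.n * ε)) =O[𝓝[≥] (0 : ℝ)] (fun ε : ℝ => ε ^ 2) ∧
      err =O[𝓝[≥] (0 : ℝ)] (fun ε : ℝ => ε ^ 2) ∧
      ∀ ε ∈ Set.Icc (0 : ℝ) 1,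
        0 ≤ err ε ∧ err ε ≤ 1 ∧
        ∀ (D : Type) [Fintype D] [DecidableEq D] (place : ∀ j : Fin l, Fin (k j) ↪ D)
          (V : Fin l → Synth.Op D) (ρ : Synth.Op D),
          (∀ j, V j ∈ Matrix.unitaryGroup (Synth.Bits D) ℂ) → Synth.IsState ρ →
          (P.accepted place V ε ρ).trace = (p ε : ℂ) ∧
          ∃ η : Synth.Op D, Synth.IsState η ∧
            P.accepted place V ε ρ
              = (p ε : ℂ) • (((1 - err ε : ℝ) : ℂ) • Synth.ideal U place V ρ
                  + (err ε : ℂ) • η) := by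
  choose F hF hUF using fun j => Synth.exists_parityPhase_of_mem_D3 (hU j)
  obtain ⟨P, Δ, hΔ, hP, hn⟩ := Synth.exists_synthillation F hF hUF
  refine ⟨P, Δ, P.successProb, P.errorRate, hΔ, hn, ?_, P.successProb_isBigO hP,
    P.errorRate_isBigO hP, fun ε hε => ⟨(P.errorRate_mem hε).1, (P.errorRate_mem hε).2, ?_⟩⟩
  · rw [hn, show (3 : ℕ∞) = 1 + 2 by norm_num, add_mul, one_mul]
    gcongr
    exact Synth.mu_le_tau _
  · intro D _ _ place V ρ hV hρ
    exact P.accepted_spec (fun j => ⟨_, hUF j⟩)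
      (fun j => by rw [hUF j]; exact Synth.diagonal_ph_mem_unitaryGroup _) place V hV hε hρ
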